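/- Let $\mathbb S=\mathbb R/2\pi\mathbb Z$, and let $\Sigma_\infty$ be the set of configurations $\hat\eta=(\tilde\eta_x,\theta_x)_{x\in\mathbb Z^2}$ in which each site $x$ is empty (then $\theta_x=0$ by convention) or carries one particle, active ($a$) or passive ($p$), with an angle $\theta_x\in\mathbb S$. For $\sigma\in\{a,p\}$ let $\eta^\sigma_x\in\{0,1\}$ be the number of particles of type $\sigma$ at $x$, $\eta_x=\eta_x^a+\eta_x^p$, and $\eta_x^{\sigma,\Phi}=\Phi(\theta_x)\eta^\sigma_x$ for $\Phi:\mathbb S\to\mathbb R$. Let $\hat\eta^{x,y}$ be $\hat\eta$ with the states at $x$ and $y$ exchanged, and let $\tau_xf(\hat\eta)=f((\hat\eta_{y+x})_{y})$. Let $\hat{\boldsymbol\alpha}=(\hat\alpha^a,\hat\alpha^p)$ be a pair of non-negative measures on $\mathbb S$ with $\hat\alpha^a(\mathbb S)+\hat\alpha^p(\mathbb S)\le 1$, and let $\mu_{\hat{\boldsymbol\alpha}}$ be the product measure on $\Sigma_\infty$ under which each site carries a particle of type $\sigma$ with angle in $d\theta$ with probability $\hat\alpha^\sigma(d\theta)$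 and is empty otherwise. Fix $\omega\in C^2(\mathbb S)$. A cylinder function is a function $f:\Sigma_\infty\to\mathbb R$ that depends on finitely many sites and is $C^2$ in each angle. Let $T^\omega$ be the linear span of the cylinder functions of the form $\sum_{x\in\mathbb Z^2}(a\eta^a_x+b\eta^p_x+c\eta^{a,\omega}_x+d\eta^{p,\omega}_x)F_x$ with $a,b,c,d\in\mathbb R$, where every $F_x$ depends only on the occupation variables $(\eta_y)_{y}$. Let $\mathcal T^\omega_0$ be the set of those $h\in T^\omega$ such that, for every box $B_l=\{-l,\dots,l\}^2$ containing the sites on which $h$ depends, $h$ has mean zero under every canonical measure on $B_l$ with at least two empty sites, that is, under the uniform distribution over the rearrangements in $B_l$ of any given particles (types and angles) in number at most $|B_l|-2$. A differential form is a family $\mathfrak u=(\mathfrak u_{x,x+z})_{x\in\mathbb Z^2,|z|=1}$ of functions in $L^2(\mu_{\hat{\boldsymbol\alpha}})$ with $\mathfrak u_{x,x+z}=\eta_x(1-\eta_{x+z})\mathfrak u_{x,x+z}$ on $\Sigma_\infty$. It is closed if, for every $\hat\eta\in\Sigma_\infty$ and every finite sequence of nearest-neighbour jumps of particles to empty sites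 that starts from $\hat\eta$ and ends at $\hat\eta$, the sum of the values of $\mathfrak u$ along the sequence (each taken at the configuration just before the jump) is $0$. A pair $\mathfrak U=(\mathfrak u_1,\mathfrak u_2)$ of functions in $L^2(\mu_{\hat{\boldsymbol\alpha}})$ is a germ of a closed form if $\mathfrak u_{x,x+e_i}=\tau_x\mathfrak u_i$, $\mathfrak u_{x,x-e_i}(\hat\eta)=-\mathfrak u_{x-e_i,x}(\hat\eta^{x,x-e_i})$, $i=1,2$, defines a closed form. For a cylinder function $h$ put $$\boldsymbol\nabla\Sigma_h=\Big(\eta_0(1-\eta_{e_i})\sum_{x\in\mathbb Z^2}\big(\tau_xh(\hat\eta^{0,e_i})-\tau_xh(\hat\eta)\big)\Big)_{i=1,2},$$ and let $\mathfrak j^{\sigma,\Phi,i}$ be the pair with $k$-th component $\delta_{i,k}\,\eta_0^{\sigma,\Phi}(1-\eta_{e_i})$, with $\mathfrak j^{\sigma,i}=\mathfrak j^{\sigma,1,i}$. In the space of pairs with norm $\mathbb E_{\mu_{\hat{\boldsymbol\alpha}}}[\mathfrak u_1^2+\mathfrak u_2^2]^{1/2}$, let $\mathfrak T^\omega$ be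 the closure of the set of germs of closed forms with both components in $T^\omega$, let $\mathfrak E^\omega$ be the closure of $\{\boldsymbol\nabla\Sigma_h : h\in\mathcal T_0^\omega\}$, and let $\mathfrak J^\omega$ be the (finite-dimensional) span of $\mathfrak j^{a,i},\mathfrak j^{p,i},\mathfrak j^{a,\omega,i},\mathfrak j^{p,\omega,i}$, $i=1,2$. Then $\mathfrak T^\omega$ and $\mathfrak E^\omega$ are linear subspaces, and $$\mathfrak T^\omega=\mathfrak E^\omega\oplus\mathfrak J^\omega ,$$ that is, $\mathfrak T^\omega=\mathfrak E^\omega+\mathfrak J^\omega$ and $\mathfrak E^\omega\cap\mathfrak J^\omega=\{0\}$. -/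

import Mathlib

open MeasureTheory
open scoped ENNReal

noncomputable section

namespace ActivePassive

/-! ### Configurations -/

/-- The angular domain, the circle of length `2π`. -/
abbrev Angle : Type := AddCircle (2 * Real.pi)

/-- The two types of particles. -/
inductive Species
  | active
  | passive
  deriving DecidableEq

instance : MeasurableSpace (Option Species) := ⊤

/-- The state of one site: `none` (empty) or `some σ` (a particle of type `σ`), with an angle
that is `0` by convention at an empty site. -/
abbrev SiteState : Type := {s : Option Species × Angle // s.1 = none → s.2 = 0}

/-- The lattice `ℤ²`. -/
abbrev Z2 : Type := ℤ × ℤ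

/-- The space `Σ_∞` of infinite configurations. -/
abbrev Config : Type := Z2 → SiteState

/-- The canonical basis `e_1, e_2` of the lattice. -/
def e (i : Fin 2) : Z2 := if i = 0 then (1, 0) else (0, 1)

def SiteState.empty : SiteState := ⟨(none, 0), fun _ => rfl⟩

def SiteState.particle (σ : Species) (θ : Angle) : SiteState :=
  ⟨(some σ, θ), fun h => nomatch h⟩

/-- Change of the angle of the particle at a site; nothing happens at an empty site. -/
def SiteState.withAngle (s : SiteState) (θ : Angle) : SiteState :=
  match s.1.1 with
  | none => s
  | some σ => SiteState.particle σ θ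

/-- The number, `0` or `1`, of particles of type `σ` at a site. -/
def SiteState.count (s : SiteState) (σ : Species) : ℝ := if s.1.1 = some σ then 1 else 0

/-- `η_x^σ ∈ {0, 1}`. -/
def num (σ : Species) (x : Z2) (η : Config) : ℝ := (η x).count σ

/-- `η_x = η_x^a + η_x^p`. -/
def occ (x : Z2) (η : Config) : ℝ := num .active x η + num .passive x η

/-- `η_x^{σ,Φ} = Φ(θ_x) η_x^σ`. -/
def numW (σ : Species) (Φ : Angle → ℝ) (x : Z2) (η : Config) : ℝ := Φ (η x).1.2 * num σ x η

/-- The translated configuration: `τ_x f (η) = f (shift x η)`. -/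
def shift (x : Z2) (η : Config) : Config := fun y => η (y + x)

/-- `η^{x,y}`, the states of the sites `x` and `y` being exchanged. -/
def swap (x y : Z2) (η : Config) : Config :=
  fun w => η (Equiv.swap x y w)

/-- A twice continuously differentiable function on the circle. -/
def IsC2 (Φ : Angle → ℝ) : Prop := ContDiff ℝ 2 (fun t : ℝ => Φ (t : Angle))

/-! ### Grand canonical measures -/

/-- A grand canonical parameter: two non-negative measures on the circle, of total mass at
most one together. -/
structure GrandParam where
  meas : Species → Measure Angle
  mass_le_one : meas .active Set.univ + meas .passive Set.univ ≤ 1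

/-- The law of the state of one site: a particle of type `σ` with an angle in `dθ` with
probability `meas σ (dθ)`, and empty with the remaining probability. -/
def siteMeasure (α : GrandParam) : Measure SiteState :=
  (α.meas .active).map (SiteState.particle .active)
    + (α.meas .passive).map (SiteState.particle .passive)
    + (1 - (α.meas .active Set.univ + α.meas .passive Set.univ)) • Measure.dirac SiteState.empty

theorem measurable_particle (σ : Species) : Measurable (SiteState.particle σ) :=
  Measurable.subtype_mk (measurable_const.prodMk measurable_id)

instance (α : GrandParam) : IsProbabilityMeasure (siteMeasure α) := ⟨by
  simp only [siteMeasure, Measure.add_apply, Measure.smul_apply,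
    Measure.map_apply (measurable_particle _) MeasurableSet.univ, Set.preimage_univ,
    measure_univ, smul_eq_mul, mul_one]
  exact add_tsub_cancel_of_le α.mass_le_one⟩

/-- The grand canonical measure with parameter `α`: the product measure on `Σ_∞`. -/
def grandMeasure (α : GrandParam) : Measure Config :=
  Measure.infinitePi (fun _ : Z2 => siteMeasure α)

/-! ### Cylinder functions and the class `T^ω` -/

/-- A cylinder function: it depends on finitely many sites and is `C²` in each angle. -/
def IsCylinder (f : Config → ℝ) : Prop :=
  (∃ s : Finset Z2, DependsOn f (s : Set Z2)) ∧
    ∀ (η : Config) (x : Z2),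
      ContDiff ℝ 2 (fun t : ℝ => f (Function.update η x ((η x).withAngle (t : Angle))))

/-- The box `B_l = [-l, l]²`. -/
def box (l : ℕ) : Finset Z2 := Finset.Icc (-(l : ℤ), -(l : ℤ)) ((l : ℤ), (l : ℤ))

/-- Mean of `ψ` under the canonical measure on the box `B_l` with the particles (types and
angles) that `ζ` has there: all rearrangements of these particles inside the box are equally
likely. Outside the box the configuration is kept, which is irrelevant for functions that
depend on the sites of the box only. -/
def canonicalMean (l : ℕ) (ζ : Config) (ψ : Config → ℝ) : ℝ :=
  (∑ π : Equiv.Perm {x // x ∈ box l}, ψ (fun x => ζ (Equiv.Perm.ofSubtype π x))) /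
    (Fintype.card (Equiv.Perm {x // x ∈ box l}) : ℝ)

/-- The class `𝒞₀` of cylinder functions with mean zero under every canonical measure with at
least two empty sites, on every box that carries the function. -/
def IsCenteredCylinder (ψ : Config → ℝ) : Prop :=
  IsCylinder ψ ∧
    ∀ l : ℕ, DependsOn ψ (box l : Set Z2) →
      ∀ ζ : Config,
        (∃ x ∈ box l, ∃ y ∈ box l, x ≠ y ∧ (ζ x).1.1 = none ∧ (ζ y).1.1 = none) →
          canonicalMean l ζ ψ = 0

/-- Functions that see only which sites are occupied: they are blind to types and angles. -/
def IsBlind (F : Config → ℝ) : Prop :=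
  ∀ η ξ : Config, (∀ x, (η x).1.1 = none ↔ (ξ x).1.1 = none) → F η = F ξ

/-- The space `T^ω`: the span of the cylinder functions
`∑_x (a η_x^a + b η_x^p + c η_x^{a,ω} + d η_x^{p,ω}) F_x(η)` with blind `F_x`. -/
def Tω (ω : Angle → ℝ) : Submodule ℝ (Config → ℝ) :=
  Submodule.span ℝ {f | IsCylinder f ∧
    ∃ (a b c d : ℝ) (F : Z2 → Config → ℝ), (∀ x, IsBlind (F x)) ∧
      ∀ η, HasSum (fun x => (a * num .active x η + b * num .passive x η
        + c * numW .active ω x η + d * numW .passive ω x η) * F x η) (f η)}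

/-! ### Closed forms -/

/-- A nearest-neighbour jump: from the site `src` in the direction `e_i` (if `fwd` is `true`)
or `-e_i` (if `fwd` is `false`). -/
structure Jump where
  src : Z2
  dir : Fin 2
  fwd : Bool

/-- The site at which a jump ends. -/
def Jump.tgt (j : Jump) : Z2 := if j.fwd then j.src + e j.dir else j.src - e j.dir

/-- The configuration after a jump. -/
def Jump.apply (j : Jump) (η : Config) : Config := swap j.src j.tgt η

/-- A path of jumps that can be performed one after the other, starting from `η`. -/
def IsLicit : Config → List Jump → Prop
  | _, [] => True
  | η, j :: γ => occ j.src η * (1 - occ j.tgt η) = 1 ∧ IsLicit (j.apply η) γ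

/-- The final configuration of a path that starts from `η`. -/
def pathEnd : Config → List Jump → Config
  | η, [] => η
  | η, j :: γ => pathEnd (j.apply η) γ

/-- The integral of `u` along a path that starts from `η`. -/
def pathIntegral (u : Jump → Config → ℝ) : Config → List Jump → ℝ
  | _, [] => 0
  | η, j :: γ => u j η + pathIntegral u (j.apply η) γ

/-- Differential forms: collections of `L²` functions, one for each nearest-neighbour jump, that
vanish where the jump cannot be performed. -/
def IsDifferentialForm (α : GrandParam) (u : Jump → Config → ℝ) : Prop :=
  ∀ j, MemLp (u j) 2 (grandMeasure α) ∧ ∀ η, u j η = occ j.src η * (1 - occ j.tgt η) * u j η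

/-- Closed forms: the integral along every licit closed path vanishes. -/
def IsClosedForm (α : GrandParam) (u : Jump → Config → ℝ) : Prop :=
  IsDifferentialForm α u ∧
    ∀ (η : Config) (γ : List Jump), IsLicit η γ → pathEnd η γ = η → pathIntegral u η γ = 0

/-- The form generated by a pair `U = (u_1, u_2)`: `u_{x,x+e_i} = τ_x u_i` and
`u_{x,x-e_i}(η) = - u_{x-e_i,x}(η^{x,x-e_i})`. -/
def germForm (U : Config → EuclideanSpace ℝ (Fin 2)) (j : Jump) (η : Config) : ℝ :=
  if j.fwd then U (shift j.src η) j.dir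
  else - U (shift (j.src - e j.dir) (swap j.src (j.src - e j.dir) η)) j.dir

/-- Germs of closed forms. -/
def IsClosedGerm (α : GrandParam) (U : Config → EuclideanSpace ℝ (Fin 2)) : Prop :=
  MemLp U 2 (grandMeasure α) ∧ IsClosedForm α (germForm U)

/-- The pair `∇Σ_h = (∇_{0,e_1} Σ_h, ∇_{0,e_2} Σ_h)` for the formal sum `Σ_h = ∑_x τ_x h`; for
a local function `h` only finitely many differences are non-zero. -/
def gradSum (h : Config → ℝ) (η : Config) : EuclideanSpace ℝ (Fin 2) :=
  WithLp.toLp 2 fun i =>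
    occ 0 η * (1 - occ (e i) η) * ∑ᶠ x : Z2, (h (shift x (swap 0 (e i) η)) - h (shift x η))

/-- The germ of a current form: its `k`-th component is `δ_{i,k} η_0^{σ,Φ} (1 - η_{e_i})`. -/
def currentGerm (σ : Species) (Φ : Angle → ℝ) (i : Fin 2) (η : Config) :
    EuclideanSpace ℝ (Fin 2) :=
  EuclideanSpace.single i (numW σ Φ 0 η * (1 - occ (e i) η))

/-! ### The spaces of germs in `L²` -/

/-- The space of pairs of `L²(μ_α)` functions, with the norm `E[u_1² + u_2²]^{1/2}`. -/
abbrev L2 (α : GrandParam) : Type := Lp (EuclideanSpace ℝ (Fin 2)) 2 (grandMeasure α)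

/-- The classes in `L²` of the germs of closed forms with components in `T^ω`. -/
def closedGerms (α : GrandParam) (ω : Angle → ℝ) : Set (L2 α) :=
  {g | ∃ U : Config → EuclideanSpace ℝ (Fin 2), IsClosedGerm α U ∧
    (∀ i, (fun η => U η i) ∈ Tω ω) ∧ g =ᵐ[grandMeasure α] U}

/-- The classes in `L²` of the germs `∇Σ_h` with `h` in `𝒞₀ ∩ T^ω`. -/
def exactGerms (α : GrandParam) (ω : Angle → ℝ) : Set (L2 α) :=
  {g | ∃ h : Config → ℝ, IsCenteredCylinder h ∧ h ∈ Tω ω ∧ g =ᵐ[grandMeasure α] gradSum h}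

/-- The span of the germs of the current forms `j^{σ,i}` and `j^{σ,ω,i}`, for both types `σ` and
`i = 1, 2`. -/
def currentForms (α : GrandParam) (ω : Angle → ℝ) : Submodule ℝ (L2 α) :=
  Submodule.span ℝ {g | ∃ (σ : Species) (i : Fin 2),
    g =ᵐ[grandMeasure α] currentGerm σ (fun _ => 1) i ∨ g =ᵐ[grandMeasure α] currentGerm σ ω i}

end ActivePassive

end

open ActivePassive

/-!
A germ of a closed form with components in `T^ω` acts on a lonely particle through a current.
Without this current the form vanishes at isolated particles, so that it is exact: the value of its
potential is minus the cost of moving all the particles far to the right, one after the other and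
starting with the last one in the lexicographic order. This potential is the formal sum of a local
function, because a particle that is alone after `r + 1` steps moves on for free, and closedness
makes the order of the exits irrelevant. Hence every such germ is of the form `∇Σ_h + current ψ`.
Subtracting from `h` its canonical average over a large box makes `h` centred and hardly changes
`∇Σ_h`.

The sum is direct since the norm of `∇Σ_h + current ψ` controls the current. This form is the
differential of the formal potential `Σ_h + ∑_x ∑_i x_i ψ_i(η_x)`. Let `D` be the change of the
potential under the cyclic rotation of the sites `0, e_i, e_j`. The expectation of `ψ_i(η_0) D` is
half that of `(ψ_i(η_0) - ψ_i(η_{e_i}))^2`: by exchangeability, the contribution of `h` drops out.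
On the other hand, the rotation can be performed by jumps only, with the help of the first hole on
a ray. The probability that this hole is distant decays exponentially, so the expectation is at most
a constant times the norm of `∇Σ_h + current ψ`.
-/

noncomputable section

namespace ActivePassive

/-! ### Configurations and relabelling of sites -/

section Configurations

variable {x y w : Z2} {η : Config}

lemma SiteState.eq_empty_iff {s : SiteState} : s = SiteState.empty ↔ s.1.1 = none :=
  ⟨by rintro rfl; rfl, fun h => Subtype.ext (Prod.ext h (s.2 h))⟩

lemma SiteState.count_empty (σ : Species) : SiteState.empty.count σ = 0 := rfl

lemma SiteState.particle_ne_empty (σ : Species) (θ : Angle) :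
    SiteState.particle σ θ ≠ SiteState.empty := by
  simp [SiteState.eq_empty_iff, SiteState.particle]

/-- The particle at `x` may jump to `y`: the exclusion constraint `η_x (1 - η_y) = 1`. -/
def CanJump (η : Config) (x y : Z2) : Prop := η x ≠ SiteState.empty ∧ η y = SiteState.empty

lemma occ_of_empty (h : η x = SiteState.empty) : occ x η = 0 := by
  simp [occ, num, h, SiteState.count_empty]

lemma occ_of_ne_empty (h : η x ≠ SiteState.empty) : occ x η = 1 := by
  rw [Ne, SiteState.eq_empty_iff] at h
  obtain ⟨_ | _, hσ⟩ := Option.ne_none_iff_exists'.1 h <;> simp [occ, num, SiteState.count, hσ]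

lemma occ_mul_vacant_of_not_canJump (h : ¬ CanJump η x y) : occ x η * (1 - occ y η) = 0 := by
  by_cases hx : η x = SiteState.empty
  · rw [occ_of_empty hx, zero_mul]
  · rw [occ_of_ne_empty fun hy => h ⟨hx, hy⟩, sub_self, mul_zero]

lemma CanJump.occ_mul_vacant (h : CanJump η x y) : occ x η * (1 - occ y η) = 1 := by
  rw [occ_of_ne_empty h.1, occ_of_empty h.2, sub_zero, mul_one]

lemma occ_mul_vacant_eq_one_iff : occ x η * (1 - occ y η) = 1 ↔ CanJump η x y :=
  ⟨fun h => by_contra fun hn => by simp [occ_mul_vacant_of_not_canJump hn] at h,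
    CanJump.occ_mul_vacant⟩

/-- The configuration with permuted sites. Both `shift` and `swap` are of this form, by
definition. -/
def permute (π : Equiv.Perm Z2) (η : Config) : Config := fun x => η (π x)

/-- The configuration that has at `x` the state of `η` at `g x`, and is empty at `x` if
`g x = none`. -/
def relabel (g : Z2 → Option Z2) (η : Config) : Config :=
  fun x => (g x).elim SiteState.empty η

open Classical in
/-- The configuration that keeps the particles in `s` only. -/
def truncate (s : Set Z2) (η : Config) : Config :=
  relabel (fun x => if x ∈ s then some x else none) η

lemma truncate_of_mem {s : Set Z2} (h : x ∈ s) : truncate s η x = η x := by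
  simp [truncate, relabel, h]

lemma truncate_of_notMem {s : Set Z2} (h : x ∉ s) : truncate s η x = SiteState.empty := by
  simp [truncate, relabel, h]

lemma permute_permute (π ρ : Equiv.Perm Z2) (η : Config) :
    permute π (permute ρ η) = permute (ρ * π) η := rfl

lemma shift_shift (x y : Z2) (η : Config) : shift x (shift y η) = shift (x + y) η := by
  funext w; simp only [shift, add_assoc]

lemma shift_zero (η : Config) : shift 0 η = η := by funext w; simp only [shift, add_zero]

lemma swap_swap (x y : Z2) (η : Config) : swap x y (swap x y η) = η := by
  funext w; simp only [swap, Equiv.swap_apply_self]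

lemma swap_left (x y : Z2) (η : Config) : swap x y η x = η y := by
  rw [swap, Equiv.swap_apply_left]

lemma swap_right (x y : Z2) (η : Config) : swap x y η y = η x := by
  rw [swap, Equiv.swap_apply_right]

lemma swap_of_ne (η : Config) (hx : w ≠ x) (hy : w ≠ y) : swap x y η w = η w := by
  rw [swap, Equiv.swap_apply_of_ne_of_ne hx hy]

lemma swap_comm (x y : Z2) (η : Config) : swap x y η = swap y x η := by
  funext w; rw [swap, swap, Equiv.swap_comm]

lemma swap_shift (a b x : Z2) (η : Config) :
    swap a b (shift x η) = shift x (swap (a + x) (b + x) η) := by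
  funext w
  exact congrArg η ((add_left_injective x).map_swap a b w)

lemma swap_eq_self (h : η x = η y) : swap x y η = η := by
  funext w
  rcases eq_or_ne w x with rfl | hx
  · rw [swap_left, h]
  rcases eq_or_ne w y with rfl | hy
  · rw [swap_right, h]
  exact swap_of_ne η hx hy

lemma e_ne_zero (i : Fin 2) : e i ≠ 0 := by
  fin_cases i <;> simp [e, Prod.ext_iff]

end Configurations

/-! ### Algebras of observables -/

/-- The function depends on finitely many coordinates. -/
def IsLocal {ι S β : Type*} (f : (ι → S) → β) : Prop :=
  ∃ s : Finset ι, DependsOn f (s : Set ι)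

lemma isLocal_apply {ι S β : Type*} (ψ : S → β) (i : ι) : IsLocal fun η : ι → S => ψ (η i) :=
  ⟨{i}, fun _ _ h => congrArg ψ (h i (by simp))⟩

lemma IsLocal.map₂ {ι S β γ δ : Type*} {f : (ι → S) → β} {g : (ι → S) → γ} (hf : IsLocal f)
    (hg : IsLocal g) (m : β → γ → δ) : IsLocal fun η => m (f η) (g η) := by
  classical
  obtain ⟨s, hs⟩ := hf
  obtain ⟨t, ht⟩ := hg
  refine ⟨s ∪ t, fun η ξ h => ?_⟩
  rw [Finset.coe_union] at h
  exact congrArg₂ m (hs fun x hx => h x (.inl hx)) (ht fun x hx => h x (.inr hx))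

lemma IsLocal.comp_relabel {f : Config → ℝ} (hf : IsLocal f) (g : Z2 → Option Z2) :
    IsLocal fun η => f (relabel g η) := by
  obtain ⟨s, hs⟩ := hf
  refine ⟨s.biUnion fun x => (g x).toFinset, fun η ξ h => hs fun x hx => ?_⟩
  rcases hg : g x with _ | y
  · simp only [relabel, hg, Option.elim_none]
  · simpa only [relabel, hg, Option.elim_some] using
      h y (Finset.mem_coe.2 (Finset.mem_biUnion.2 ⟨x, hx, by simp [hg]⟩))

/-- The algebra of local functions. -/
def localFunctions (ι S : Type*) : Subalgebra ℝ ((ι → S) → ℝ) where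
  carrier := {f | IsLocal f}
  mul_mem' hf hg := hf.map₂ hg (· * ·)
  add_mem' hf hg := hf.map₂ hg (· + ·)
  algebraMap_mem' _ := ⟨∅, fun _ _ _ => rfl⟩

/-- The algebra of bounded measurable functions. -/
def boundedMeasurable (X : Type*) [MeasurableSpace X] : Subalgebra ℝ (X → ℝ) where
  carrier := {f | Measurable f ∧ ∃ C, ∀ x, |f x| ≤ C}
  mul_mem' := by
    rintro f g ⟨hf, A, hA⟩ ⟨hg, B, hB⟩
    refine ⟨hf.mul hg, A * B, fun x => ?_⟩
    rw [Pi.mul_apply, abs_mul]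
    exact mul_le_mul (hA x) (hB x) (abs_nonneg _) ((abs_nonneg _).trans (hA x))
  add_mem' := by
    rintro f g ⟨hf, A, hA⟩ ⟨hg, B, hB⟩
    exact ⟨hf.add hg, A + B, fun x => (abs_add_le _ _).trans (add_le_add (hA x) (hB x))⟩
  algebraMap_mem' r := ⟨measurable_const, |r|, fun _ => le_rfl⟩

lemma comp_mem_boundedMeasurable {X Y : Type*} [MeasurableSpace X] [MeasurableSpace Y]
    {f : Y → ℝ} (hf : f ∈ boundedMeasurable Y) {g : X → Y} (hg : Measurable g) :
    (fun x => f (g x)) ∈ boundedMeasurable X :=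
  ⟨hf.1.comp hg, hf.2.imp fun _ hC x => hC (g x)⟩

/-- The algebra of the local functions that see only which sites are occupied. -/
def blindLocal : Subalgebra ℝ (Config → ℝ) where
  carrier := {F | IsBlind F ∧ IsLocal F}
  mul_mem' hF hG :=
    ⟨fun η ξ h => congrArg₂ (· * ·) (hF.1 η ξ h) (hG.1 η ξ h), hF.2.map₂ hG.2 (· * ·)⟩
  add_mem' hF hG :=
    ⟨fun η ξ h => congrArg₂ (· + ·) (hF.1 η ξ h) (hG.1 η ξ h), hF.2.map₂ hG.2 (· + ·)⟩
  algebraMap_mem' _ := ⟨fun _ _ _ => rfl, ∅, fun _ _ _ => rfl⟩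

lemma IsBlind.comp_relabel {F : Config → ℝ} (hF : IsBlind F) (g : Z2 → Option Z2) :
    IsBlind fun η => F (relabel g η) := by
  refine fun η ξ h => hF _ _ fun x => ?_
  rcases hg : g x with _ | y <;> simp only [relabel, hg, Option.elim_none, Option.elim_some, h]

lemma comp_relabel_mem_blindLocal {F : Config → ℝ} (hF : F ∈ blindLocal) (g : Z2 → Option Z2) :
    (fun η => F (relabel g η)) ∈ blindLocal :=
  ⟨hF.1.comp_relabel g, hF.2.comp_relabel g⟩

lemma occ_mem_blindLocal (x : Z2) : occ x ∈ blindLocal := by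
  refine ⟨fun η ξ h => ?_,
    isLocal_apply (fun s : SiteState => s.count .active + s.count .passive) x⟩
  have h' : η x = SiteState.empty ↔ ξ x = SiteState.empty := by
    simpa only [SiteState.eq_empty_iff] using h x
  by_cases hx : η x = SiteState.empty
  · rw [occ_of_empty hx, occ_of_empty (h'.1 hx)]
  · rw [occ_of_ne_empty hx, occ_of_ne_empty (mt h'.2 hx)]

lemma vacant_mem_blindLocal (x : Z2) : (fun η => 1 - occ x η) ∈ blindLocal :=
  sub_mem blindLocal.one_mem (occ_mem_blindLocal x)

lemma measurable_isNone : Measurable fun s : SiteState => s.1.1 = none :=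
  (Measurable.of_discrete (f := fun o : Option Species => o = none)).comp
    (measurable_fst.comp measurable_subtype_coe)

lemma factorsThrough_vacancies {F : Config → ℝ} (hF : F ∈ blindLocal) :
    ∃ (s : Finset Z2) (G : (s → Prop) → ℝ), F = G ∘ fun η x => (η x).1.1 = none := by
  obtain ⟨hb, s, hs⟩ := hF
  refine ⟨s, (Function.factorsThrough_iff _).1 fun η ξ h => ?_⟩
  have eq_truncate (ζ : Config) : F ζ = F (truncate s ζ) :=
    hs fun x hx => (truncate_of_mem hx).symm
  rw [eq_truncate η, eq_truncate ξ]
  refine hb _ _ fun x => ?_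
  by_cases hx : x ∈ s
  · rw [truncate_of_mem hx, truncate_of_mem hx]
    exact iff_of_eq (congrFun h ⟨x, hx⟩)
  · rw [truncate_of_notMem hx, truncate_of_notMem hx]

lemma blindLocal_le_boundedMeasurable : blindLocal ≤ boundedMeasurable Config := by
  intro F hF
  obtain ⟨s, G, rfl⟩ := factorsThrough_vacancies hF
  refine ⟨Measurable.of_discrete.comp (measurable_pi_lambda _ fun x =>
    measurable_isNone.comp (measurable_pi_apply _)), ?_⟩
  obtain ⟨C, hC⟩ := (Set.finite_range fun v => |G v|).bddAbove
  exact ⟨C, fun η => hC ⟨_, rfl⟩⟩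

section Span

/-- The span of the one-site observables `η^σ` and `η^{σ,ω}`. -/
def siteSpan (ω : Angle → ℝ) : Submodule ℝ (SiteState → ℝ) :=
  Submodule.span ℝ {ψ | ∃ σ : Species, ψ = (fun s => s.count σ) ∨
    ψ = fun s => ω s.1.2 * s.count σ}

/-- The span of the products of a one-site observable with a blind local function. It is equal to
`T^ω`, see `Tω_eq_weightedSpan`. -/
def weightedSpan (ω : Angle → ℝ) : Submodule ℝ (Config → ℝ) :=
  Submodule.span ℝ {f | ∃ ψ ∈ siteSpan ω, ∃ (y : Z2), ∃ F ∈ blindLocal, f = fun η => ψ (η y) * F η}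

variable {ω : Angle → ℝ} {ψ : SiteState → ℝ} {f F : Config → ℝ}

lemma siteSpan_empty (hψ : ψ ∈ siteSpan ω) : ψ SiteState.empty = 0 := by
  have h : siteSpan ω ≤
      LinearMap.ker (LinearMap.proj (R := ℝ) (φ := fun _ => ℝ) SiteState.empty) := by
    refine Submodule.span_le.2 ?_
    rintro ψ ⟨σ, rfl | rfl⟩ <;> simp [SiteState.count_empty]
  exact h hψ

lemma count_mem_siteSpan (ω : Angle → ℝ) (σ : Species) :
    (fun s : SiteState => s.count σ) ∈ siteSpan ω :=
  Submodule.subset_span ⟨σ, .inl rfl⟩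

lemma weight_mul_count_mem_siteSpan (ω : Angle → ℝ) (σ : Species) :
    (fun s : SiteState => ω s.1.2 * s.count σ) ∈ siteSpan ω :=
  Submodule.subset_span ⟨σ, .inr rfl⟩

lemma mem_siteSpan_iff : ψ ∈ siteSpan ω ↔ ∃ a b c d : ℝ, ψ = fun s =>
    a * s.count .active + b * s.count .passive
      + c * (ω s.1.2 * s.count .active) + d * (ω s.1.2 * s.count .passive) := by
  constructor
  · intro hψ
    induction hψ using Submodule.span_induction with
    | mem ψ h =>
      obtain ⟨_ | _, rfl | rfl⟩ := h
      · exact ⟨1, 0, 0, 0, by simp⟩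
      · exact ⟨0, 0, 1, 0, by simp⟩
      · exact ⟨0, 1, 0, 0, by simp⟩
      · exact ⟨0, 0, 0, 1, by simp⟩
    | zero => exact ⟨0, 0, 0, 0, by funext; simp⟩
    | add _ _ _ _ hf hg =>
      obtain ⟨a, b, c, d, rfl⟩ := hf
      obtain ⟨a', b', c', d', rfl⟩ := hg
      exact ⟨a + a', b + b', c + c', d + d', by funext s; simp only [Pi.add_apply]; ring⟩
    | smul t _ _ hf =>
      obtain ⟨a, b, c, d, rfl⟩ := hf
      exact ⟨t * a, t * b, t * c, t * d, by
        funext s; simp only [Pi.smul_apply, smul_eq_mul]; ring⟩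
  · rintro ⟨a, b, c, d, rfl⟩
    exact add_mem (add_mem (add_mem
      (Submodule.smul_mem _ a (count_mem_siteSpan ω _))
      (Submodule.smul_mem _ b (count_mem_siteSpan ω _)))
      (Submodule.smul_mem _ c (weight_mul_count_mem_siteSpan ω _)))
      (Submodule.smul_mem _ d (weight_mul_count_mem_siteSpan ω _))

lemma IsC2.continuous (hω : IsC2 ω) : Continuous ω :=
  (QuotientAddGroup.isQuotientMap_mk (AddSubgroup.zmultiples (2 * Real.pi))).continuous_iff.2
    (ContDiff.continuous hω)

instance : Fact (0 < 2 * Real.pi) := ⟨Real.two_pi_pos⟩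

lemma count_mem_boundedMeasurable (σ : Species) :
    (fun s : SiteState => s.count σ) ∈ boundedMeasurable SiteState := by
  refine ⟨(Measurable.of_discrete
    (f := fun o : Option Species => if o = some σ then (1 : ℝ) else 0)).comp
      (measurable_fst.comp measurable_subtype_coe), 1, fun s => ?_⟩
  by_cases h : s.1.1 = some σ <;> simp [SiteState.count, h]

lemma IsC2.mem_boundedMeasurable (hω : IsC2 ω) : ω ∈ boundedMeasurable Angle := by
  obtain ⟨C, hC⟩ := isCompact_univ.exists_bound_of_continuousOn hω.continuous.continuousOn
  exact ⟨hω.continuous.measurable, C, fun θ => hC θ trivial⟩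

lemma siteSpan_le_boundedMeasurable (hω : IsC2 ω) :
    siteSpan ω ≤ Subalgebra.toSubmodule (boundedMeasurable SiteState) := by
  have hωs := comp_mem_boundedMeasurable hω.mem_boundedMeasurable
    (measurable_snd.comp (measurable_subtype_coe (p := fun s : Option Species × Angle =>
      s.1 = none → s.2 = 0)))
  refine Submodule.span_le.2 ?_
  rintro ψ ⟨σ, rfl | rfl⟩
  exacts [count_mem_boundedMeasurable σ,
    (boundedMeasurable _).mul_mem hωs (count_mem_boundedMeasurable σ)]

lemma mul_mem_weightedSpan (hψ : ψ ∈ siteSpan ω) (y : Z2) (hF : F ∈ blindLocal) :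
    (fun η => ψ (η y) * F η) ∈ weightedSpan ω :=
  Submodule.subset_span ⟨ψ, hψ, y, F, hF, rfl⟩

lemma comp_relabel_mem_weightedSpan (hf : f ∈ weightedSpan ω) (g : Z2 → Option Z2) :
    (fun η => f (relabel g η)) ∈ weightedSpan ω := by
  induction hf using Submodule.span_induction with
  | mem f h =>
    obtain ⟨ψ, hψ, y, F, hF, rfl⟩ := h
    rcases hg : g y with _ | z
    · simp only [relabel, hg, Option.elim_none, siteSpan_empty hψ, zero_mul]
      exact zero_mem _
    · simpa only [relabel, hg, Option.elim_some] using
        mul_mem_weightedSpan hψ z (comp_relabel_mem_blindLocal hF g)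
  | zero => exact zero_mem _
  | add f₁ f₂ _ _ h₁ h₂ => exact add_mem h₁ h₂
  | smul a f _ h => exact Submodule.smul_mem _ a h

lemma comp_shift_mem_weightedSpan (hf : f ∈ weightedSpan ω) (x : Z2) :
    (fun η => f (shift x η)) ∈ weightedSpan ω :=
  comp_relabel_mem_weightedSpan hf fun w => some (w + x)

lemma comp_permute_mem_weightedSpan (hf : f ∈ weightedSpan ω) (π : Equiv.Perm Z2) :
    (fun η => f (permute π η)) ∈ weightedSpan ω :=
  comp_relabel_mem_weightedSpan hf fun w => some (π w)

lemma blindLocal_mul_mem_weightedSpan (hF : F ∈ blindLocal) (hf : f ∈ weightedSpan ω) :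
    F * f ∈ weightedSpan ω := by
  induction hf using Submodule.span_induction with
  | mem f h =>
    obtain ⟨ψ, hψ, y, G, hG, rfl⟩ := h
    convert mul_mem_weightedSpan hψ y (mul_mem hF hG) using 1
    funext η
    exact mul_left_comm _ _ _
  | zero => rw [mul_zero]; exact zero_mem _
  | add f₁ f₂ _ _ h₁ h₂ => rw [mul_add]; exact add_mem h₁ h₂
  | smul a f _ h => rw [mul_smul_comm]; exact Submodule.smul_mem _ a h

lemma isLocal_of_mem_weightedSpan (hf : f ∈ weightedSpan ω) : IsLocal f := by
  have h : weightedSpan ω ≤ Subalgebra.toSubmodule (localFunctions Z2 SiteState) := by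
    refine Submodule.span_le.2 ?_
    rintro f ⟨ψ, -, y, F, hF, rfl⟩
    exact (isLocal_apply ψ y).map₂ hF.2 (· * ·)
  exact h hf

lemma weightedSpan_le_boundedMeasurable (hω : IsC2 ω) :
    weightedSpan ω ≤ Subalgebra.toSubmodule (boundedMeasurable Config) := by
  refine Submodule.span_le.2 ?_
  rintro f ⟨ψ, hψ, y, F, hF, rfl⟩
  exact (boundedMeasurable _).mul_mem
    (comp_mem_boundedMeasurable (siteSpan_le_boundedMeasurable hω hψ) (measurable_pi_apply y))
    (blindLocal_le_boundedMeasurable hF)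

lemma contDiff_siteSpan_withAngle (hω : IsC2 ω) (hψ : ψ ∈ siteSpan ω) (s : SiteState) :
    ContDiff ℝ 2 fun t : ℝ => ψ (s.withAngle (t : Angle)) := by
  rcases h : s.1.1 with _ | σ
  · simp only [SiteState.withAngle, h]
    exact contDiff_const
  · obtain ⟨a, b, c, d, rfl⟩ := mem_siteSpan_iff.1 hψ
    have hω' : ContDiff ℝ 2 fun t : ℝ => ω (t : Angle) := hω
    have h_angle (t : ℝ) : s.withAngle (t : Angle) = SiteState.particle σ t := by
      simp only [SiteState.withAngle, h]
    simp only [h_angle, SiteState.particle, SiteState.count]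
    exact ((contDiff_const.add contDiff_const).add
      (contDiff_const.mul (hω'.mul contDiff_const))).add
        (contDiff_const.mul (hω'.mul contDiff_const))

lemma IsBlind.update_withAngle (hF : IsBlind F) (η : Config) (x : Z2) (θ : Angle) :
    F (Function.update η x ((η x).withAngle θ)) = F η := by
  refine hF _ _ fun y => ?_
  rcases eq_or_ne y x with rfl | hy
  · rcases h : (η y).1.1 with _ | σ <;> simp [SiteState.withAngle, h, SiteState.particle]
  · rw [Function.update_of_ne hy]

lemma isCylinder_of_mem_weightedSpan (hω : IsC2 ω) (hf : f ∈ weightedSpan ω) : IsCylinder f := by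
  refine ⟨isLocal_of_mem_weightedSpan hf, ?_⟩
  induction hf using Submodule.span_induction with
  | mem f h =>
    obtain ⟨ψ, hψ, y, F, hF, rfl⟩ := h
    intro η x
    simp only [hF.1.update_withAngle]
    refine ContDiff.mul ?_ contDiff_const
    rcases eq_or_ne y x with rfl | hy
    · simpa only [Function.update_self] using contDiff_siteSpan_withAngle hω hψ (η y)
    · simpa only [Function.update_of_ne hy] using contDiff_const
  | zero => exact fun _ _ => contDiff_const
  | add f g _ _ hf hg => exact fun η x => (hf η x).add (hg η x)
  | smul t f _ hf => exact fun η x => (hf η x).const_smul t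

lemma isLocal_comp_truncate (F : Config → ℝ) (s : Finset Z2) :
    IsLocal fun η => F (truncate s η) := by
  refine ⟨s, fun η ξ h => congrArg F (funext fun x => ?_)⟩
  by_cases hx : x ∈ s
  · rw [truncate_of_mem hx, truncate_of_mem hx, h x hx]
  · rw [truncate_of_notMem hx, truncate_of_notMem hx]

/-- Truncation to the finite set `s` on which `f` depends cuts the formal sum down to `s`, and makes
its coefficients local. -/
lemma mem_weightedSpan_of_hasSum {s : Finset Z2} (hs : DependsOn f (s : Set Z2))
    (hψ : ψ ∈ siteSpan ω) {F : Z2 → Config → ℝ} (hF : ∀ x, IsBlind (F x))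
    (hsum : ∀ η, HasSum (fun x => ψ (η x) * F x η) (f η)) : f ∈ weightedSpan ω := by
  have hfin : f = ∑ x ∈ s, fun η => ψ (η x) * F x (truncate s η) := by
    funext η
    have h_vanish : ∀ x ∉ s, ψ (truncate s η x) * F x (truncate s η) = 0 := fun x hx => by
      rw [truncate_of_notMem hx, siteSpan_empty hψ, zero_mul]
    rw [hs fun x hx => (truncate_of_mem hx).symm, ← (hsum _).tsum_eq, tsum_eq_sum h_vanish,
      Finset.sum_apply]
    exact Finset.sum_congr rfl fun x hx => by rw [truncate_of_mem hx]
  rw [hfin]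
  exact sum_mem fun x _ => mul_mem_weightedSpan hψ x
    ⟨(hF x).comp_relabel _, isLocal_comp_truncate (F x) s⟩

lemma Tω_eq_weightedSpan (hω : IsC2 ω) : Tω ω = weightedSpan ω := by
  classical
  apply le_antisymm <;> refine Submodule.span_le.2 ?_
  · rintro f ⟨⟨⟨s, hs⟩, -⟩, a, b, c, d, F, hF, hsum⟩
    exact mem_weightedSpan_of_hasSum hs (mem_siteSpan_iff.2 ⟨a, b, c, d, rfl⟩) hF hsum
  · rintro f ⟨ψ, hψ, y, F, hF, rfl⟩
    have h_cyl := isCylinder_of_mem_weightedSpan hω (mul_mem_weightedSpan hψ y hF)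
    obtain ⟨a, b, c, d, rfl⟩ := mem_siteSpan_iff.1 hψ
    refine Submodule.subset_span ⟨h_cyl, a, b, c, d, Pi.single y F, fun x => ?_, fun η => ?_⟩
    · rcases eq_or_ne x y with rfl | hx
      · rw [Pi.single_eq_same]; exact hF.1
      · rw [Pi.single_eq_of_ne hx]; exact fun _ _ _ => rfl
    · convert hasSum_single y fun x hx => ?_ using 1
      · rw [Pi.single_eq_same]; rfl
      · rw [Pi.single_eq_of_ne hx, Pi.zero_apply, mul_zero]

lemma IsBlind.truncate_single_eq (hF : IsBlind F) {x : Z2} {η ξ : Config}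
    (hη : η x ≠ SiteState.empty) (hξ : ξ x ≠ SiteState.empty) :
    F (truncate {x} η) = F (truncate {x} ξ) := by
  refine hF _ _ fun y => ?_
  rcases eq_or_ne y x with rfl | hy
  · simp only [truncate_of_mem (Set.mem_singleton y), ← SiteState.eq_empty_iff, hη, hξ]
  · simp only [truncate_of_notMem (Set.mem_singleton_iff.not.2 hy)]

lemma exists_siteSpan_eq_truncate_single (hf : f ∈ weightedSpan ω) (x : Z2) :
    ∃ ψ ∈ siteSpan ω, ∀ η : Config, f (truncate {x} η) = ψ (η x) := by
  induction hf using Submodule.span_induction with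
  | mem f h =>
    obtain ⟨ψ, hψ, y, F, hF, rfl⟩ := h
    rcases eq_or_ne y x with rfl | hy
    · set ξ : Config := fun _ => SiteState.particle .active 0
      refine ⟨F (truncate {y} ξ) • ψ, Submodule.smul_mem _ _ hψ, fun η => ?_⟩
      simp only [truncate_of_mem (Set.mem_singleton y), Pi.smul_apply, smul_eq_mul]
      rw [mul_comm]
      by_cases h : η y = SiteState.empty
      · rw [h, siteSpan_empty hψ, mul_zero, mul_zero]
      · rw [hF.1.truncate_single_eq (ξ := ξ) h (SiteState.particle_ne_empty _ _)]
    · refine ⟨0, zero_mem _, fun η => ?_⟩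
      simp only [truncate_of_notMem (Set.mem_singleton_iff.not.2 hy), siteSpan_empty hψ, zero_mul,
        Pi.zero_apply]
  | zero => exact ⟨0, zero_mem _, fun _ => rfl⟩
  | add f g _ _ hf hg =>
    obtain ⟨φ, hφ, h⟩ := hf
    obtain ⟨φ', hφ', h'⟩ := hg
    exact ⟨φ + φ', add_mem hφ hφ', fun η => congrArg₂ (· + ·) (h η) (h' η)⟩
  | smul t f _ hf =>
    obtain ⟨φ, hφ, h⟩ := hf
    exact ⟨t • φ, Submodule.smul_mem _ t hφ, fun η => congrArg (t • ·) (h η)⟩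

end Span

/-! ### Invariance of the grand canonical measures -/

lemma measurePreserving_permute (α : GrandParam) (π : Equiv.Perm Z2) :
    MeasurePreserving (permute π) (grandMeasure α) (grandMeasure α) :=
  ⟨measurable_pi_lambda _ fun _ => measurable_pi_apply _,
    Measure.map_infinitePi_infinitePi_of_inj (P := fun _ : Z2 => siteMeasure α) π.injective⟩

lemma measurePreserving_shift (α : GrandParam) (x : Z2) :
    MeasurePreserving (shift x) (grandMeasure α) (grandMeasure α) :=
  measurePreserving_permute α (Equiv.addRight x)

lemma measurePreserving_swap (α : GrandParam) (x y : Z2) :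
    MeasurePreserving (swap x y) (grandMeasure α) (grandMeasure α) :=
  measurePreserving_permute α (Equiv.swap x y)

instance (α : GrandParam) : IsProbabilityMeasure (grandMeasure α) := by
  unfold grandMeasure; infer_instance

/-! ### Differences of formal sums of local functions -/

section TotalDiff

open Filter
open scoped Pointwise

/-- The difference `∑_x (k_x(ξ) - k_x(η))` of a formal sum between two configurations. It is
meaningful if only finitely many terms are non-zero. -/
def totalDiff {ι X : Type*} (k : ι → X → ℝ) (η ξ : X) : ℝ := ∑ᶠ x, (k x ξ - k x η)

/-- The function `k_x` depends on the sites in a fixed finite window around `x`. -/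
def IsUniformlyLocal {G S : Type*} [Add G] (k : G → (G → S) → ℝ) : Prop :=
  ∃ s : Finset G, ∀ (x : G) (η ξ : G → S), (∀ y ∈ s, η (y + x) = ξ (y + x)) → k x η = k x ξ

lemma totalDiff_symm {ι X : Type*} (k : ι → X → ℝ) (η ξ : X) :
    totalDiff k ξ η = -totalDiff k η ξ := by
  simp only [totalDiff, ← finsum_neg_distrib, neg_sub]

lemma totalDiff_self {ι X : Type*} (k : ι → X → ℝ) (η : X) : totalDiff k η η = 0 := by
  simp only [totalDiff, sub_self, finsum_zero]

lemma totalDiff_smul {ι X : Type*} (a : ℝ) (k : ι → X → ℝ) (η ξ : X) :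
    totalDiff (a • k) η ξ = a * totalDiff k η ξ := by
  rw [totalDiff, totalDiff, ← smul_eq_mul, smul_finsum]
  exact finsum_congr fun x => (mul_sub _ _ _).symm

variable {G S : Type*} [AddGroup G] {k k' : G → (G → S) → ℝ} {η ξ ζ : G → S}

lemma IsUniformlyLocal.exists_window (hk : IsUniformlyLocal k) (A : Finset G) :
    ∃ X : Finset G, ∀ η ξ : G → S, (∀ y ∉ A, η y = ξ y) → ∀ x ∉ X, k x η = k x ξ := by
  classical
  obtain ⟨s, hs⟩ := hk
  refine ⟨-s + A, fun η ξ h x hx => hs x η ξ fun y hy => h _ fun hA => hx ?_⟩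
  exact Finset.mem_add.2 ⟨-y, Finset.neg_mem_neg hy, y + x, hA, neg_add_cancel_left y x⟩

lemma IsUniformlyLocal.exists_totalDiff_eq_sum (hk : IsUniformlyLocal k) (A : Finset G) :
    ∃ X : Finset G, ∀ η ξ : G → S, (∀ y ∉ A, η y = ξ y) →
      totalDiff k η ξ = ∑ x ∈ X, (k x ξ - k x η) := by
  obtain ⟨X, hX⟩ := hk.exists_window A
  refine ⟨X, fun η ξ h => finsum_eq_sum_of_support_subset _ fun x hx => ?_⟩
  by_contra hxX
  exact hx (sub_eq_zero.2 (hX η ξ h x hxX).symm)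

lemma IsUniformlyLocal.finite_support (hk : IsUniformlyLocal k) (h : η =ᶠ[cofinite] ξ) :
    (Function.support fun x => k x ξ - k x η).Finite := by
  have hA : {x | η x ≠ ξ x}.Finite := h
  obtain ⟨X, hX⟩ := hk.exists_window hA.toFinset
  refine X.finite_toSet.subset fun x hx => ?_
  by_contra hxX
  exact hx (sub_eq_zero.2 (hX η ξ (by simp) x hxX).symm)

lemma totalDiff_trans (hk : IsUniformlyLocal k) (h : η =ᶠ[cofinite] ξ) (h' : ξ =ᶠ[cofinite] ζ) :
    totalDiff k η ξ + totalDiff k ξ ζ = totalDiff k η ζ := by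
  rw [totalDiff, totalDiff, ← finsum_add_distrib (hk.finite_support h) (hk.finite_support h')]
  exact finsum_congr fun x => sub_add_sub_cancel' _ _ _

lemma totalDiff_add (hk : IsUniformlyLocal k) (hk' : IsUniformlyLocal k')
    (h : η =ᶠ[cofinite] ξ) : totalDiff (k + k') η ξ = totalDiff k η ξ + totalDiff k' η ξ := by
  rw [totalDiff, totalDiff, totalDiff,
    ← finsum_add_distrib (hk.finite_support h) (hk'.finite_support h)]
  exact finsum_congr fun x => add_sub_add_comm _ _ _ _

lemma IsUniformlyLocal.add (hk : IsUniformlyLocal k) (hk' : IsUniformlyLocal k') :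
    IsUniformlyLocal (k + k') := by
  classical
  obtain ⟨s, hs⟩ := hk
  obtain ⟨t, ht⟩ := hk'
  refine ⟨s ∪ t, fun x η ξ h => congrArg₂ (· + ·)
    (hs x η ξ fun y hy => h y (Finset.mem_union_left t hy))
    (ht x η ξ fun y hy => h y (Finset.mem_union_right s hy))⟩

lemma isUniformlyLocal_site (c : G → S → ℝ) : IsUniformlyLocal fun x (η : G → S) => c x (η x) :=
  ⟨{0}, fun x η ξ h => by simpa using congrArg (c x) (h 0 (Finset.mem_singleton_self 0))⟩

end TotalDiff

/-- The family of the translates `τ_x h`, whose formal sum is `Σ_h`. -/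
def translates (h : Config → ℝ) (x : Z2) (η : Config) : ℝ := h (shift x η)

lemma isUniformlyLocal_translates {h : Config → ℝ} (hh : IsLocal h) :
    IsUniformlyLocal (translates h) :=
  hh.imp fun _ hs _ _ _ he => hs he

lemma totalDiff_translates_shift (h : Config → ℝ) (y : Z2) (η ξ : Config) :
    totalDiff (translates h) (shift y η) (shift y ξ) = totalDiff (translates h) η ξ := by
  simp only [totalDiff, translates, shift_shift]
  exact finsum_comp_equiv (Equiv.addRight y) (f := fun x => h (shift x ξ) - h (shift x η))

lemma eventuallyEq_swap (x y : Z2) (η : Config) : η =ᶠ[Filter.cofinite] swap x y η := by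
  refine (Set.toFinite {x, y}).subset fun w hw => ?_
  by_contra hxy
  rw [Set.mem_insert_iff, Set.mem_singleton_iff, not_or] at hxy
  exact hw (swap_of_ne η hxy.1 hxy.2).symm

lemma totalDiff_site_swap (c : Z2 → SiteState → ℝ) {a b : Z2} (hab : a ≠ b) (η : Config) :
    totalDiff (fun x ζ => c x (ζ x)) η (swap a b η) =
      (c a (η b) - c a (η a)) + (c b (η a) - c b (η b)) := by
  rw [totalDiff, finsum_eq_sum_of_support_subset (s := {a, b}), Finset.sum_pair hab, swap_left,
    swap_right]
  intro x hx
  by_contra hxab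
  simp only [Finset.coe_insert, Finset.coe_singleton, Set.mem_insert_iff,
    Set.mem_singleton_iff, not_or] at hxab
  exact hx (by simp only [swap_of_ne η hxab.1 hxab.2, sub_self])

/-! ### Forms that are differences of a formal potential -/

section Potential

variable {U : Config → EuclideanSpace ℝ (Fin 2)} {k : Z2 → Config → ℝ} {η : Config} {j : Jump}

lemma canJump_swap_symm {x y : Z2} : CanJump (swap x y η) y x ↔ CanJump η x y := by
  rw [CanJump, CanJump, swap_left, swap_right]

lemma canJump_shift {x y z : Z2} : CanJump (shift z η) x y ↔ CanJump η (x + z) (y + z) := Iff.rfl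

lemma memLp_germForm {α : GrandParam} (hU : MemLp U 2 (grandMeasure α)) (j : Jump) :
    MemLp (germForm U j) 2 (grandMeasure α) := by
  obtain ⟨y, i, _ | _⟩ := j
  · exact ((hU.eval_piLp i).comp_measurePreserving ((measurePreserving_shift α (y - e i)).comp
      (measurePreserving_swap α y (y - e i)))).neg
  · exact (hU.eval_piLp i).comp_measurePreserving (measurePreserving_shift α y)

lemma germForm_eq_zero_of_not_canJump (hU : ∀ η i, ¬ CanJump η 0 (e i) → U η i = 0)
    (hj : ¬ CanJump η j.src j.tgt) : germForm U j η = 0 := by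
  obtain ⟨y, i, _ | _⟩ := j
  · refine neg_eq_zero.2 (hU _ _ fun h => hj ?_)
    rw [canJump_shift, zero_add, add_sub_cancel] at h
    exact canJump_swap_symm.1 h
  · refine hU _ _ fun h => hj ?_
    rwa [canJump_shift, zero_add, add_comm] at h

lemma germForm_eq_totalDiff
    (hU : ∀ η y i, CanJump η y (y + e i) →
      U (shift y η) i = totalDiff k η (swap y (y + e i) η))
    (hj : CanJump η j.src j.tgt) : germForm U j η = totalDiff k η (j.apply η) := by
  obtain ⟨y, i, _ | _⟩ := j
  · have h_back := hU (swap y (y - e i) η) (y - e i) i (by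
      rw [sub_add_cancel]; exact canJump_swap_symm.2 hj)
    rw [sub_add_cancel, swap_comm (y - e i) y, swap_swap, totalDiff_symm] at h_back
    exact neg_eq_iff_eq_neg.2 h_back
  · exact hU η y i hj

lemma eventuallyEq_pathEnd (η : Config) (γ : List Jump) :
    η =ᶠ[Filter.cofinite] pathEnd η γ := by
  induction γ generalizing η with
  | nil => exact Filter.EventuallyEq.rfl
  | cons j γ ih => exact (eventuallyEq_swap _ _ _).trans (ih _)

lemma pathIntegral_eq_totalDiff (hk : IsUniformlyLocal k) {u : Jump → Config → ℝ}
    (hu : ∀ j η, CanJump η j.src j.tgt → u j η = totalDiff k η (j.apply η)) (γ : List Jump)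
    (hγ : IsLicit η γ) : pathIntegral u η γ = totalDiff k η (pathEnd η γ) := by
  induction γ generalizing η with
  | nil => exact (totalDiff_self k η).symm
  | cons j γ ih =>
    rw [pathIntegral, ih hγ.2, hu j η (occ_mul_vacant_eq_one_iff.1 hγ.1)]
    exact totalDiff_trans hk (eventuallyEq_swap _ _ _) (eventuallyEq_pathEnd _ _)

lemma isClosedGerm_of_totalDiff {α : GrandParam} (hL : MemLp U 2 (grandMeasure α))
    (hU₀ : ∀ η i, ¬ CanJump η 0 (e i) → U η i = 0) (hk : IsUniformlyLocal k)
    (hU : ∀ η y i, CanJump η y (y + e i) →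
      U (shift y η) i = totalDiff k η (swap y (y + e i) η)) : IsClosedGerm α U := by
  refine ⟨hL, fun j => ⟨memLp_germForm hL j, fun η => ?_⟩, fun η γ hγ h_end => ?_⟩
  · by_cases hj : CanJump η j.src j.tgt
    · rw [hj.occ_mul_vacant, one_mul]
    · rw [germForm_eq_zero_of_not_canJump hU₀ hj, mul_zero]
  · rw [pathIntegral_eq_totalDiff hk (fun j η => germForm_eq_totalDiff hU) γ hγ, h_end,
      totalDiff_self]

end Potential

/-! ### Germs of exact forms and of currents -/

section Germ

/-- The pair with `i`-th component `ψ_i(η_0) (1 - η_{e_i})`. -/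
def current (ψ : Fin 2 → SiteState → ℝ) (η : Config) : EuclideanSpace ℝ (Fin 2) :=
  WithLp.toLp 2 fun i => ψ i (η 0) * (1 - occ (e i) η)

/-- The general element `∇Σ_h + current ψ` of the spaces to be compared. -/
def germ (h : Config → ℝ) (ψ : Fin 2 → SiteState → ℝ) (η : Config) :
    EuclideanSpace ℝ (Fin 2) :=
  gradSum h η + current ψ η

/-- The coordinates of a lattice point. -/
def coord (x : Z2) (i : Fin 2) : ℤ := if i = 0 then x.1 else x.2

/-- The moment `∑_i x_i ψ_i` of a state at the site `x`. -/
def moment (ψ : Fin 2 → SiteState → ℝ) (x : Z2) (s : SiteState) : ℝ :=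
  ∑ i, (coord x i : ℝ) * ψ i s

/-- The summands of the formal potential of `germ h ψ`: currents increase the moments. -/
def potential (h : Config → ℝ) (ψ : Fin 2 → SiteState → ℝ) : Z2 → Config → ℝ :=
  translates h + fun x η => moment ψ x (η x)

variable {ω : Angle → ℝ} {h : Config → ℝ} {ψ : Fin 2 → SiteState → ℝ} {η : Config} {y : Z2}
  {i : Fin 2}

lemma coord_add_e (x : Z2) (i m : Fin 2) :
    coord (x + e i) m = coord x m + if m = i then 1 else 0 := by
  fin_cases i <;> fin_cases m <;> simp [coord, e]

lemma moment_empty (hψ : ∀ i, ψ i SiteState.empty = 0) (x : Z2) :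
    moment ψ x SiteState.empty = 0 := by
  simp only [moment, hψ, mul_zero, Finset.sum_const_zero]

lemma moment_add_e (ψ : Fin 2 → SiteState → ℝ) (x : Z2) (i : Fin 2) (s : SiteState) :
    moment ψ (x + e i) s = moment ψ x s + ψ i s := by
  simp only [moment, coord_add_e, Int.cast_add, add_mul, Finset.sum_add_distrib, Int.cast_ite,
    Int.cast_one, Int.cast_zero, ite_mul, one_mul, zero_mul, Finset.sum_ite_eq',
    Finset.mem_univ, if_true]

lemma isUniformlyLocal_potential (hh : IsLocal h) (ψ : Fin 2 → SiteState → ℝ) :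
    IsUniformlyLocal (potential h ψ) :=
  (isUniformlyLocal_translates hh).add (isUniformlyLocal_site (moment ψ))

lemma current_apply (ψ : Fin 2 → SiteState → ℝ) (η : Config) (i : Fin 2) :
    current ψ η i = ψ i (η 0) * (1 - occ (e i) η) := rfl

lemma gradSum_apply (h : Config → ℝ) (η : Config) (i : Fin 2) :
    gradSum h η i =
      occ 0 η * (1 - occ (e i) η) * totalDiff (translates h) η (swap 0 (e i) η) := rfl

lemma gradSum_shift_of_canJump (h : Config → ℝ) (hη : CanJump η y (y + e i)) :
    gradSum h (shift y η) i = totalDiff (translates h) η (swap y (y + e i) η) := by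
  have hη' : CanJump (shift y η) 0 (e i) := by rwa [canJump_shift, zero_add, add_comm]
  rw [gradSum_apply, hη'.occ_mul_vacant, one_mul, swap_shift, totalDiff_translates_shift,
    zero_add, add_comm]

lemma current_shift_of_canJump (hψ : ∀ i, ψ i SiteState.empty = 0)
    (hη : CanJump η y (y + e i)) :
    current ψ (shift y η) i = totalDiff (fun x ζ => moment ψ x (ζ x)) η (swap y (y + e i) η) := by
  have h_empty : shift y η (e i) = SiteState.empty := by rw [shift, add_comm, hη.2]
  have h_ne : y ≠ y + e i := (add_ne_left.2 (e_ne_zero i)).symm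
  rw [totalDiff_site_swap _ h_ne, hη.2, moment_empty hψ, moment_empty hψ, moment_add_e,
    current_apply, occ_of_empty h_empty, shift, zero_add]
  ring

lemma germ_shift_of_canJump (hh : IsLocal h) (hψ : ∀ i, ψ i SiteState.empty = 0)
    (hη : CanJump η y (y + e i)) :
    germ h ψ (shift y η) i = totalDiff (potential h ψ) η (swap y (y + e i) η) := by
  rw [germ, PiLp.add_apply, gradSum_shift_of_canJump h hη, current_shift_of_canJump hψ hη,
    potential, totalDiff_add (isUniformlyLocal_translates hh) (isUniformlyLocal_site (moment ψ))
    (eventuallyEq_swap _ _ _)]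

lemma germ_of_not_canJump (h : Config → ℝ) (hψ : ∀ i, ψ i SiteState.empty = 0)
    (hη : ¬ CanJump η 0 (e i)) : germ h ψ η i = 0 := by
  rw [germ, PiLp.add_apply, gradSum_apply, occ_mul_vacant_of_not_canJump hη, current_apply,
    zero_mul, zero_add]
  by_cases h₀ : η 0 = SiteState.empty
  · rw [h₀, hψ, zero_mul]
  · rw [occ_of_ne_empty fun h₁ => hη ⟨h₀, h₁⟩, sub_self, mul_zero]

lemma memLp_of_mem_weightedSpan (hω : IsC2 ω) (α : GrandParam)
    {U : Config → EuclideanSpace ℝ (Fin 2)} (hU : ∀ i, (fun η => U η i) ∈ weightedSpan ω) :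
    MemLp U 2 (grandMeasure α) := by
  refine MemLp.of_eval_piLp fun i => ?_
  obtain ⟨hm, C, hC⟩ := weightedSpan_le_boundedMeasurable hω (hU i)
  exact MemLp.of_bound hm.aestronglyMeasurable C (.of_forall hC)

lemma gradSum_mem_weightedSpan (hh : h ∈ weightedSpan ω) (i : Fin 2) :
    (fun η => gradSum h η i) ∈ weightedSpan ω := by
  obtain ⟨X, hX⟩ := (isUniformlyLocal_translates
    (isLocal_of_mem_weightedSpan hh)).exists_totalDiff_eq_sum {0, e i}
  have h_sum : (fun η => gradSum h η i) = (occ 0 * fun η => 1 - occ (e i) η) *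
      ∑ x ∈ X, ((fun η => h (shift x (swap 0 (e i) η))) - fun η => h (shift x η)) := by
    funext η
    rw [gradSum_apply, hX η (swap 0 (e i) η), Pi.mul_apply, Finset.sum_apply]
    · rfl
    · intro y hy
      rw [Finset.mem_insert, Finset.mem_singleton, not_or] at hy
      exact (swap_of_ne η hy.1 hy.2).symm
  rw [h_sum]
  refine blindLocal_mul_mem_weightedSpan
    (mul_mem (occ_mem_blindLocal 0) (vacant_mem_blindLocal (e i))) (sum_mem fun x _ => ?_)
  have h_shift := comp_shift_mem_weightedSpan hh x
  exact sub_mem (comp_permute_mem_weightedSpan h_shift (Equiv.swap 0 (e i))) h_shift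

lemma current_mem_weightedSpan (hψ : ∀ i, ψ i ∈ siteSpan ω) (i : Fin 2) :
    (fun η => current ψ η i) ∈ weightedSpan ω :=
  mul_mem_weightedSpan (hψ i) 0 (vacant_mem_blindLocal (e i))

lemma germ_mem_weightedSpan (hh : h ∈ weightedSpan ω) (hψ : ∀ i, ψ i ∈ siteSpan ω) (i : Fin 2) :
    (fun η => germ h ψ η i) ∈ weightedSpan ω :=
  add_mem (gradSum_mem_weightedSpan hh i) (current_mem_weightedSpan hψ i)

lemma isClosedGerm_germ (hω : IsC2 ω) (α : GrandParam) (hh : h ∈ weightedSpan ω)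
    (hψ : ∀ i, ψ i ∈ siteSpan ω) : IsClosedGerm α (germ h ψ) :=
  have hψ₀ (i : Fin 2) : ψ i SiteState.empty = 0 := siteSpan_empty (hψ i)
  have hl : IsLocal h := isLocal_of_mem_weightedSpan hh
  isClosedGerm_of_totalDiff (memLp_of_mem_weightedSpan hω α (germ_mem_weightedSpan hh hψ))
    (fun _ _ => germ_of_not_canJump h hψ₀) (isUniformlyLocal_potential hl ψ)
    fun _ _ _ => germ_shift_of_canJump hl hψ₀

end Germ

/-! ### Paths of jumps -/

section Paths

/-- The configuration `ξ` can be reached from `η` by a licit path along which the form generated by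
`V` has the integral `c`. -/
inductive Reach (V : Config → EuclideanSpace ℝ (Fin 2)) : Config → Config → ℝ → Prop
  | refl (η : Config) : Reach V η η 0
  | fwd (η : Config) (y : Z2) (i : Fin 2) (h : CanJump η y (y + e i)) :
      Reach V η (swap y (y + e i) η) (V (shift y η) i)
  | bwd (η : Config) (y : Z2) (i : Fin 2) (h : CanJump η y (y + e i)) :
      Reach V (swap y (y + e i) η) η (-V (shift y η) i)
  | trans {η ξ ζ : Config} {c d : ℝ} (h : Reach V η ξ c) (h' : Reach V ξ ζ d) :
      Reach V η ζ (c + d)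

lemma isLicit_append {η : Config} {γ δ : List Jump} (h : IsLicit η γ)
    (h' : IsLicit (pathEnd η γ) δ) : IsLicit η (γ ++ δ) := by
  induction γ generalizing η with
  | nil => exact h'
  | cons j γ ih => exact ⟨h.1, ih h.2 h'⟩

lemma pathEnd_append (η : Config) (γ δ : List Jump) :
    pathEnd η (γ ++ δ) = pathEnd (pathEnd η γ) δ := by
  induction γ generalizing η with
  | nil => rfl
  | cons _ _ ih => exact ih _

lemma pathIntegral_append (u : Jump → Config → ℝ) (η : Config) (γ δ : List Jump) :
    pathIntegral u η (γ ++ δ) = pathIntegral u η γ + pathIntegral u (pathEnd η γ) δ := by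
  induction γ generalizing η with
  | nil => exact (zero_add _).symm
  | cons j γ ih => simp only [List.cons_append, pathIntegral, pathEnd, ih, add_assoc]

namespace Reach

variable {V : Config → EuclideanSpace ℝ (Fin 2)} {η ξ : Config} {c d : ℝ}

lemma symm (h : Reach V η ξ c) : Reach V ξ η (-c) := by
  induction h with
  | refl η => simpa only [neg_zero] using refl η
  | fwd η y i h => exact bwd η y i h
  | bwd η y i h => simpa only [neg_neg] using fwd η y i h
  | trans _ _ h h' => simpa only [neg_add_rev] using h'.trans h

lemma exists_path (h : Reach V η ξ c) :
    ∃ γ, IsLicit η γ ∧ pathEnd η γ = ξ ∧ pathIntegral (germForm V) η γ = c := by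
  induction h with
  | refl η => exact ⟨[], trivial, rfl, rfl⟩
  | fwd η y i h => exact ⟨[⟨y, i, true⟩], ⟨h.occ_mul_vacant, trivial⟩, rfl, add_zero _⟩
  | bwd η y i h =>
    refine ⟨[⟨y + e i, i, false⟩], ?_⟩
    simp only [IsLicit, pathEnd, pathIntegral, germForm, Jump.apply, Jump.tgt,
      Bool.false_eq_true, if_false, add_sub_cancel_right, swap_comm (y + e i) y, swap_swap,
      add_zero, and_true]
    exact (canJump_swap_symm.2 h).occ_mul_vacant
  | trans _ _ h h' =>
    obtain ⟨γ, hγ, rfl, rfl⟩ := h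
    obtain ⟨δ, hδ, rfl, rfl⟩ := h'
    exact ⟨γ ++ δ, isLicit_append hγ hδ, pathEnd_append _ _ _, pathIntegral_append _ _ _ _⟩

lemma unique (hV : ∀ (η : Config) (γ : List Jump), IsLicit η γ → pathEnd η γ = η →
    pathIntegral (germForm V) η γ = 0) (h : Reach V η ξ c) (h' : Reach V η ξ d) : c = d := by
  obtain ⟨γ, hγ, h_end, h_int⟩ := (h.trans h'.symm).exists_path
  exact eq_of_sub_eq_zero ((sub_eq_add_neg c d).trans (h_int.symm.trans (hV η γ hγ h_end)))

end Reach

end Paths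

/-! ### Moving the last particle away -/

section Exit

open Function

/-- The sites `a` and `y` are at a sup distance larger than `r`. -/
def Far (r : ℕ) (a y : Z2) : Prop :=
  a.1 + r < y.1 ∨ y.1 + r < a.1 ∨ a.2 + r < y.2 ∨ y.2 + r < a.2

/-- All the particles of `ζ` are at sites that precede `z` in the lexicographic order. -/
def LeftOf (ζ : Config) (z : Z2) : Prop := ∀ x, ζ x ≠ SiteState.empty → toLex x < toLex z

/-- The form generated by `V` has range `r`, is a closed differential form, and vanishes at the
jumps of particles without another particle within distance `r`. -/
structure IsIsolatedClosed (V : Config → EuclideanSpace ℝ (Fin 2)) (r : ℕ) : Prop where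
  local_range : ∀ i η ξ, (∀ x : Z2, ¬ Far r x 0 → η x = ξ x) → V η i = V ξ i
  isolated : ∀ i η, (∀ x : Z2, x ≠ 0 → ¬ Far r x 0 → η x = SiteState.empty) → V η i = 0
  exclusion : ∀ i η, ¬ CanJump η 0 (e i) → V η i = 0
  closed : ∀ (η : Config) (γ : List Jump), IsLicit η γ → pathEnd η γ = η →
    pathIntegral (germForm V) η γ = 0

/-- The integral of the form along the motion of a particle of state `t` from `z` to the right,
in the background `ζ`. If `LeftOf ζ z`, then `r + 1` steps are enough to isolate the particle. -/
def exitCost (V : Config → EuclideanSpace ℝ (Fin 2)) (r : ℕ) (ζ : Config) (z : Z2)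
    (t : SiteState) : ℝ :=
  ∑ k ∈ Finset.range (r + 1), V (shift (z + k • e 0) (update ζ (z + k • e 0) t)) 0

variable {V : Config → EuclideanSpace ℝ (Fin 2)} {r : ℕ} {ζ : Config} {a b y z : Z2} {i : Fin 2}
  {s t : SiteState}

lemma fst_add_nsmul_e_zero (y : Z2) (k : ℕ) : (y + k • e 0).1 = y.1 + k := by simp [e]

lemma snd_add_nsmul_e_zero (y : Z2) (k : ℕ) : (y + k • e 0).2 = y.2 := by simp [e]

lemma fst_add_nsmul_e_one (y : Z2) (k : ℕ) : (y + k • e 1).1 = y.1 := by simp [e]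

lemma snd_add_nsmul_e_one (y : Z2) (k : ℕ) : (y + k • e 1).2 = y.2 + k := by simp [e]

lemma fst_add_e_zero (y : Z2) : (y + e 0).1 = y.1 + 1 := by simp [e]

lemma snd_add_e_zero (y : Z2) : (y + e 0).2 = y.2 := by simp [e]

lemma lt_add_e (y : Z2) (i : Fin 2) : toLex y < toLex (y + e i) := by
  rw [Prod.Lex.toLex_lt_toLex]
  fin_cases i <;> simp [e]

lemma le_add_nsmul_e (y : Z2) (k : ℕ) (i : Fin 2) : toLex y ≤ toLex (y + k • e i) := by
  induction k with
  | zero => rw [zero_nsmul, add_zero]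
  | succ k ih => rw [succ_nsmul, ← add_assoc]; exact ih.trans (lt_add_e _ i).le

lemma Far.ne (h : Far r a y) : y ≠ a := by
  rintro rfl; simp only [Far] at h; omega

lemma LeftOf.eq_empty (h : LeftOf ζ z) (hy : toLex z ≤ toLex y) : ζ y = SiteState.empty :=
  of_not_not fun hc => (h y hc).not_ge hy

lemma LeftOf.mono (h : LeftOf ζ y) (hy : toLex y ≤ toLex z) : LeftOf ζ z :=
  fun x hx => (h x hx).trans_le hy

lemma LeftOf.update (h : LeftOf ζ z) (hy : toLex y < toLex z) (s : SiteState) :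
    LeftOf (update ζ y s) z := by
  intro x hx
  rcases eq_or_ne x y with rfl | hne
  · exact hy
  · exact h x (by rwa [update_of_ne hne] at hx)

lemma swap_update (ha : ζ a = SiteState.empty) (hb : ζ b = SiteState.empty) (t : SiteState) :
    swap a b (update ζ a t) = update ζ b t := by
  funext w
  rcases eq_or_ne w b with rfl | hwb
  · rw [swap_right, update_self, update_self]
  rcases eq_or_ne w a with rfl | hwa
  · rw [swap_left, update_of_ne hwb, update_of_ne hwb.symm, ha, hb]
  rw [swap_of_ne _ hwa hwb, update_of_ne hwa, update_of_ne hwb]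

lemma reach_step (V : Config → EuclideanSpace ℝ (Fin 2)) (ht : t ≠ SiteState.empty)
    (hy : ζ y = SiteState.empty) (hy' : ζ (y + e i) = SiteState.empty) :
    Reach V (update ζ y t) (update ζ (y + e i) t) (V (shift y (update ζ y t)) i) := by
  rw [← swap_update hy hy' t]
  refine Reach.fwd _ y i ⟨?_, ?_⟩
  · rwa [update_self]
  · rwa [update_of_ne (add_ne_left.2 (e_ne_zero i))]

lemma reach_walk (V : Config → EuclideanSpace ℝ (Fin 2)) (ht : t ≠ SiteState.empty) (L : ℕ)
    (h : ∀ k ≤ L, ζ (y + k • e i) = SiteState.empty) :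
    Reach V (update ζ y t) (update ζ (y + L • e i) t)
      (∑ k ∈ Finset.range L, V (shift (y + k • e i) (update ζ (y + k • e i) t)) i) := by
  induction L with
  | zero => simpa using Reach.refl (V := V) (update ζ y t)
  | succ L ih =>
    have h_succ : y + (L + 1) • e i = y + L • e i + e i := by rw [succ_nsmul, add_assoc]
    rw [Finset.sum_range_succ, h_succ]
    exact (ih fun k hk => h k (hk.trans L.le_succ)).trans
      (reach_step V ht (h L L.le_succ) (h_succ ▸ h (L + 1) le_rfl))

namespace IsIsolatedClosed

variable (hV : IsIsolatedClosed V r)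

include hV

lemma eq_of_far (i : Fin 2) (s : SiteState) (h : Far r a y) :
    V (shift y (update ζ a s)) i = V (shift y ζ) i := by
  refine hV.local_range i _ _ fun x hx => update_of_ne (fun hxa => hx ?_) _ _
  subst hxa
  simp only [Far, Prod.fst_add, Prod.snd_add, Prod.fst_zero, Prod.snd_zero] at *
  omega

lemma eq_zero_of_isolated (i : Fin 2) (t : SiteState)
    (h : ∀ x, ζ x ≠ SiteState.empty → Far r x y) :
    V (shift y (update ζ y t)) i = 0 := by
  refine hV.isolated i _ fun x hx hf => ?_
  rw [shift, update_of_ne (add_ne_right.2 hx)]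
  refine of_not_not fun hc => hf ?_
  have := h _ hc
  simp only [Far, Prod.fst_add, Prod.snd_add, Prod.fst_zero, Prod.snd_zero] at *
  omega

/-- The exit of a particle costs the same along all paths that go right and then up, and in the
presence of a second particle that stays far from the path. -/
lemma reach_exit_of_far (hζ : LeftOf ζ z) (ht : t ≠ SiteState.empty) {L : ℕ} (hL : r < L) (M : ℕ)
    (ha : ∀ k ≤ L, Far r a (z + k • e 0)) (ha' : ∀ k ≤ M, Far r a (z + L • e 0 + k • e 1)) :
    Reach V (update (update ζ a s) z t) (update (update ζ a s) (z + L • e 0 + M • e 1) t)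
      (exitCost V r ζ z t) := by
  have h_empty {x : Z2} (hx : toLex z ≤ toLex x) (hax : Far r a x) :
      update ζ a s x = SiteState.empty := by
    rw [update_of_ne hax.ne, hζ.eq_empty hx]
  have h_ignore {i : Fin 2} {x : Z2} (hax : Far r a x) :
      V (shift x (update (update ζ a s) x t)) i = V (shift x (update ζ x t)) i := by
    rw [update_comm hax.ne.symm, hV.eq_of_far i s hax]
  have h_isolated (i : Fin 2) {x : Z2} (hx : z.1 + r < x.1) : V (shift x (update ζ x t)) i = 0 := by
    refine hV.eq_zero_of_isolated i t fun w hw => ?_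
    have := Prod.Lex.toLex_lt_toLex.1 (hζ w hw)
    simp only [Far]
    omega
  have h_right := reach_walk V ht L fun k hk => h_empty (le_add_nsmul_e z k 0) (ha k hk)
  have h_up := reach_walk V ht M fun k hk =>
    h_empty ((le_add_nsmul_e z L 0).trans (le_add_nsmul_e _ k 1)) (ha' k hk)
  convert h_right.trans h_up using 1
  rw [Finset.sum_congr rfl fun k hk => h_ignore (ha k (Finset.mem_range.1 hk).le),
    Finset.sum_eq_zero (s := Finset.range M), add_zero, exitCost]
  · refine Finset.sum_subset (Finset.range_mono hL) fun k _ hk => h_isolated 0 ?_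
    rw [fst_add_nsmul_e_zero]
    rw [Finset.mem_range] at hk
    omega
  · intro k hk
    rw [h_ignore (ha' k (Finset.mem_range.1 hk).le), h_isolated]
    rw [fst_add_nsmul_e_one, fst_add_nsmul_e_zero]
    omega

lemma reach_exit (hζ : LeftOf ζ z) (ht : t ≠ SiteState.empty) {L : ℕ} (hL : r < L) (M : ℕ) :
    Reach V (update ζ z t) (update ζ (z + L • e 0 + M • e 1) t) (exitCost V r ζ z t) := by
  have h_far {x : Z2} (hx : x.1 ≤ z.1 + L) : Far r (z + (L + r + 1) • e 0) x := by
    simp only [Far, fst_add_nsmul_e_zero]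
    omega
  have h := hV.reach_exit_of_far (s := SiteState.empty) hζ ht hL M
    (fun k hk => h_far (by rw [fst_add_nsmul_e_zero]; omega))
    (fun k _ => h_far (by rw [fst_add_nsmul_e_one, fst_add_nsmul_e_zero]))
  have h_self : update ζ (z + (L + r + 1) • e 0) SiteState.empty = ζ :=
    update_eq_self_iff.2 (hζ.eq_empty (le_add_nsmul_e z _ 0)).symm
  rwa [h_self] at h

lemma reach_exit_right (hζ : LeftOf ζ z) (ht : t ≠ SiteState.empty) {L : ℕ} (hL : r < L) :
    Reach V (update ζ z t) (update ζ (z + L • e 0) t) (exitCost V r ζ z t) := by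
  simpa only [zero_nsmul, add_zero] using hV.reach_exit hζ ht hL 0

lemma jump_add_exitCost (hζ : LeftOf ζ y) (ht : t ≠ SiteState.empty) (i : Fin 2) :
    V (shift y (update ζ y t)) i + exitCost V r ζ (y + e i) t = exitCost V r ζ y t := by
  set y' := y + (r + 1) • e 0
  have hy' : toLex y ≤ toLex y' := le_add_nsmul_e y (r + 1) 0
  have h_jump_exit := (reach_step V (i := i) ht (hζ.eq_empty le_rfl)
    (hζ.eq_empty (lt_add_e y i).le)).trans
      (hV.reach_exit_right (hζ.mono (lt_add_e y i).le) ht r.lt_succ_self)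
  have h_exit_jump := (hV.reach_exit_right hζ ht r.lt_succ_self).trans
    (reach_step V (i := i) ht (hζ.eq_empty hy') (hζ.eq_empty (hy'.trans (lt_add_e y' i).le)))
  rw [add_right_comm y] at h_jump_exit
  have h_free : V (shift y' (update ζ y' t)) i = 0 := by
    refine hV.eq_zero_of_isolated i t fun x hx => ?_
    have := Prod.Lex.toLex_lt_toLex.1 (hζ x hx)
    simp only [Far, y', fst_add_nsmul_e_zero]
    omega
  rw [h_free, add_zero] at h_exit_jump
  exact h_jump_exit.unique hV.closed h_exit_jump

lemma reach_step_of_far (hs : s ≠ SiteState.empty) (hy : ζ y = SiteState.empty)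
    (hy' : ζ (y + e i) = SiteState.empty) (ha : Far r a y) (ha' : y + e i ≠ a) :
    Reach V (update (update ζ y s) a t) (update (update ζ (y + e i) s) a t)
      (V (shift y (update ζ y s)) i) := by
  have h := reach_step V (ζ := update ζ a t) (i := i) hs (by rwa [update_of_ne ha.ne])
    (by rwa [update_of_ne ha'])
  rwa [update_comm ha.ne.symm, hV.eq_of_far i t ha, update_comm ha'.symm] at h

lemma jump_exit_comm (hs : s ≠ SiteState.empty) (ht : t ≠ SiteState.empty) (hζ : LeftOf ζ z)
    (hz : toLex (y + e i) < toLex z) (hy : ζ y = SiteState.empty)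
    (hy' : ζ (y + e i) = SiteState.empty) :
    V (shift y (update (update ζ y s) z t)) i + exitCost V r (update ζ (y + e i) s) z t =
      exitCost V r (update ζ y s) z t + V (shift y (update ζ y s)) i := by
  have hyz : toLex y < toLex z := (lt_add_e y i).trans hz
  have h_far : Far r (z + (r + 1) • e 0) y := by
    rw [Prod.Lex.toLex_lt_toLex] at hyz
    simp only [Far, fst_add_nsmul_e_zero]
    omega
  have hzy : z ≠ y := by rintro rfl; exact hyz.false
  have hzy' : z ≠ y + e i := by rintro rfl; exact hz.false
  have h_jump := reach_step V (ζ := update ζ z t) (i := i) hs (by rwa [update_of_ne hzy.symm])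
    (by rwa [update_of_ne hzy'.symm])
  rw [update_comm hzy, update_comm hzy'] at h_jump
  have h_jump_exit := h_jump.trans
    (hV.reach_exit_right (hζ.update hz s) ht r.lt_succ_self)
  have h_exit_jump := (hV.reach_exit_right (hζ.update hyz s) ht r.lt_succ_self).trans
    (hV.reach_step_of_far hs hy hy' h_far
      fun h => (hz.trans_le (le_add_nsmul_e z (r + 1) 0)).ne (congrArg toLex h))
  exact h_jump_exit.unique hV.closed h_exit_jump

lemma reach_jump_exit_exit (hs : s ≠ SiteState.empty) (ht : t ≠ SiteState.empty)
    (hζ : LeftOf ζ z) (hzy : z ≠ y) (hz : toLex z < toLex (y + e 0))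
    (hy : ζ y = SiteState.empty) {L L' M : ℕ} (hL : r < L) (hL' : r < L') (hM : z.2 + r < y.2 + M) :
    Reach V (update (update ζ z t) y s)
      (update (update ζ (y + e 0 + L • e 0 + M • e 1) s) (z + L' • e 0) t)
      (V (shift y (update (update ζ z t) y s)) 0 + exitCost V r (update ζ z t) (y + e 0) s
        + exitCost V r ζ z t) := by
  have hzy' : z ≠ y + e 0 := by rintro rfl; exact hz.false
  have hy' : ζ (y + e 0) = SiteState.empty := hζ.eq_empty hz.le
  have snd_end : (y + e 0 + L • e 0 + M • e 1).2 = y.2 + M := by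
    rw [snd_add_nsmul_e_one, snd_add_nsmul_e_zero, snd_add_e_zero]
  have h_far (k : ℕ) : Far r (y + e 0 + L • e 0 + M • e 1) (z + k • e 0) := by
    simp only [Far, snd_end, snd_add_nsmul_e_zero]; omega
  have h_ne := (h_far 0).ne
  rw [zero_nsmul, add_zero] at h_ne
  have h_jump := reach_step V (ζ := update ζ z t) (i := 0) hs (by rwa [update_of_ne hzy.symm])
    (by rwa [update_of_ne hzy'.symm])
  have h_exit := hV.reach_exit ((hζ.mono hz.le).update hz t) hs hL M
  have h_exit' := hV.reach_exit_of_far (s := s) hζ ht hL' 0 (fun k _ => h_far k) fun k hk => by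
    simpa only [Nat.le_zero.1 hk, zero_nsmul, add_zero] using h_far L'
  rw [update_comm h_ne] at h_exit
  simpa only [zero_nsmul, add_zero] using (h_jump.trans h_exit).trans h_exit'

lemma reach_exit_jump_exit (hs : s ≠ SiteState.empty) (ht : t ≠ SiteState.empty)
    (hζ : LeftOf ζ z) (hyz : toLex y < toLex z) (hz : toLex z < toLex (y + e 0))
    (hy : ζ y = SiteState.empty) {L L' : ℕ} (hL : r < L) (hL' : L + r + 1 < L') (M : ℕ) :
    Reach V (update (update ζ y s) z t)
      (update (update ζ (z + L' • e 0) t) (y + e 0 + L • e 0 + M • e 1) s)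
      (exitCost V r (update ζ y s) z t + V (shift y (update ζ y s)) 0
        + exitCost V r ζ (y + e 0) s) := by
  have hζ' : LeftOf ζ (y + e 0) := hζ.mono hz.le
  have h_far {x : Z2} (hx : x.1 ≤ y.1 + 1 + L) : Far r (z + L' • e 0) x := by
    rw [Prod.Lex.toLex_lt_toLex] at hyz
    simp only [Far, fst_add_nsmul_e_zero]; omega
  have h_far' : Far r (z + L' • e 0) (y + e 0) := h_far (by rw [fst_add_e_zero]; omega)
  have h_exit := hV.reach_exit_right (L := L') (hζ.update hyz s) ht (by omega)
  have h_jump := hV.reach_step_of_far (t := t) hs hy (hζ'.eq_empty le_rfl)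
    (h_far (x := y) (by omega)) h_far'.ne
  have h_exit' := hV.reach_exit_of_far (s := t) hζ' hs hL M
    (fun k hk => h_far (by rw [fst_add_nsmul_e_zero, fst_add_e_zero]; omega))
    (fun k _ => h_far (by rw [fst_add_nsmul_e_one, fst_add_nsmul_e_zero, fst_add_e_zero]))
  rw [update_comm h_far'.ne] at h_jump
  exact (h_exit.trans h_jump).trans h_exit'

/-- The order of the exits of the particles `s` and `t` changes when `s` jumps. If `s` leaves
horizontally and then far enough up, and `t` leaves horizontally and then stops beyond `s`, then
both orders are possible. -/
lemma jump_exit_exchange (hs : s ≠ SiteState.empty) (ht : t ≠ SiteState.empty) (hζ : LeftOf ζ z)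
    (hyz : toLex y < toLex z) (hz : toLex z < toLex (y + e 0)) (hy : ζ y = SiteState.empty) :
    V (shift y (update (update ζ y s) z t)) 0 + exitCost V r (update ζ z t) (y + e 0) s
        + exitCost V r ζ z t =
      exitCost V r (update ζ y s) z t + V (shift y (update ζ y s)) 0
        + exitCost V r ζ (y + e 0) s := by
  obtain ⟨M, hM⟩ : ∃ M : ℕ, z.2 + r < y.2 + M := ⟨(z.2 + r - y.2).toNat + 1, by omega⟩
  have hzy : z ≠ y := by rintro rfl; exact hyz.false
  have h_jump_first := hV.reach_jump_exit_exit hs ht hζ hzy hz hy (L := r + 1)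
    (L' := 2 * r + 3) (by omega) (by omega) hM
  have h_exit_first := hV.reach_exit_jump_exit hs ht hζ hyz hz hy (L := r + 1)
    (L' := 2 * r + 3) (by omega) (by omega) M
  have h_end : y + e 0 + (r + 1) • e 0 + M • e 1 ≠ z + (2 * r + 3) • e 0 := by
    refine fun h => absurd (congrArg Prod.snd h) ?_
    rw [snd_add_nsmul_e_one, snd_add_nsmul_e_zero, snd_add_e_zero, snd_add_nsmul_e_zero]
    omega
  rw [update_comm hzy, update_comm h_end] at h_jump_first
  exact h_jump_first.unique hV.closed h_exit_first

end IsIsolatedClosed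

end Exit

/-! ### The potential of a closed form that vanishes at isolated particles -/

section ExitPotential

open Filter Function

/-- The sites that precede `z` in the lexicographic order. -/
def before (z : Z2) : Set Z2 := {w | toLex w < toLex z}

/-- The translates of this function sum up to a potential of the form generated by `V`: the
particles leave to the right one after the other, starting with the last one. -/
def exitPotential (V : Config → EuclideanSpace ℝ (Fin 2)) (r : ℕ) (η : Config) : ℝ :=
  -exitCost V r (truncate (before 0) η) 0 (η 0)

variable {ω : Angle → ℝ} {V : Config → EuclideanSpace ℝ (Fin 2)} {r : ℕ} {η ξ ζ : Config}
  {x y z : Z2} {i : Fin 2} {s t : SiteState}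

lemma mem_before : x ∈ before z ↔ toLex x < toLex z := Iff.rfl

lemma truncate_congr {S : Set Z2} (h : ∀ x ∈ S, η x = ξ x) : truncate S η = truncate S ξ := by
  funext x
  by_cases hx : x ∈ S
  · rw [truncate_of_mem hx, truncate_of_mem hx, h x hx]
  · rw [truncate_of_notMem hx, truncate_of_notMem hx]

lemma truncate_before_update (h : toLex x ≤ toLex z) (η : Config) (t : SiteState) :
    truncate (before x) (update η z t) = truncate (before x) η :=
  truncate_congr fun _ hw => update_of_ne
    (fun hwz => (lt_of_lt_of_le (mem_before.1 hw) h).ne (congrArg toLex hwz)) _ _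

lemma LeftOf.truncate_eq (h : LeftOf ζ z) : truncate (before z) ζ = ζ := by
  funext x
  by_cases hx : x ∈ before z
  · exact truncate_of_mem hx
  · rw [truncate_of_notMem hx, h.eq_empty (not_lt.1 (mt mem_before.2 hx))]

lemma truncate_before_shift (x : Z2) (η : Config) :
    truncate (before 0) (shift x η) =
      shift x (truncate (before x) η) := by
  funext w
  have h_iff : w + x ∈ before x ↔ w ∈ before 0 := by
    simp only [mem_before, Prod.Lex.toLex_lt_toLex, Prod.fst_add, Prod.snd_add,
      Prod.fst_zero, Prod.snd_zero]
    omega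
  by_cases hw : w ∈ before 0
  · rw [truncate_of_mem hw, shift, shift, truncate_of_mem (h_iff.2 hw)]
  · rw [truncate_of_notMem hw, shift, truncate_of_notMem (mt h_iff.1 hw)]

lemma shift_update (x y : Z2) (η : Config) (t : SiteState) :
    shift x (update η (y + x) t) = update (shift x η) y t := by
  funext w
  simp only [shift, update_apply, add_left_inj]

lemma translates_exitPotential (V : Config → EuclideanSpace ℝ (Fin 2)) (r : ℕ) (x : Z2)
    (η : Config) : translates (exitPotential V r) x η =
      -exitCost V r (truncate (before x) η) x (η x) := by
  rw [translates, exitPotential, truncate_before_shift]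
  refine congrArg Neg.neg (Finset.sum_congr rfl fun k _ => ?_)
  rw [← shift_update, shift_shift, shift, zero_add, zero_add, add_comm x]

lemma exitPotential_mem_weightedSpan (hV : (fun η => V η 0) ∈ weightedSpan ω) (r : ℕ) :
    exitPotential V r ∈ weightedSpan ω := by
  classical
  set g : ℕ → Z2 → Option Z2 := fun k w =>
    if w = 0 then some 0 else if w + k • e 0 ∈ before 0 then some (w + k • e 0) else none
  have h_sum : exitPotential V r =
      -∑ k ∈ Finset.range (r + 1), fun η => V (relabel (g k) η) 0 := by
    funext η
    rw [exitPotential, exitCost, Pi.neg_apply, Finset.sum_apply]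
    refine congrArg Neg.neg (Finset.sum_congr rfl fun k _ => congrArg (fun ξ => V ξ 0) ?_)
    funext w
    have h_update (ξ : Config) (t : SiteState) :
        shift (0 + k • e 0) (update ξ (0 + k • e 0) t) = update (shift (k • e 0) ξ) 0 t := by
      rw [← shift_update, zero_add]
    rw [h_update]
    rcases eq_or_ne w 0 with rfl | hw
    · simp [relabel, g]
    · rw [update_of_ne hw]
      by_cases h : w + k • e 0 ∈ before 0
      · rw [shift, truncate_of_mem h]
        simp only [relabel, g, if_neg hw, if_pos h, Option.elim_some]
      · rw [shift, truncate_of_notMem h]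
        simp only [relabel, g, if_neg hw, if_neg h, Option.elim_none]
  rw [h_sum]
  exact neg_mem (sum_mem fun k _ => comp_relabel_mem_weightedSpan hV (g k))

lemma eventuallyEq_update (η : Config) (z : Z2) (t : SiteState) :
    η =ᶠ[cofinite] update η z t :=
  (Set.finite_singleton z).subset fun _ hx => by_contra fun hxz => hx (update_of_ne hxz _ _).symm

namespace IsIsolatedClosed

variable (hV : IsIsolatedClosed V r)

include hV

lemma exitCost_empty (ζ : Config) (z : Z2) : exitCost V r ζ z SiteState.empty = 0 :=
  Finset.sum_eq_zero fun k _ =>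
    hV.exclusion 0 _ fun h => h.1 (by rw [shift, zero_add, update_self])

lemma totalDiff_update (hζ : LeftOf ζ z) (t : SiteState) :
    totalDiff (translates (exitPotential V r)) ζ (update ζ z t) = -exitCost V r ζ z t := by
  simp only [totalDiff, translates_exitPotential]
  rw [finsum_eq_single _ z]
  · rw [truncate_before_update le_rfl, hζ.truncate_eq, update_self, hζ.eq_empty le_rfl,
      hV.exitCost_empty, neg_zero, sub_zero]
  · intro x hxz
    rw [update_of_ne hxz]
    rcases lt_or_ge (toLex z) (toLex x) with hzx | hxz
    · rw [hζ.eq_empty hzx.le, hV.exitCost_empty, hV.exitCost_empty, sub_self]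
    · rw [truncate_before_update hxz, sub_self]

variable (hloc : IsLocal (exitPotential V r))

include hloc

lemma totalDiff_update_right (h : ξ =ᶠ[cofinite] ζ) (hζ : LeftOf ζ z) (t : SiteState) :
    totalDiff (translates (exitPotential V r)) ξ (update ζ z t) =
      totalDiff (translates (exitPotential V r)) ξ ζ - exitCost V r ζ z t := by
  rw [sub_eq_add_neg, ← hV.totalDiff_update hζ t]
  exact (totalDiff_trans (isUniformlyLocal_translates hloc) h (eventuallyEq_update ζ z t)).symm

lemma totalDiff_update_update (h : ζ =ᶠ[cofinite] ξ) (hζ : LeftOf ζ y) (hξ : LeftOf ξ z)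
    (s t : SiteState) :
    totalDiff (translates (exitPotential V r)) (update ζ y s) (update ξ z t) =
      exitCost V r ζ y s + totalDiff (translates (exitPotential V r)) ζ ξ - exitCost V r ξ z t := by
  rw [hV.totalDiff_update_right hloc ((eventuallyEq_update ζ y s).symm.trans h) hξ, totalDiff_symm,
    hV.totalDiff_update_right hloc h.symm hζ, totalDiff_symm _ ζ ξ]
  ring

lemma totalDiff_jump_of_lt (hs : s ≠ SiteState.empty) (ht : t ≠ SiteState.empty)
    (hζ : LeftOf ζ z) (hz : toLex (y + e i) < toLex z) (hy : ζ y = SiteState.empty)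
    (hy' : ζ (y + e i) = SiteState.empty)
    (h_jump : totalDiff (translates (exitPotential V r)) (update ζ y s) (update ζ (y + e i) s) =
      V (shift y (update ζ y s)) i) :
    totalDiff (translates (exitPotential V r)) (update (update ζ y s) z t)
        (update (update ζ (y + e i) s) z t) =
      V (shift y (update (update ζ y s) z t)) i := by
  rw [hV.totalDiff_update_update hloc ((eventuallyEq_update ζ y s).symm.trans
    (eventuallyEq_update ζ _ s)) (hζ.update ((lt_add_e y i).trans hz) s) (hζ.update hz s), h_jump]
  linarith [hV.jump_exit_comm hs ht hζ hz hy hy']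

lemma totalDiff_jump_of_gt (hs : s ≠ SiteState.empty) (ht : t ≠ SiteState.empty)
    (hζ : LeftOf ζ z) (hyz : toLex y < toLex z) (hz : toLex z < toLex (y + e i))
    (hy : ζ y = SiteState.empty)
    (h_jump : totalDiff (translates (exitPotential V r)) (update ζ y s) (update ζ (y + e i) s) =
      V (shift y (update ζ y s)) i) :
    totalDiff (translates (exitPotential V r)) (update (update ζ y s) z t)
        (update (update ζ (y + e i) s) z t) =
      V (shift y (update (update ζ y s) z t)) i := by
  obtain rfl : i = 0 := by
    by_contra hi
    obtain rfl : i = 1 := by omega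
    rw [Prod.Lex.toLex_lt_toLex] at hyz hz
    simp only [e, one_ne_zero, if_false, Prod.fst_add, Prod.snd_add] at hz
    omega
  have hζ' : LeftOf ζ (y + e 0) := hζ.mono hz.le
  have h_start : update ζ y s =ᶠ[cofinite] ζ := (eventuallyEq_update ζ y s).symm
  rw [hV.totalDiff_update_right hloc h_start hζ'] at h_jump
  rw [update_comm (a := y + e 0) (fun h => hz.ne' (congrArg toLex h)),
    hV.totalDiff_update_update hloc (h_start.trans (eventuallyEq_update ζ z t))
      (hζ.update hyz s) (hζ'.update hz t), hV.totalDiff_update_right hloc h_start hζ]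
  linarith [hV.jump_exit_exchange hs ht hζ hyz hz hy]

lemma totalDiff_swap_update (ht : t ≠ SiteState.empty) (hζ : LeftOf ζ z)
    (ih : ∀ y i, CanJump ζ y (y + e i) →
      totalDiff (translates (exitPotential V r)) ζ (swap y (y + e i) ζ) = V (shift y ζ) i)
    (hj : CanJump (update ζ z t) y (y + e i)) :
    totalDiff (translates (exitPotential V r)) (update ζ z t)
      (swap y (y + e i) (update ζ z t)) = V (shift y (update ζ z t)) i := by
  rcases eq_or_ne y z with rfl | hyz
  · have hζ' := hζ.mono (lt_add_e y i).le
    rw [swap_update (hζ.eq_empty le_rfl) (hζ.eq_empty (lt_add_e y i).le),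
      hV.totalDiff_update_update hloc EventuallyEq.rfl hζ hζ', totalDiff_self, add_zero,
      ← hV.jump_add_exitCost hζ ht i, add_sub_cancel_right]
  have hzy' : y + e i ≠ z := fun h => ht (by simpa only [h, update_self] using hj.2)
  rw [CanJump, update_of_ne hyz, update_of_ne hzy'] at hj
  obtain ⟨ζ₀, s, hy₀, rfl⟩ : ∃ ζ₀ s, ζ₀ y = SiteState.empty ∧ ζ = update ζ₀ y s :=
    ⟨update ζ y SiteState.empty, ζ y, update_self .., by simp⟩
  have hζ₀ : LeftOf ζ₀ z := fun x hx => hζ x fun hc => hx <| by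
    rcases eq_or_ne x y with rfl | hxy
    · exact hy₀
    · rwa [update_of_ne hxy] at hc
  have hy₀' : ζ₀ (y + e i) = SiteState.empty := by
    rw [← hj.2, update_of_ne (add_ne_left.2 (e_ne_zero i))]
  have hs : s ≠ SiteState.empty := by simpa only [update_self] using hj.1
  have h_jump := ih y i (by rwa [CanJump])
  rw [swap_update hy₀ hy₀'] at h_jump
  rw [update_comm hyz, swap_update (by rwa [update_of_ne hyz]) (by rwa [update_of_ne hzy']),
    update_comm hyz.symm, update_comm hzy'.symm]
  rcases lt_or_gt_of_ne fun h => hzy' (toLex.injective h) with h | h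
  · exact hV.totalDiff_jump_of_lt hloc hs ht hζ₀ h hy₀ hy₀' h_jump
  · exact hV.totalDiff_jump_of_gt hloc hs ht hζ₀
      (hζ y (by rwa [update_self])) h hy₀ h_jump

lemma totalDiff_swap_truncate (s : Finset Z2) (η : Config)
    (hj : CanJump (truncate s η) y (y + e i)) :
    totalDiff (translates (exitPotential V r)) (truncate s η) (swap y (y + e i) (truncate s η)) =
      V (shift y (truncate s η)) i := by
  induction s using Finset.induction_on_max_value (toLex : Z2 → ℤ ×ₗ ℤ) generalizing y i with
  | empty => exact absurd (truncate_of_notMem (Finset.notMem_empty y)) hj.1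
  | insert z s hz h_max ih =>
    have h_insert : truncate (insert z s : Finset Z2) η = update (truncate s η) z (η z) := by
      funext x
      rcases eq_or_ne x z with rfl | hxz
      · rw [update_self, truncate_of_mem (Finset.mem_insert_self x s)]
      · rw [update_of_ne hxz]
        simp [truncate, relabel, hxz]
    rw [h_insert] at hj ⊢
    by_cases ht : η z = SiteState.empty
    · rw [ht, update_eq_self_iff.2 (truncate_of_notMem hz).symm] at hj ⊢
      exact ih hj
    refine hV.totalDiff_swap_update hloc ht (fun x hx => ?_) (fun y i => ih) hj
    have hxs : x ∈ s := by_contra fun h => hx (truncate_of_notMem h)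
    exact lt_of_le_of_ne (h_max x hxs) fun h => hz (toLex.injective h ▸ hxs)

end IsIsolatedClosed

lemma IsLocal.eq_of_truncate {f g : Config → ℝ} (hf : IsLocal f) (hg : IsLocal g)
    (h : ∀ (s : Finset Z2) (η : Config), f (truncate s η) = g (truncate s η)) : f = g := by
  classical
  obtain ⟨s, hs⟩ := hf
  obtain ⟨s', hs'⟩ := hg
  funext η
  have h_truncate (x : Z2) (hx : x ∈ s ∪ s') : η x = truncate (s ∪ s' : Finset Z2) η x :=
    (truncate_of_mem hx).symm
  rw [hs fun x hx => h_truncate x (Finset.mem_union_left s' hx),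
    hs' fun x hx => h_truncate x (Finset.mem_union_right s hx), h]

lemma IsIsolatedClosed.eq_gradSum (hV : IsIsolatedClosed V r)
    (hVω : ∀ i, (fun η => V η i) ∈ weightedSpan ω) : V = gradSum (exitPotential V r) := by
  have hh := exitPotential_mem_weightedSpan (hVω 0) r
  suffices ∀ i, (fun η => V η i) = fun η => gradSum (exitPotential V r) η i by
    funext η
    ext i
    exact congrFun (this i) η
  intro i
  refine (isLocal_of_mem_weightedSpan (hVω i)).eq_of_truncate
    (isLocal_of_mem_weightedSpan (gradSum_mem_weightedSpan hh i)) fun s η => ?_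
  by_cases hj : CanJump (truncate s η) 0 (e i)
  · have h := hV.totalDiff_swap_truncate (y := 0) (i := i) (isLocal_of_mem_weightedSpan hh) s η
      (by rwa [zero_add])
    rw [zero_add, shift_zero] at h
    rw [gradSum_apply, hj.occ_mul_vacant, one_mul, h]
  · rw [hV.exclusion i _ hj, gradSum_apply, occ_mul_vacant_of_not_canJump hj, zero_mul]

end ExitPotential

/-! ### Decomposition of closed germs -/

section Decomposition

variable {ω : Angle → ℝ} {α : GrandParam} {U V : Config → EuclideanSpace ℝ (Fin 2)}
  {ψ : Fin 2 → SiteState → ℝ}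

lemma germForm_sub (U V : Config → EuclideanSpace ℝ (Fin 2)) (j : Jump) (η : Config) :
    germForm (U - V) j η = germForm U j η - germForm V j η := by
  obtain ⟨y, i, _ | _⟩ := j
  · exact neg_sub' _ _
  · rfl

lemma pathIntegral_sub (U V : Config → EuclideanSpace ℝ (Fin 2)) (η : Config) (γ : List Jump) :
    pathIntegral (germForm (U - V)) η γ =
      pathIntegral (germForm U) η γ - pathIntegral (germForm V) η γ := by
  induction γ generalizing η with
  | nil => exact (sub_self 0).symm
  | cons j γ ih => simp only [pathIntegral, ih, germForm_sub, sub_add_sub_comm]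

lemma gradSum_zero : gradSum 0 = 0 := by
  funext η
  ext i
  simp [gradSum]

lemma germ_zero (ψ : Fin 2 → SiteState → ℝ) : germ 0 ψ = current ψ := by
  funext η
  rw [germ, gradSum_zero, Pi.zero_apply, zero_add]

lemma IsClosedGerm.eq_zero_of_not_canJump (hU : IsClosedGerm α U) {i : Fin 2} {η : Config}
    (hη : ¬ CanJump η 0 (e i)) : U η i = 0 := by
  have h := (hU.2.1 ⟨0, i, true⟩).2 η
  simp only [germForm, Jump.tgt, if_true, zero_add, shift_zero] at h
  rw [h, occ_mul_vacant_of_not_canJump hη, zero_mul]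

lemma exists_range (hV : ∀ i, IsLocal fun η => V η i) :
    ∃ r, ∀ i η ξ, (∀ x : Z2, ¬ Far r x 0 → η x = ξ x) → V η i = V ξ i := by
  choose s hs using hV
  set r := (Finset.univ.biUnion s).sup fun x => x.1.natAbs + x.2.natAbs
  refine ⟨r, fun i η ξ h => hs i fun x hx => h x ?_⟩
  have h_le := Finset.le_sup (f := fun x : Z2 => x.1.natAbs + x.2.natAbs)
    (Finset.mem_biUnion.2 ⟨i, Finset.mem_univ i, hx⟩)
  simp only [Far, Prod.fst_zero, Prod.snd_zero]
  omega

lemma IsClosedGerm.exists_isIsolatedClosed_sub_current (hω : IsC2 ω) (hU : IsClosedGerm α U)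
    (hUω : ∀ i, (fun η => U η i) ∈ weightedSpan ω) (hψ : ∀ i, ψ i ∈ siteSpan ω)
    (hψU : ∀ i η, U (truncate {0} η) i = ψ i (η 0)) :
    ∃ r, IsIsolatedClosed (U - current ψ) r := by
  have h_current : IsClosedGerm α (current ψ) :=
    germ_zero ψ ▸ isClosedGerm_germ hω α (weightedSpan ω).zero_mem hψ
  have hVω (i : Fin 2) : (fun η => (U - current ψ) η i) ∈ weightedSpan ω :=
    sub_mem (hUω i) (current_mem_weightedSpan hψ i)
  obtain ⟨r, hr⟩ := exists_range fun i => isLocal_of_mem_weightedSpan (hVω i)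
  refine ⟨r, hr, fun i η hη => ?_, fun i η hη => ?_, fun η γ hγ h_end => ?_⟩
  · have h_single : (U - current ψ) η i = (U - current ψ) (truncate {0} η) i := by
      refine hr i _ _ fun x hx => ?_
      rcases eq_or_ne x 0 with rfl | hx₀
      · exact (truncate_of_mem (Set.mem_singleton 0)).symm
      · rw [truncate_of_notMem (Set.mem_singleton_iff.not.2 hx₀), hη x hx₀ hx]
    rw [h_single, Pi.sub_apply, PiLp.sub_apply, hψU, current_apply,
      truncate_of_mem (Set.mem_singleton 0), occ_of_empty
      (truncate_of_notMem (Set.mem_singleton_iff.not.2 (e_ne_zero i))), sub_zero, mul_one, sub_self]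
  · rw [Pi.sub_apply, PiLp.sub_apply, hU.eq_zero_of_not_canJump hη,
      h_current.eq_zero_of_not_canJump hη, sub_self]
  · rw [pathIntegral_sub, hU.2.2 η γ hγ h_end, h_current.2.2 η γ hγ h_end, sub_self]

lemma IsClosedGerm.eq_germ (hω : IsC2 ω) (hU : IsClosedGerm α U)
    (hUω : ∀ i, (fun η => U η i) ∈ weightedSpan ω) :
    ∃ h ∈ weightedSpan ω, ∃ ψ : Fin 2 → SiteState → ℝ, (∀ i, ψ i ∈ siteSpan ω) ∧
      U = germ h ψ := by
  choose ψ hψ hψU using fun i => exists_siteSpan_eq_truncate_single (hUω i) 0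
  obtain ⟨r, hV⟩ := hU.exists_isIsolatedClosed_sub_current hω hUω hψ hψU
  have hVω (i : Fin 2) : (fun η => (U - current ψ) η i) ∈ weightedSpan ω :=
    sub_mem (hUω i) (current_mem_weightedSpan hψ i)
  exact ⟨_, exitPotential_mem_weightedSpan (hVω 0) r, ψ, hψ, sub_eq_iff_eq_add.1
    (hV.eq_gradSum hVω)⟩

end Decomposition

/-! ### Canonical averages -/

section CanonicalMean

variable {l m : ℕ} {x y z : Z2} {ω : Angle → ℝ} {h : Config → ℝ} {η ξ : Config} {i : Fin 2}

/-- The rearrangements of the box `B_l`, over which canonical means are taken. -/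
abbrev BoxPerm (l : ℕ) : Type := Equiv.Perm {x // x ∈ box l}

lemma mem_box : x ∈ box l ↔ -(l : ℤ) ≤ x.1 ∧ x.1 ≤ l ∧ -(l : ℤ) ≤ x.2 ∧ x.2 ≤ l := by
  rw [box, Finset.mem_Icc, Prod.le_def, Prod.le_def]
  tauto

lemma box_mono (hlm : l ≤ m) : box l ⊆ box m := by
  intro x hx
  rw [mem_box] at *
  omega

lemma card_box (l : ℕ) : (box l).card = (2 * l + 1) ^ 2 := by
  rw [box, Finset.card_Icc_prod, Int.card_Icc, sq]
  congr 1 <;> omega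

lemma exists_subset_box (s : Finset Z2) : ∃ l, s ⊆ box l := by
  refine ⟨s.sup fun x => x.1.natAbs + x.2.natAbs, fun x hx => mem_box.2 ?_⟩
  have h_le := Finset.le_sup (f := fun x : Z2 => x.1.natAbs + x.2.natAbs) hx
  omega

lemma canonicalMean_eq (l : ℕ) (ζ : Config) (ψ : Config → ℝ) :
    canonicalMean l ζ ψ = (∑ π : BoxPerm l, ψ (permute (Equiv.Perm.ofSubtype π) ζ)) /
      (Fintype.card (BoxPerm l) : ℝ) := rfl

lemma ofSubtype_mem_box (π : BoxPerm l) (hx : x ∈ box l) : Equiv.Perm.ofSubtype π x ∈ box l := by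
  rw [Equiv.Perm.ofSubtype_apply_of_mem π hx]
  exact (π ⟨x, hx⟩).2

lemma exists_ofSubtype_eq_swap (hx : x ∈ box l) (hy : y ∈ box l) :
    ∃ ρ : BoxPerm l, Equiv.Perm.ofSubtype ρ = Equiv.swap x y :=
  ⟨Equiv.swap ⟨x, hx⟩ ⟨y, hy⟩, Equiv.Perm.ofSubtype_swap_eq _ _⟩

lemma exists_ofSubtype_eq_ofSubtype (hlm : l ≤ m) (ρ : BoxPerm l) :
    ∃ ρ' : BoxPerm m, Equiv.Perm.ofSubtype ρ' = Equiv.Perm.ofSubtype ρ := by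
  have h_out {x : Z2} (hx : x ∉ box l) : Equiv.Perm.ofSubtype ρ x = x :=
    Equiv.Perm.ofSubtype_apply_of_not_mem ρ hx
  refine ⟨_, Equiv.Perm.ofSubtype_subtypePerm (fun x => ?_) fun x hx =>
    box_mono hlm (not_imp_comm.1 h_out hx)⟩
  by_cases hx : x ∈ box l
  · exact iff_of_true (box_mono hlm (ofSubtype_mem_box ρ hx)) (box_mono hlm hx)
  · rw [h_out hx]

lemma canonicalMean_permute (ρ : BoxPerm l) (ζ : Config) (ψ : Config → ℝ) :
    canonicalMean l (permute (Equiv.Perm.ofSubtype ρ) ζ) ψ = canonicalMean l ζ ψ := by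
  rw [canonicalMean_eq, canonicalMean_eq, Fintype.sum_equiv (Equiv.mulLeft ρ) _
    (fun π => ψ (permute (Equiv.Perm.ofSubtype π) ζ)) fun π => by
      rw [permute_permute, ← map_mul, Equiv.coe_mulLeft]]

lemma canonicalMean_comp_permute (ρ : BoxPerm l) (ζ : Config) (ψ : Config → ℝ) :
    canonicalMean l ζ (fun η => ψ (permute (Equiv.Perm.ofSubtype ρ) η)) =
      canonicalMean l ζ ψ := by
  rw [canonicalMean_eq, canonicalMean_eq, Fintype.sum_equiv (Equiv.mulRight ρ) _
    (fun π => ψ (permute (Equiv.Perm.ofSubtype π) ζ)) fun π => by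
      rw [permute_permute, ← map_mul, Equiv.coe_mulRight]]

lemma canonicalMean_swap (hx : x ∈ box l) (hy : y ∈ box l) (ζ : Config) (ψ : Config → ℝ) :
    canonicalMean l (swap x y ζ) ψ = canonicalMean l ζ ψ := by
  obtain ⟨ρ, hρ⟩ := exists_ofSubtype_eq_swap hx hy
  rw [← canonicalMean_permute ρ ζ ψ, hρ]
  rfl

lemma canonicalMean_sub (l : ℕ) (ζ : Config) (ψ φ : Config → ℝ) :
    canonicalMean l ζ (ψ - φ) = canonicalMean l ζ ψ - canonicalMean l ζ φ := by
  simp only [canonicalMean_eq, Pi.sub_apply, Finset.sum_sub_distrib, sub_div]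

lemma canonicalMean_add (l : ℕ) (ζ : Config) (ψ φ : Config → ℝ) :
    canonicalMean l ζ (ψ + φ) = canonicalMean l ζ ψ + canonicalMean l ζ φ := by
  simp only [canonicalMean_eq, Pi.add_apply, Finset.sum_add_distrib, add_div]

lemma canonicalMean_canonicalMean (hlm : l ≤ m) (ζ : Config) (ψ : Config → ℝ) :
    canonicalMean m ζ (fun η => canonicalMean l η ψ) = canonicalMean m ζ ψ := by
  have h_card : (Fintype.card (BoxPerm l) : ℝ) ≠ 0 := Nat.cast_ne_zero.2 Fintype.card_ne_zero
  have h_inv (ρ : BoxPerm l) :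
      canonicalMean m ζ (fun η => ψ (permute (Equiv.Perm.ofSubtype ρ) η)) =
        canonicalMean m ζ ψ := by
    obtain ⟨ρ', hρ'⟩ := exists_ofSubtype_eq_ofSubtype hlm ρ
    rw [← hρ', canonicalMean_comp_permute]
  calc canonicalMean m ζ (fun η => canonicalMean l η ψ)
      = (∑ ρ : BoxPerm l, canonicalMean m ζ (fun η => ψ (permute (Equiv.Perm.ofSubtype ρ) η))) /
          (Fintype.card (BoxPerm l) : ℝ) := by
        simp only [canonicalMean_eq, ← Finset.sum_div]
        rw [Finset.sum_comm, div_right_comm]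
    _ = canonicalMean m ζ ψ := by
        rw [Finset.sum_congr rfl fun ρ _ => h_inv ρ, Finset.sum_const, Finset.card_univ,
          nsmul_eq_mul, mul_div_cancel_left₀ _ h_card]

lemma canonicalMean_mem_weightedSpan (hh : h ∈ weightedSpan ω) (l : ℕ) :
    (fun η => canonicalMean l η h) ∈ weightedSpan ω := by
  have h_sum : (fun η => canonicalMean l η h) = (Fintype.card (BoxPerm l) : ℝ)⁻¹ •
      ∑ π : BoxPerm l, fun η => h (permute (Equiv.Perm.ofSubtype π) η) := by
    funext η
    rw [Pi.smul_apply, Finset.sum_apply, smul_eq_mul, mul_comm, ← div_eq_mul_inv,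
      canonicalMean_eq]
  rw [h_sum]
  exact Submodule.smul_mem _ _ (sum_mem fun π _ => comp_permute_mem_weightedSpan hh _)

lemma dependsOn_canonicalMean (hh : DependsOn h (box l : Set Z2)) :
    DependsOn (fun η => canonicalMean l η h) (box l : Set Z2) := by
  intro η ξ he
  simp only [canonicalMean_eq]
  congr 1
  exact Finset.sum_congr rfl fun π _ => hh fun x hx => he _ (ofSubtype_mem_box π hx)

lemma card_perm_apply_eq {β : Type*} [Fintype β] [DecidableEq β] (y z : β) :
    Fintype.card β * (Finset.univ.filter fun π : Equiv.Perm β => π y = z).card =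
      Fintype.card (Equiv.Perm β) := by
  have h_fiber : ∀ w ∈ (Finset.univ : Finset β),
      (Finset.univ.filter fun π : Equiv.Perm β => π y = w).card =
        (Finset.univ.filter fun π : Equiv.Perm β => π y = z).card := by
    refine fun w _ => Finset.card_equiv (Equiv.mulLeft (Equiv.swap w z)) fun π => ?_
    simp only [Finset.mem_filter, Finset.mem_univ, true_and, Equiv.coe_mulLeft,
      Equiv.Perm.mul_apply, Equiv.swap_apply_eq_iff, Equiv.swap_apply_right]
  rw [← Finset.card_univ (α := Equiv.Perm β),
    Finset.card_eq_sum_card_fiberwise (s := Finset.univ) (f := fun π : Equiv.Perm β => π y)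
      (t := Finset.univ) fun _ _ => Finset.mem_coe.2 (Finset.mem_univ _),
    Finset.sum_congr rfl h_fiber, Finset.sum_const, Finset.card_univ, smul_eq_mul]

lemma card_boxPerm_apply_eq (hy : y ∈ box l) (hz : z ∈ box l) :
    ((Finset.univ.filter fun π : BoxPerm l => Equiv.Perm.ofSubtype π y = z).card : ℝ) =
      Fintype.card (BoxPerm l) / (2 * l + 1) ^ 2 := by
  have h_filter : (Finset.univ.filter fun π : BoxPerm l => Equiv.Perm.ofSubtype π y = z) =
      Finset.univ.filter fun π : BoxPerm l => π ⟨y, hy⟩ = ⟨z, hz⟩ :=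
    Finset.filter_congr fun π _ => by
      rw [Equiv.Perm.ofSubtype_apply_of_mem π hy, ← Subtype.coe_inj]
  rw [h_filter, ← card_perm_apply_eq (⟨y, hy⟩ : {x // x ∈ box l}) ⟨z, hz⟩, Fintype.card_coe,
    card_box, eq_div_iff (by positivity)]
  push_cast
  ring

open Classical in
lemma abs_sub_le_sum_of_dependsOn {ι S : Type*} {f : (ι → S) → ℝ} {s : Finset ι}
    (hs : DependsOn f (s : Set ι)) {C : ℝ} (hC : ∀ η, |f η| ≤ C) (η ξ : ι → S) :
    |f η - f ξ| ≤ ∑ x ∈ s, if η x = ξ x then 0 else 2 * C := by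
  have hC₀ : 0 ≤ C := (abs_nonneg _).trans (hC η)
  have h_nonneg (x : ι) : 0 ≤ if η x = ξ x then 0 else 2 * C := by split_ifs <;> positivity
  by_cases h_eq : ∀ x ∈ s, η x = ξ x
  · rw [hs h_eq, sub_self, abs_zero]
    exact Finset.sum_nonneg fun x _ => h_nonneg x
  · push Not at h_eq
    obtain ⟨x, hx, hne⟩ := h_eq
    calc |f η - f ξ| ≤ |f η| + |f ξ| := abs_sub _ _
      _ ≤ 2 * C := by linarith [hC η, hC ξ]
      _ = if η x = ξ x then 0 else 2 * C := (if_neg hne).symm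
      _ ≤ _ := Finset.single_le_sum (fun x _ => h_nonneg x) hx

/-- A site of the box is carried into `s` by a fraction `s.card / |B_l|` of the rearrangements, so
averaging makes the function insensitive to single sites. -/
lemma abs_canonicalMean_sub_le {s : Finset Z2} (hs : DependsOn h (s : Set Z2)) {C : ℝ}
    (hC : ∀ η, |h η| ≤ C) (hl : s ⊆ box l) (hz : z ∈ box l)
    (he : ∀ x ∈ box l, x ≠ z → η x = ξ x) :
    |canonicalMean l η h - canonicalMean l ξ h| ≤ 2 * C * s.card / (2 * l + 1 : ℝ) ^ 2 := by
  classical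
  have hC₀ : 0 ≤ C := (abs_nonneg _).trans (hC η)
  have h_card : (0 : ℝ) < Fintype.card (BoxPerm l) := Nat.cast_pos.2 Fintype.card_pos
  have h_perm (π : BoxPerm l) :
      |h (permute (Equiv.Perm.ofSubtype π) η) - h (permute (Equiv.Perm.ofSubtype π) ξ)| ≤
        ∑ y ∈ s, if Equiv.Perm.ofSubtype π y = z then 2 * C else 0 := by
    refine (abs_sub_le_sum_of_dependsOn hs hC _ _).trans (Finset.sum_le_sum fun y hy => ?_)
    by_cases hyz : Equiv.Perm.ofSubtype π y = z
    · rw [if_pos hyz]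
      split_ifs <;> linarith
    · have h_eq : permute (Equiv.Perm.ofSubtype π) η y = permute (Equiv.Perm.ofSubtype π) ξ y :=
        he _ (ofSubtype_mem_box π (hl hy)) hyz
      rw [if_neg hyz, if_pos h_eq]
  have h_count : ∀ y ∈ s, ∑ π : BoxPerm l, (if Equiv.Perm.ofSubtype π y = z then 2 * C else 0) =
      Fintype.card (BoxPerm l) / (2 * l + 1) ^ 2 * (2 * C) := fun y hy => by
    rw [← Finset.sum_filter, Finset.sum_const, nsmul_eq_mul, card_boxPerm_apply_eq (hl hy) hz]
  rw [canonicalMean_eq, canonicalMean_eq, ← sub_div, ← Finset.sum_sub_distrib, abs_div,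
    abs_of_pos h_card, div_le_iff₀ h_card]
  calc |∑ π : BoxPerm l, (h (permute (Equiv.Perm.ofSubtype π) η) -
          h (permute (Equiv.Perm.ofSubtype π) ξ))|
      ≤ ∑ π : BoxPerm l, ∑ y ∈ s, if Equiv.Perm.ofSubtype π y = z then 2 * C else 0 :=
        (Finset.abs_sum_le_sum_abs _ _).trans (Finset.sum_le_sum fun π _ => h_perm π)
    _ = s.card * (Fintype.card (BoxPerm l) / (2 * l + 1) ^ 2 * (2 * C)) := by
        rw [Finset.sum_comm, Finset.sum_congr rfl h_count, Finset.sum_const, nsmul_eq_mul]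
    _ = 2 * C * s.card / (2 * l + 1) ^ 2 * Fintype.card (BoxPerm l) := by ring

/-- The translations for which exactly one end of the bond `(0, e_i)` is carried into the box. -/
def boundaryShifts (l : ℕ) (i : Fin 2) : Finset Z2 :=
  if i = 0 then {-(l : ℤ), (l : ℤ) + 1} ×ˢ Finset.Icc (-(l : ℤ)) l
  else Finset.Icc (-(l : ℤ)) l ×ˢ {-(l : ℤ), (l : ℤ) + 1}

lemma card_boundaryShifts (l : ℕ) (i : Fin 2) : (boundaryShifts l i).card = 2 * (2 * l + 1) := by
  have h_ends : ({-(l : ℤ), (l : ℤ) + 1} : Finset ℤ).card = 2 := Finset.card_pair (by omega)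
  have h_side : (Finset.Icc (-(l : ℤ)) l).card = 2 * l + 1 := by rw [Int.card_Icc]; omega
  unfold boundaryShifts
  split_ifs <;> rw [Finset.card_product, h_ends, h_side]
  ring

lemma notMem_boundaryShifts : x ∉ boundaryShifts l i ↔ (-x ∈ box l ↔ e i - x ∈ box l) := by
  fin_cases i <;>
  · simp [boundaryShifts, mem_box, e]
    omega

lemma shift_swap_zero (i : Fin 2) (x : Z2) (η : Config) :
    shift x (swap 0 (e i) η) = swap (-x) (e i - x) (shift x η) := by
  rw [swap_shift, neg_add_cancel, sub_add_cancel]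

lemma translates_canonicalMean_swap (hh : DependsOn h (box l : Set Z2))
    (hx : x ∉ boundaryShifts l i) :
    translates (fun ζ => canonicalMean l ζ h) x (swap 0 (e i) η) =
      translates (fun ζ => canonicalMean l ζ h) x η := by
  have h_ends := notMem_boundaryShifts.1 hx
  rw [translates, shift_swap_zero]
  by_cases h_in : -x ∈ box l
  · exact canonicalMean_swap h_in (h_ends.1 h_in) _ _
  · refine dependsOn_canonicalMean hh fun y hy => swap_of_ne _ ?_ ?_
    · exact ne_of_mem_of_not_mem hy h_in
    · exact ne_of_mem_of_not_mem hy (mt h_ends.2 h_in)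

lemma abs_translates_canonicalMean_sub_le {s : Finset Z2} (hs : DependsOn h (s : Set Z2)) {C : ℝ}
    (hC : ∀ η, |h η| ≤ C) (hl : s ⊆ box l) (hx : x ∈ boundaryShifts l i) :
    |translates (fun ζ => canonicalMean l ζ h) x (swap 0 (e i) η) -
      translates (fun ζ => canonicalMean l ζ h) x η| ≤ 2 * C * s.card / (2 * l + 1 : ℝ) ^ 2 := by
  rw [translates, translates, shift_swap_zero]
  have h_ends := notMem_boundaryShifts.not_right.1 hx
  by_cases h_in : -x ∈ box l
  · have h_out : e i - x ∉ box l := fun h => h_ends (iff_of_true h_in h)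
    exact abs_canonicalMean_sub_le hs hC hl h_in fun y hy hne =>
      swap_of_ne _ hne (ne_of_mem_of_not_mem hy h_out)
  · have h_in' : e i - x ∈ box l := by_contra fun h => h_ends (iff_of_false h_in h)
    exact abs_canonicalMean_sub_le hs hC hl h_in' fun y hy hne =>
      swap_of_ne _ (ne_of_mem_of_not_mem hy h_in) hne

lemma abs_gradSum_canonicalMean_le {s : Finset Z2} (hs : DependsOn h (s : Set Z2)) {C : ℝ}
    (hC : ∀ η, |h η| ≤ C) (hl : s ⊆ box l) (η : Config) (i : Fin 2) :
    |gradSum (fun ζ => canonicalMean l ζ h) η i| ≤ 4 * C * s.card / (2 * l + 1 : ℝ) := by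
  have hC₀ : 0 ≤ C := (abs_nonneg _).trans (hC η)
  have h_support : (Function.support fun x =>
      translates (fun ζ => canonicalMean l ζ h) x (swap 0 (e i) η) -
        translates (fun ζ => canonicalMean l ζ h) x η) ⊆ boundaryShifts l i := by
    intro x hx
    by_contra h_notMem
    exact hx (sub_eq_zero.2 (translates_canonicalMean_swap (hs.mono (Finset.coe_subset.2 hl))
      fun h => h_notMem (Finset.mem_coe.2 h)))
  have h_diff : |totalDiff (translates fun ζ => canonicalMean l ζ h) η (swap 0 (e i) η)| ≤
      4 * C * s.card / (2 * l + 1 : ℝ) := by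
    rw [totalDiff, finsum_eq_sum_of_support_subset _ h_support]
    calc _ ≤ _ := Finset.abs_sum_le_sum_abs _ _
      _ ≤ (boundaryShifts l i).card • (2 * C * s.card / (2 * l + 1 : ℝ) ^ 2) :=
        Finset.sum_le_card_nsmul _ _ _ fun x => abs_translates_canonicalMean_sub_le hs hC hl
      _ = 4 * C * s.card / (2 * l + 1 : ℝ) := by
        rw [card_boundaryShifts, nsmul_eq_mul]
        push_cast
        field_simp
        ring
  rw [gradSum_apply, abs_mul]
  by_cases hη : CanJump η 0 (e i)
  · rwa [hη.occ_mul_vacant, abs_one, one_mul]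
  · rw [occ_mul_vacant_of_not_canJump hη, abs_zero, zero_mul]
    positivity

end CanonicalMean

/-! ### Centred approximations -/

section Centered

variable {l m : ℕ} {ω : Angle → ℝ} {h f : Config → ℝ}

lemma gradSum_add {h k : Config → ℝ} (hh : IsLocal h) (hk : IsLocal k) :
    gradSum (h + k) = gradSum h + gradSum k := by
  funext η
  ext i
  rw [Pi.add_apply, PiLp.add_apply, gradSum_apply, gradSum_apply, gradSum_apply, ← mul_add,
    ← totalDiff_add (isUniformlyLocal_translates hh) (isUniformlyLocal_translates hk)
    (eventuallyEq_swap _ _ _)]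
  rfl

lemma gradSum_smul (a : ℝ) (h : Config → ℝ) : gradSum (a • h) = a • gradSum h := by
  funext η
  ext i
  rw [Pi.smul_apply, PiLp.smul_apply, gradSum_apply, gradSum_apply, smul_eq_mul, mul_left_comm]
  exact congrArg _ (totalDiff_smul a (translates h) η _)

lemma gradSum_sub {h k : Config → ℝ} (hh : IsLocal h) (hk : IsLocal k) :
    gradSum (h - k) = gradSum h - gradSum k := by
  have hk' : IsLocal (-k) := (localFunctions Z2 SiteState).neg_mem hk
  rw [sub_eq_add_neg, gradSum_add hh hk', ← neg_one_smul ℝ k, gradSum_smul, neg_one_smul,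
    ← sub_eq_add_neg]

lemma gradSum_comp_shift (h : Config → ℝ) (x : Z2) :
    gradSum (fun η => h (shift x η)) = gradSum h := by
  funext η
  ext i
  rw [gradSum_apply, gradSum_apply]
  congr 1
  simp only [totalDiff, translates, shift_shift]
  exact finsum_comp_equiv (Equiv.addLeft x)
    (f := fun y => h (shift y (swap 0 (e i) η)) - h (shift y η))

lemma occ_mem_weightedSpan (ω : Angle → ℝ) (x : Z2) : occ x ∈ weightedSpan ω := by
  have h_site : (fun s : SiteState => s.count .active + s.count .passive) ∈ siteSpan ω :=
    add_mem (count_mem_siteSpan ω _) (count_mem_siteSpan ω _)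
  have h_occ := mul_mem_weightedSpan h_site x (one_mem blindLocal)
  simp only [Pi.one_apply, mul_one] at h_occ
  exact h_occ

/-- The difference of the occupations of two corners of `B_l`: it depends on no smaller box. -/
def cornerDiff (l : ℕ) : Config → ℝ := occ ((l : ℤ), (l : ℤ)) - occ ((l : ℤ), -(l : ℤ))

lemma cornerDiff_mem_weightedSpan (ω : Angle → ℝ) (l : ℕ) : cornerDiff l ∈ weightedSpan ω :=
  sub_mem (occ_mem_weightedSpan ω _) (occ_mem_weightedSpan ω _)

lemma gradSum_cornerDiff (l : ℕ) : gradSum (cornerDiff l) = 0 := by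
  have h_occ (x : Z2) : occ x = fun η => occ 0 (shift x η) := by
    funext η
    simp only [occ, num, shift, zero_add]
  have h_local (x : Z2) : IsLocal (occ x) := isLocal_of_mem_weightedSpan
    (occ_mem_weightedSpan 0 x)
  rw [cornerDiff, gradSum_sub (h_local _) (h_local _), h_occ ((l : ℤ), (l : ℤ)),
    h_occ ((l : ℤ), -(l : ℤ)), gradSum_comp_shift, gradSum_comp_shift, sub_self]

lemma canonicalMean_cornerDiff (hlm : l ≤ m) (ζ : Config) :
    canonicalMean m ζ (cornerDiff l) = 0 := by
  obtain ⟨ρ, hρ⟩ := exists_ofSubtype_eq_swap (l := m) (x := ((l : ℤ), (l : ℤ)))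
    (y := ((l : ℤ), -(l : ℤ))) (mem_box.2 (by omega)) (mem_box.2 (by omega))
  rw [cornerDiff, canonicalMean_sub, sub_eq_zero, ← canonicalMean_comp_permute ρ ζ (occ _), hρ]
  congr 1
  funext η
  simp only [occ, num, permute, Equiv.swap_apply_left]

lemma not_dependsOn_cornerDiff (hml : m < l) :
    ¬ DependsOn (cornerDiff l) (box m : Set Z2) := by
  intro h_dep
  set η₀ : Config := fun _ => SiteState.empty
  set η₁ : Config := Function.update η₀ ((l : ℤ), (l : ℤ)) (SiteState.particle .active 0) with hη₁
  have h_corner : η₁ ((l : ℤ), (l : ℤ)) ≠ SiteState.empty := by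
    rw [hη₁, Function.update_self]
    exact SiteState.particle_ne_empty _ _
  have h_corner' : η₁ ((l : ℤ), -(l : ℤ)) = SiteState.empty :=
    Function.update_of_ne (fun h => by have := congrArg Prod.snd h; simp only at this; omega) _ _
  have h_eq : cornerDiff l η₁ = cornerDiff l η₀ := h_dep fun x hx =>
    Function.update_of_ne (by rintro rfl; exact absurd (mem_box.1 hx) (by omega)) _ _
  rw [cornerDiff, Pi.sub_apply, Pi.sub_apply, occ_of_ne_empty h_corner, occ_of_empty h_corner',
    occ_of_empty (η := η₀) rfl, occ_of_empty (η := η₀) rfl, sub_self, sub_zero] at h_eq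
  exact one_ne_zero h_eq

lemma exists_isCenteredCylinder_gradSum_eq (hω : IsC2 ω) (hf : f ∈ weightedSpan ω)
    (h_mean : ∀ k, l ≤ k → ∀ ζ, canonicalMean k ζ f = 0) :
    ∃ g ∈ weightedSpan ω, IsCenteredCylinder g ∧ gradSum g = gradSum f := by
  by_cases h_dep : ∃ k < l, DependsOn f (box k : Set Z2)
  · -- No mean of `f` over a box smaller than `B_l` is known to vanish, so `f` is made sensitive
    -- to the whole of `B_l`.
    obtain ⟨k₀, hk₀, h_dep₀⟩ := h_dep
    have hg : f + cornerDiff l ∈ weightedSpan ω :=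
      add_mem hf (cornerDiff_mem_weightedSpan ω l)
    refine ⟨_, hg, ⟨isCylinder_of_mem_weightedSpan hω hg, fun k hk ζ _ => ?_⟩, ?_⟩
    · have hlk : l ≤ k := by
        by_contra! hkl
        refine not_dependsOn_cornerDiff (max_lt hkl hk₀) fun η ξ he => ?_
        have h_sum := hk.mono (Finset.coe_subset.2 (box_mono (le_max_left k k₀))) he
        rwa [Pi.add_apply, Pi.add_apply,
          h_dep₀.mono (Finset.coe_subset.2 (box_mono (le_max_right k k₀))) he,
          add_right_inj] at h_sum
      rw [canonicalMean_add, h_mean k hlk, canonicalMean_cornerDiff hlk, add_zero]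
    · rw [gradSum_add (isLocal_of_mem_weightedSpan hf)
        (isLocal_of_mem_weightedSpan (cornerDiff_mem_weightedSpan ω l)), gradSum_cornerDiff,
        add_zero]
  · push Not at h_dep
    exact ⟨f, hf, ⟨isCylinder_of_mem_weightedSpan hω hf, fun k hk ζ _ =>
      h_mean k (not_lt.1 fun hkl => h_dep k hkl hk) ζ⟩, rfl⟩

lemma exists_abs_gradSum_canonicalMean_le (hω : IsC2 ω) (hh : h ∈ weightedSpan ω) {ε : ℝ}
    (hε : 0 < ε) : ∃ l, ∀ η i, |gradSum (fun ζ => canonicalMean l ζ h) η i| ≤ ε := by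
  obtain ⟨s, hs⟩ := isLocal_of_mem_weightedSpan hh
  obtain ⟨-, C, hC⟩ := weightedSpan_le_boundedMeasurable hω hh
  obtain ⟨r, hr⟩ := exists_subset_box s
  obtain ⟨K, hK⟩ := exists_nat_gt (4 * C * s.card / ε)
  refine ⟨r + K, fun η i => (abs_gradSum_canonicalMean_le hs hC
    (hr.trans (box_mono (Nat.le_add_right r K))) η i).trans ?_⟩
  rw [div_lt_iff₀ hε] at hK
  rw [div_le_iff₀ (by positivity), mul_comm ε]
  refine hK.le.trans (mul_le_mul_of_nonneg_right ?_ hε.le)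
  push_cast
  linarith [Nat.cast_nonneg (α := ℝ) r, Nat.cast_nonneg (α := ℝ) K]

lemma exists_centered_approx (hω : IsC2 ω) (hh : h ∈ weightedSpan ω) {ε : ℝ} (hε : 0 < ε) :
    ∃ f ∈ weightedSpan ω, IsCenteredCylinder f ∧
      ∀ η i, |gradSum h η i - gradSum f η i| ≤ ε := by
  obtain ⟨l, hl⟩ := exists_abs_gradSum_canonicalMean_le hω hh hε
  have h_mean := canonicalMean_mem_weightedSpan hh l
  obtain ⟨f, hf, hfc, h_grad⟩ := exists_isCenteredCylinder_gradSum_eq (l := l) hω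
    (sub_mem hh h_mean) fun k hk ζ => by
      rw [canonicalMean_sub, canonicalMean_canonicalMean hk, sub_self]
  refine ⟨f, hf, hfc, fun η i => ?_⟩
  rw [h_grad, gradSum_sub (isLocal_of_mem_weightedSpan hh) (isLocal_of_mem_weightedSpan h_mean),
    Pi.sub_apply, PiLp.sub_apply, sub_sub_cancel]
  exact hl η i

end Centered

/-! ### Permutations realized by the motion of a hole -/

lemma eventuallyEq_permute {π : Equiv.Perm Z2} (hπ : {x | π x ≠ x}.Finite) (η : Config) :
    η =ᶠ[Filter.cofinite] permute π η :=
  hπ.subset fun _ hx hπx => hx (congrArg η hπx).symm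

lemma measurable_permute (π : Equiv.Perm Z2) : Measurable (permute π) :=
  measurable_pi_lambda _ fun _ => measurable_pi_apply _

lemma finite_swap_ne (x y : Z2) : {w | Equiv.swap x y w ≠ w}.Finite :=
  (Set.toFinite {x, y}).subset fun w hw => by
    by_contra hxy
    rw [Set.mem_insert_iff, Set.mem_singleton_iff, not_or] at hxy
    exact hw (Equiv.swap_apply_of_ne_of_ne hxy.1 hxy.2)

lemma finite_mul_ne {π ρ : Equiv.Perm Z2} (hπ : {x | π x ≠ x}.Finite)
    (hρ : {x | ρ x ≠ x}.Finite) : {x | (π * ρ) x ≠ x}.Finite :=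
  (hπ.union hρ).subset (Equiv.Perm.set_support_mul_subset π ρ)

section HoleBound

variable {α : GrandParam} {k : Z2 → Config → ℝ} {π ρ : Equiv.Perm Z2} {a b : Z2}

lemma exists_totalDiff_permute_eq_sum (hk : IsUniformlyLocal k) (hπ : {x | π x ≠ x}.Finite) :
    ∃ X : Finset Z2, ∀ η, totalDiff k η (permute π η) = ∑ x ∈ X, (k x (permute π η) - k x η) := by
  obtain ⟨X, hX⟩ := hk.exists_totalDiff_eq_sum hπ.toFinset
  refine ⟨X, fun η => hX η _ fun y hy => ?_⟩
  rw [Set.Finite.mem_toFinset, Set.mem_ofPred_eq, not_not] at hy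
  rw [permute, hy]

lemma totalDiff_permute_mul (hk : IsUniformlyLocal k) (hπ : {x | π x ≠ x}.Finite)
    (hρ : {x | ρ x ≠ x}.Finite) (η : Config) :
    totalDiff k η (permute (π * ρ) η) =
      totalDiff k η (permute π η) + totalDiff k (permute π η) (permute ρ (permute π η)) := by
  rw [totalDiff_trans hk (eventuallyEq_permute hπ η) (eventuallyEq_permute hρ _), permute_permute]

lemma totalDiff_permute_mem_boundedMeasurable (hk : IsUniformlyLocal k)
    (hkb : ∀ x, k x ∈ boundedMeasurable Config) (hπ : {x | π x ≠ x}.Finite) :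
    (fun η => totalDiff k η (permute π η)) ∈ boundedMeasurable Config := by
  obtain ⟨X, hX⟩ := exists_totalDiff_permute_eq_sum hk hπ
  have h_sum := sum_mem (S := boundedMeasurable Config) (t := X) fun x _ =>
    sub_mem (comp_mem_boundedMeasurable (hkb x) (measurable_permute π)) (hkb x)
  convert h_sum using 1
  funext η
  rw [hX, Finset.sum_apply]
  rfl

/-- A bound on the change of the formal sum `∑_x k_x` under the permutation `π` of the sites, on
the configurations with a hole at `a`. Such bounds add up when the permutation is performed in
steps and the hole is followed. -/
structure HoleBound (α : GrandParam) (k : Z2 → Config → ℝ) (π : Equiv.Perm Z2) (a : Z2)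
    (C : ℝ≥0∞) : Prop where
  finite_ne : {x | π x ≠ x}.Finite
  eLpNorm_le : ∀ A : Set Config, MeasurableSet A → (∀ η ∈ A, η a = SiteState.empty) →
    eLpNorm (fun η => totalDiff k η (permute π η)) 1 ((grandMeasure α).restrict A) ≤
      C * grandMeasure α A ^ (1 / 2 : ℝ)

lemma permute_inv_permute (π : Equiv.Perm Z2) (η : Config) :
    permute π⁻¹ (permute π η) = η := by
  rw [permute_permute, mul_inv_cancel]
  rfl

lemma HoleBound.eLpNorm_comp_permute_le {C : ℝ≥0∞} (hρ : HoleBound α k ρ (π.symm a) C)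
    (h_meas : Measurable fun η => totalDiff k η (permute ρ η)) {A : Set Config}
    (hA : MeasurableSet A) (h_hole : ∀ η ∈ A, η a = SiteState.empty) :
    eLpNorm ((fun η => totalDiff k η (permute ρ η)) ∘ permute π) 1
      ((grandMeasure α).restrict A) ≤ C * grandMeasure α A ^ (1 / 2 : ℝ) := by
  have hπ := measurePreserving_permute α π
  have hπ' := measurePreserving_permute α π⁻¹
  have hA' : permute π ⁻¹' (permute π⁻¹ ⁻¹' A) = A := by
    ext η
    rw [Set.mem_preimage, Set.mem_preimage, permute_inv_permute]
  have h_restrict := hπ.restrict_preimage (measurable_permute π⁻¹ hA)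
  rw [hA'] at h_restrict
  rw [eLpNorm_comp_measurePreserving h_meas.aestronglyMeasurable h_restrict,
    ← hπ'.measure_preimage hA.nullMeasurableSet]
  exact hρ.eLpNorm_le _ (measurable_permute _ hA) fun η hη => h_hole _ hη

lemma HoleBound.mul (hk : IsUniformlyLocal k) (hkb : ∀ x, k x ∈ boundedMeasurable Config)
    {C D : ℝ≥0∞} (hπ : HoleBound α k π a C) (hρ : HoleBound α k ρ b D) (hab : π b = a) :
    HoleBound α k (π * ρ) a (C + D) := by
  refine ⟨finite_mul_ne hπ.finite_ne hρ.finite_ne, fun A hA h_hole => ?_⟩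
  have h_meas := (totalDiff_permute_mem_boundedMeasurable hk hkb hπ.finite_ne).1
  have h_meas' := (totalDiff_permute_mem_boundedMeasurable hk hkb hρ.finite_ne).1
  have h_split : (fun η => totalDiff k η (permute (π * ρ) η)) =
      (fun η => totalDiff k η (permute π η)) +
        (fun η => totalDiff k η (permute ρ η)) ∘ permute π :=
    funext (totalDiff_permute_mul hk hπ.finite_ne hρ.finite_ne)
  rw [h_split, add_mul]
  refine (eLpNorm_add_le h_meas.aestronglyMeasurable
    (h_meas'.comp (measurable_permute π)).aestronglyMeasurable le_rfl).trans
    (add_le_add (hπ.eLpNorm_le A hA h_hole) ?_)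
  rw [(Equiv.eq_symm_apply π).2 hab] at hρ
  exact hρ.eLpNorm_comp_permute_le h_meas' hA h_hole

lemma eLpNorm_restrict_le_of_measurePreserving {X E : Type*} [MeasurableSpace X]
    [NormedAddCommGroup E] {μ : Measure X} {D : X → E} (hD : MemLp D 2 μ) {T : X → X}
    (hT : MeasurePreserving T μ μ) {F : X → ℝ} {A : Set X} (hA : MeasurableSet A)
    (hF : ∀ x ∈ A, |F x| ≤ ‖D (T x)‖) :
    eLpNorm F 1 (μ.restrict A) ≤ eLpNorm D 2 μ * μ A ^ (1 / 2 : ℝ) := by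
  have hDT := hD.comp_measurePreserving hT
  calc eLpNorm F 1 (μ.restrict A)
      ≤ eLpNorm (D ∘ T) 1 (μ.restrict A) :=
        eLpNorm_mono_ae ((ae_restrict_iff' hA).2 (.of_forall hF))
    _ ≤ eLpNorm (D ∘ T) 2 (μ.restrict A) *
          μ.restrict A Set.univ ^ (1 / (1 : ℝ≥0∞).toReal - 1 / (2 : ℝ≥0∞).toReal) :=
        eLpNorm_le_eLpNorm_mul_rpow_measure_univ (by norm_num) hDT.1.restrict
    _ = eLpNorm (D ∘ T) 2 (μ.restrict A) * μ A ^ (1 / 2 : ℝ) := by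
        rw [Measure.restrict_apply_univ]
        norm_num
    _ ≤ eLpNorm (D ∘ T) 2 μ * μ A ^ (1 / 2 : ℝ) := by
        gcongr
        exact Measure.restrict_le_self
    _ = eLpNorm D 2 μ * μ A ^ (1 / 2 : ℝ) := by rw [eLpNorm_comp_measurePreserving hD.1 hT]

variable {h : Config → ℝ} {ψ : Fin 2 → SiteState → ℝ} {η : Config} {y : Z2} {i : Fin 2}

lemma abs_totalDiff_swap_le (hh : IsLocal h) (hψ : ∀ i, ψ i SiteState.empty = 0)
    (h_hole : η (y + e i) = SiteState.empty) :
    |totalDiff (potential h ψ) η (swap y (y + e i) η)| ≤ ‖germ h ψ (shift y η)‖ := by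
  by_cases hy : η y = SiteState.empty
  · rw [swap_eq_self (hy.trans h_hole.symm), totalDiff_self, abs_zero]
    exact norm_nonneg _
  · rw [← germ_shift_of_canJump hh hψ ⟨hy, h_hole⟩]
    exact PiLp.norm_apply_le (germ h ψ (shift y η)) i

lemma holeBound_swap_right (hh : IsLocal h) (hψ : ∀ i, ψ i SiteState.empty = 0)
    (hU : MemLp (germ h ψ) 2 (grandMeasure α)) (y : Z2) (i : Fin 2) :
    HoleBound α (potential h ψ) (Equiv.swap y (y + e i)) (y + e i)
      (eLpNorm (germ h ψ) 2 (grandMeasure α)) :=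
  ⟨finite_swap_ne _ _, fun _ hA h_hole => eLpNorm_restrict_le_of_measurePreserving hU
    (measurePreserving_shift α y) hA fun η hη => abs_totalDiff_swap_le hh hψ (h_hole η hη)⟩

lemma holeBound_swap_left (hh : IsLocal h) (hψ : ∀ i, ψ i SiteState.empty = 0)
    (hU : MemLp (germ h ψ) 2 (grandMeasure α)) (y : Z2) (i : Fin 2) :
    HoleBound α (potential h ψ) (Equiv.swap y (y + e i)) y
      (eLpNorm (germ h ψ) 2 (grandMeasure α)) := by
  refine ⟨finite_swap_ne _ _, fun A hA h_hole => eLpNorm_restrict_le_of_measurePreserving hU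
    ((measurePreserving_shift α y).comp (measurePreserving_swap α y (y + e i))) hA
    fun η hη => ?_⟩
  have h_right : swap y (y + e i) η (y + e i) = SiteState.empty :=
    (swap_right _ _ _).trans (h_hole η hη)
  have h_le := abs_totalDiff_swap_le hh hψ h_right
  rwa [swap_swap, totalDiff_symm, abs_neg] at h_le

end HoleBound

section Rotation

variable {i j : Fin 2}

/-- The cyclic permutation of the sites `0, e_i, e_j` that is performed by a hole which travels
from `e_i + e_j` around a plaquette, back to its starting point. -/
def rotation (i j : Fin 2) : Equiv.Perm Z2 :=
  Equiv.swap (e j + e i) (e i) * Equiv.swap (e i) 0 * Equiv.swap 0 (e j) *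
    Equiv.swap (e j) (e j + e i)

/-- The sites of a ray that starts from `e_i + e_j`, on which a hole is looked for. -/
def raySite (i j : Fin 2) (k : ℕ) : Z2 := e j + e i + k • e i

lemma e_injective : Function.Injective e := by decide

lemma raySite_zero (i j : Fin 2) : raySite i j 0 = e j + e i := by
  rw [raySite, zero_nsmul, add_zero]

lemma raySite_succ (i j : Fin 2) (k : ℕ) : raySite i j (k + 1) = raySite i j k + e i := by
  rw [raySite, raySite, succ_nsmul, add_assoc (e j + e i)]

lemma raySite_injective (i j : Fin 2) : Function.Injective (raySite i j) := fun k l h_eq => by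
  have h_smul : (k : ℤ) • e i = (l : ℤ) • e i := by
    simpa only [natCast_zsmul] using add_left_cancel h_eq
  exact Nat.cast_injective (smul_left_injective ℤ (e_ne_zero i) h_smul)

lemma raySite_notMem (hij : i ≠ j) (k : ℕ) : raySite i j k ∉ ({0, e i, e j} : Finset Z2) := by
  fin_cases i <;> fin_cases j <;> simp_all [e, raySite, Prod.ext_iff] <;> omega

lemma rotation_left (hij : i ≠ j) : rotation i j (e i) = 0 := by
  revert i j
  decide

lemma rotation_right (hij : i ≠ j) : rotation i j (e j) = e i := by
  revert i j
  decide

lemma rotation_of_notMem {x : Z2} (hx : x ∉ ({0, e i, e j} : Finset Z2)) :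
    rotation i j x = x := by
  simp only [Finset.mem_insert, Finset.mem_singleton, not_or] at hx
  obtain ⟨h₀, hi, hj⟩ := hx
  simp only [rotation, Equiv.Perm.mul_apply]
  rcases eq_or_ne x (e j + e i) with rfl | hx
  · rw [Equiv.swap_apply_right, Equiv.swap_apply_right, Equiv.swap_apply_right,
      Equiv.swap_apply_right]
  · rw [Equiv.swap_apply_of_ne_of_ne hj hx, Equiv.swap_apply_of_ne_of_ne h₀ hj,
      Equiv.swap_apply_of_ne_of_ne hi h₀, Equiv.swap_apply_of_ne_of_ne hx hi]

lemma finite_rotation_ne (i j : Fin 2) : {x | rotation i j x ≠ x}.Finite :=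
  (Finset.finite_toSet {0, e i, e j}).subset fun _ hx => by
    by_contra hx'
    exact hx (rotation_of_notMem hx')

lemma swap_mul_rotation_mul_swap (hij : i ≠ j) (k : ℕ) :
    Equiv.swap (raySite i j k) (raySite i j (k + 1)) * rotation i j *
      Equiv.swap (raySite i j k) (raySite i j (k + 1)) = rotation i j := by
  rw [mul_assoc, Equiv.mul_swap_eq_swap_mul, rotation_of_notMem (raySite_notMem hij k),
    rotation_of_notMem (raySite_notMem hij (k + 1)), ← mul_assoc, Equiv.swap_mul_self, one_mul]

variable {α : GrandParam} {k : Z2 → Config → ℝ} {C : ℝ≥0∞}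

lemma holeBound_rotation_zero (hk : IsUniformlyLocal k)
    (hkb : ∀ x, k x ∈ boundedMeasurable Config)
    (h_left : ∀ y i, HoleBound α k (Equiv.swap y (y + e i)) y C)
    (h_right : ∀ y i, HoleBound α k (Equiv.swap y (y + e i)) (y + e i) C) :
    HoleBound α k (rotation i j) (raySite i j 0) (4 * C) := by
  have h₁ := h_right (e i) j
  have h₂ := h_right 0 i
  have h₃ := h_left 0 j
  have h₄ := h_left (e j) i
  rw [Equiv.swap_comm, add_comm (e i)] at h₁
  rw [Equiv.swap_comm, zero_add] at h₂
  rw [zero_add] at h₃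
  have h_all := (((h₁.mul hk hkb h₂ ?_).mul hk hkb h₃ ?_).mul hk hkb h₄ ?_)
  · have h_const : 4 * C = C + C + C + C := by ring
    rwa [raySite_zero, rotation, h_const]
  all_goals simp only [Equiv.Perm.mul_apply, Equiv.swap_apply_right]

lemma holeBound_rotation (hk : IsUniformlyLocal k) (hkb : ∀ x, k x ∈ boundedMeasurable Config)
    (h_left : ∀ y i, HoleBound α k (Equiv.swap y (y + e i)) y C)
    (h_right : ∀ y i, HoleBound α k (Equiv.swap y (y + e i)) (y + e i) C) (hij : i ≠ j) (n : ℕ) :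
    HoleBound α k (rotation i j) (raySite i j n) ((2 * n + 4) * C) := by
  induction n with
  | zero =>
    rw [Nat.cast_zero, mul_zero, zero_add]
    exact holeBound_rotation_zero hk hkb h_left h_right
  | succ n ih =>
    -- The hole steps back to the previous site of the ray, and forth again at the end.
    have h_back := h_right (raySite i j n) i
    have h_forth := h_left (raySite i j n) i
    rw [← raySite_succ] at h_back h_forth
    have h_all := (h_back.mul hk hkb ih (Equiv.swap_apply_left _ _)).mul hk hkb h_forth (by
      rw [Equiv.Perm.mul_apply, rotation_of_notMem (raySite_notMem hij n),
        Equiv.swap_apply_left])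
    rw [swap_mul_rotation_mul_swap hij] at h_all
    convert h_all using 1
    push_cast
    ring

end Rotation

/-! ### Pairing a current with a formal potential -/

section Pairing

variable {h f : Config → ℝ} {ψ : Fin 2 → SiteState → ℝ} {χ φ : SiteState → ℝ}
  {k : Z2 → Config → ℝ} {π : Equiv.Perm Z2} {x y z : Z2} {i j : Fin 2}

lemma integrable_of_mem_boundedMeasurable {X : Type*} [MeasurableSpace X] {μ : Measure X}
    [IsFiniteMeasure μ] {f : X → ℝ} (hf : f ∈ boundedMeasurable X) : Integrable f μ :=
  let ⟨h_meas, C, hC⟩ := hf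
  .of_bound h_meas.aestronglyMeasurable C (.of_forall hC)

lemma integral_permute (α : GrandParam) (π : Equiv.Perm Z2) (hf : Measurable f) :
    ∫ η, f (permute π η) ∂grandMeasure α = ∫ η, f η ∂grandMeasure α := by
  have hπ := measurePreserving_permute α π
  conv_rhs => rw [← hπ.map_eq]
  exact (integral_map hπ.measurable.aemeasurable hf.aestronglyMeasurable).symm

lemma site_mem_boundedMeasurable (hχ : χ ∈ boundedMeasurable SiteState) (x : Z2) :
    (fun η : Config => χ (η x)) ∈ boundedMeasurable Config :=
  comp_mem_boundedMeasurable hχ (measurable_pi_apply x)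

lemma site_mul_mem_boundedMeasurable (hχ : χ ∈ boundedMeasurable SiteState) (x : Z2)
    (hf : f ∈ boundedMeasurable Config) :
    (fun η : Config => χ (η x) * f η) ∈ boundedMeasurable Config :=
  mul_mem (site_mem_boundedMeasurable hχ x) hf

lemma translates_mem_boundedMeasurable (hh : h ∈ boundedMeasurable Config) (x : Z2) :
    translates h x ∈ boundedMeasurable Config :=
  comp_mem_boundedMeasurable hh (measurable_permute (Equiv.addRight x))

lemma potential_mem_boundedMeasurable (hh : h ∈ boundedMeasurable Config)
    (hψ : ∀ i, ψ i ∈ boundedMeasurable SiteState) (x : Z2) :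
    potential h ψ x ∈ boundedMeasurable Config := by
  have h_moment : moment ψ x ∈ boundedMeasurable SiteState := by
    have h_sum := sum_mem (S := boundedMeasurable SiteState) (t := Finset.univ) fun i _ =>
      (boundedMeasurable SiteState).smul_mem (hψ i) (coord x i : ℝ)
    convert h_sum using 1
    funext s
    rw [Finset.sum_apply]
    rfl
  exact add_mem (translates_mem_boundedMeasurable hh x) (site_mem_boundedMeasurable h_moment x)

lemma integral_mul_totalDiff_permute (α : GrandParam) (hk : IsUniformlyLocal k)
    (hkb : ∀ x, k x ∈ boundedMeasurable Config) (hπ : {x | π x ≠ x}.Finite)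
    (hf : f ∈ boundedMeasurable Config) :
    ∫ η, f η * totalDiff k η (permute π η) ∂grandMeasure α =
      ∑ᶠ x, ∫ η, f η * (k x (permute π η) - k x η) ∂grandMeasure α := by
  obtain ⟨X, hX⟩ := hk.exists_window hπ.toFinset
  have hX' (η : Config) (x : Z2) (hx : x ∉ X) : k x (permute π η) - k x η = 0 := by
    refine sub_eq_zero.2 (hX η _ (fun y hy => ?_) x hx).symm
    rw [Set.Finite.mem_toFinset, Set.mem_ofPred_eq, not_not] at hy
    rw [permute, hy]
  have h_mem (x : Z2) :
      (fun η => f η * (k x (permute π η) - k x η)) ∈ boundedMeasurable Config :=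
    mul_mem hf (sub_mem (comp_mem_boundedMeasurable (hkb x) (measurable_permute π)) (hkb x))
  have h_sum (η : Config) : f η * totalDiff k η (permute π η) =
      ∑ x ∈ X, f η * (k x (permute π η) - k x η) := by
    rw [totalDiff, finsum_eq_sum_of_support_subset _ fun x hx => ?_, Finset.mul_sum]
    by_contra hxX
    exact hx (hX' η x hxX)
  simp only [h_sum]
  rw [integral_finsetSum _ fun x _ => integrable_of_mem_boundedMeasurable (h_mem x)]
  refine (finsum_eq_sum_of_support_subset _ fun x hx => ?_).symm
  by_contra hxX
  exact hx (by simp only [hX' _ x hxX, mul_zero, integral_zero])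

/-- The correlation between the state of the site `z` and a function `h`. It does not depend on `z`
when `z` is off the support of `h`. -/
def siteCorrelation (α : GrandParam) (χ : SiteState → ℝ) (h : Config → ℝ) (z : Z2) : ℝ :=
  ∫ η, χ (η z) * h η ∂grandMeasure α

lemma siteCorrelation_eq_of_notMem (α : GrandParam) (hχ : χ ∈ boundedMeasurable SiteState)
    (hh : h ∈ boundedMeasurable Config) {s : Finset Z2} (hs : DependsOn h (s : Set Z2))
    (hx : x ∉ s) (hy : y ∉ s) : siteCorrelation α χ h x = siteCorrelation α χ h y := by
  rw [siteCorrelation, ← integral_permute α (Equiv.swap x y)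
    (site_mul_mem_boundedMeasurable hχ x hh).1]
  refine integral_congr_ae (.of_forall fun η => ?_)
  have h_eq : h (permute (Equiv.swap x y) η) = h η := hs fun w hw =>
    congrArg η (Equiv.swap_apply_of_ne_of_ne (ne_of_mem_of_not_mem hw hx)
      (ne_of_mem_of_not_mem hw hy))
  simp only [h_eq, permute, Equiv.swap_apply_left]

lemma integral_site_mul_translates (α : GrandParam) (hχ : χ ∈ boundedMeasurable SiteState)
    (hh : h ∈ boundedMeasurable Config) (y x : Z2) :
    ∫ η, χ (η y) * translates h x η ∂grandMeasure α = siteCorrelation α χ h (y - x) := by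
  rw [siteCorrelation, ← integral_permute α (Equiv.addRight x)
    (site_mul_mem_boundedMeasurable hχ (y - x) hh).1]
  refine integral_congr_ae (.of_forall fun η => ?_)
  simp only [permute, Equiv.coe_addRight, sub_add_cancel, translates]
  rfl

lemma integral_site_mul_translates_sub (α : GrandParam) (hχ : χ ∈ boundedMeasurable SiteState)
    (hh : h ∈ boundedMeasurable Config) (π : Equiv.Perm Z2) (y x : Z2) :
    ∫ η, χ (η (π y)) * (translates h x (permute π η) - translates h x η) ∂grandMeasure α =
      siteCorrelation α χ h (y - x) - siteCorrelation α χ h (π y - x) := by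
  have h_trans := translates_mem_boundedMeasurable hh x
  have h_permuted : (fun η => translates h x (permute π η)) ∈ boundedMeasurable Config :=
    comp_mem_boundedMeasurable h_trans (measurable_permute π)
  have h_permute : ∫ η, χ (η (π y)) * translates h x (permute π η) ∂grandMeasure α =
      ∫ η, χ (η y) * translates h x η ∂grandMeasure α :=
    integral_permute α π (site_mul_mem_boundedMeasurable hχ y h_trans).1
  simp only [mul_sub]
  rw [integral_sub (integrable_of_mem_boundedMeasurable
      (site_mul_mem_boundedMeasurable hχ (π y) h_permuted))
    (integrable_of_mem_boundedMeasurable (site_mul_mem_boundedMeasurable hχ (π y) h_trans)),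
    h_permute, integral_site_mul_translates α hχ hh, integral_site_mul_translates α hχ hh]

lemma integral_site_mul_totalDiff_translates (α : GrandParam)
    (hχ : χ ∈ boundedMeasurable SiteState) (hh : h ∈ boundedMeasurable Config) (hl : IsLocal h)
    (hπ : {x | π x ≠ x}.Finite) (y : Z2) :
    ∫ η, χ (η (π y)) * totalDiff (translates h) η (permute π η) ∂grandMeasure α = 0 := by
  obtain ⟨s, hs⟩ := hl
  obtain ⟨z, hz⟩ := Infinite.exists_notMem_finset s
  set q : Z2 → ℝ := fun x => siteCorrelation α χ h x - siteCorrelation α χ h z with hq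
  have h_finite (c : Z2) : (Function.support fun x => q (c - x)).Finite := by
    refine (s.image (c - ·)).finite_toSet.subset fun x hx => ?_
    by_contra hxs
    refine hx (sub_eq_zero.2 (siteCorrelation_eq_of_notMem α hχ hh hs (fun hc => hxs ?_) hz))
    exact Finset.mem_coe.2 (Finset.mem_image.2 ⟨c - x, hc, sub_sub_cancel c x⟩)
  have h_sum (c : Z2) : ∑ᶠ x, q (c - x) = ∑ᶠ x, q x := finsum_comp_equiv (Equiv.subLeft c)
  calc ∫ η, χ (η (π y)) * totalDiff (translates h) η (permute π η) ∂grandMeasure α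
      = ∑ᶠ x, (q (y - x) - q (π y - x)) := by
        rw [integral_mul_totalDiff_permute α (isUniformlyLocal_translates ⟨s, hs⟩)
          (translates_mem_boundedMeasurable hh) hπ (site_mem_boundedMeasurable hχ _)]
        refine finsum_congr fun x => ?_
        rw [integral_site_mul_translates_sub α hχ hh, hq, sub_sub_sub_cancel_right]
    _ = 0 := by rw [finsum_sub_distrib (h_finite _) (h_finite _), h_sum, h_sum, sub_self]

lemma moment_zero (ψ : Fin 2 → SiteState → ℝ) (s : SiteState) : moment ψ 0 s = 0 := by
  simp only [moment, coord, Prod.fst_zero, Prod.snd_zero, ite_self, Int.cast_zero, zero_mul,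
    Finset.sum_const_zero]

lemma totalDiff_moment_rotation (ψ : Fin 2 → SiteState → ℝ) (hij : i ≠ j) (η : Config) :
    totalDiff (fun x ζ => moment ψ x (ζ x)) η (permute (rotation i j) η) =
      (ψ i (η 0) - ψ i (η (e i))) + (ψ j (η (e i)) - ψ j (η (e j))) := by
  have h_moment (i : Fin 2) (s : SiteState) : moment ψ (e i) s = ψ i s := by
    rw [← zero_add (e i), moment_add_e, moment_zero, zero_add]
  rw [totalDiff, finsum_eq_sum_of_support_subset (s := {0, e i, e j}) _ fun x hx => ?_,
    Finset.sum_insert, Finset.sum_pair (e_injective.ne hij)]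
  · simp only [moment_zero, h_moment, permute, rotation_left hij, rotation_right hij, sub_zero,
      zero_add]
  · simp only [Finset.mem_insert, Finset.mem_singleton, not_or]
    exact ⟨(e_ne_zero i).symm, (e_ne_zero j).symm⟩
  · by_contra hx'
    exact hx (by simp only [permute, rotation_of_notMem hx', sub_self])

lemma integral_site_mul_sub_self (α : GrandParam) (hχ : χ ∈ boundedMeasurable SiteState)
    (x y : Z2) : ∫ η, χ (η x) * (χ (η x) - χ (η y)) ∂grandMeasure α =
      (1 / 2) * ∫ η, (χ (η x) - χ (η y)) ^ 2 ∂grandMeasure α := by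
  have h_mem (x y : Z2) : (fun η : Config => χ (η x) * (χ (η x) - χ (η y))) ∈
      boundedMeasurable Config :=
    mul_mem (site_mem_boundedMeasurable hχ x)
      (sub_mem (site_mem_boundedMeasurable hχ x) (site_mem_boundedMeasurable hχ y))
  have h_swap := integral_permute α (Equiv.swap x y) (h_mem x y).1
  simp only [permute, Equiv.swap_apply_left, Equiv.swap_apply_right] at h_swap
  have h_sq : ∫ η, (χ (η x) - χ (η y)) ^ 2 ∂grandMeasure α =
      ∫ η, χ (η x) * (χ (η x) - χ (η y)) ∂grandMeasure α +
        ∫ η, χ (η y) * (χ (η y) - χ (η x)) ∂grandMeasure α := by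
    rw [← integral_add (integrable_of_mem_boundedMeasurable (h_mem x y))
      (integrable_of_mem_boundedMeasurable (h_mem y x))]
    refine integral_congr_ae (.of_forall fun η => ?_)
    ring
  rw [h_sq, h_swap]
  ring

lemma integral_site_mul_site_sub (α : GrandParam) (hχ : χ ∈ boundedMeasurable SiteState)
    (hφ : φ ∈ boundedMeasurable SiteState) (hzx : z ≠ x) (hzy : z ≠ y) :
    ∫ η, χ (η z) * (φ (η x) - φ (η y)) ∂grandMeasure α = 0 := by
  have h_mem (x y : Z2) : (fun η : Config => χ (η z) * (φ (η x) - φ (η y))) ∈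
      boundedMeasurable Config :=
    mul_mem (site_mem_boundedMeasurable hχ z)
      (sub_mem (site_mem_boundedMeasurable hφ x) (site_mem_boundedMeasurable hφ y))
  have h_swap := integral_permute α (Equiv.swap x y) (h_mem x y).1
  simp only [permute, Equiv.swap_apply_left, Equiv.swap_apply_right,
    Equiv.swap_apply_of_ne_of_ne hzx hzy] at h_swap
  have h_neg : ∫ η, χ (η z) * (φ (η y) - φ (η x)) ∂grandMeasure α =
      -∫ η, χ (η z) * (φ (η x) - φ (η y)) ∂grandMeasure α := by
    rw [← integral_neg]
    refine integral_congr_ae (.of_forall fun η => ?_)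
    ring
  linarith

lemma integral_site_mul_totalDiff_rotation (α : GrandParam) (hh : h ∈ boundedMeasurable Config)
    (hl : IsLocal h) (hψ : ∀ i, ψ i ∈ boundedMeasurable SiteState) (hij : i ≠ j) :
    ∫ η, ψ i (η 0) * totalDiff (potential h ψ) η (permute (rotation i j) η) ∂grandMeasure α =
      (1 / 2) * ∫ η, (ψ i (η 0) - ψ i (η (e i))) ^ 2 ∂grandMeasure α := by
  have hl' := isUniformlyLocal_translates hl
  have h_site (m : Fin 2) (x : Z2) := site_mem_boundedMeasurable (hψ m) x
  have h_exact_mem := site_mul_mem_boundedMeasurable (hψ i) 0 <|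
    totalDiff_permute_mem_boundedMeasurable hl' (translates_mem_boundedMeasurable hh)
      (finite_rotation_ne i j)
  have h_split (η : Config) :
      ψ i (η 0) * totalDiff (potential h ψ) η (permute (rotation i j) η) =
        ψ i (η 0) * totalDiff (translates h) η (permute (rotation i j) η) +
          (ψ i (η 0) * (ψ i (η 0) - ψ i (η (e i))) +
            ψ i (η 0) * (ψ j (η (e i)) - ψ j (η (e j)))) := by
    rw [potential, totalDiff_add hl' (isUniformlyLocal_site (moment ψ))
      (eventuallyEq_permute (finite_rotation_ne i j) η), totalDiff_moment_rotation ψ hij, mul_add,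
      mul_add (ψ i (η 0))]
  have h_exact := integral_site_mul_totalDiff_translates α (hψ i) hh hl (finite_rotation_ne i j)
    (e i)
  rw [rotation_left hij] at h_exact
  have h_site_mem (m : Fin 2) (x y : Z2) :
      (fun η : Config => ψ i (η 0) * (ψ m (η x) - ψ m (η y))) ∈ boundedMeasurable Config :=
    site_mul_mem_boundedMeasurable (hψ i) 0 (sub_mem (h_site m x) (h_site m y))
  have h_sites_mem : (fun η : Config => ψ i (η 0) * (ψ i (η 0) - ψ i (η (e i))) +
      ψ i (η 0) * (ψ j (η (e i)) - ψ j (η (e j)))) ∈ boundedMeasurable Config :=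
    add_mem (h_site_mem i _ _) (h_site_mem j _ _)
  calc _ = ∫ η, ψ i (η 0) * totalDiff (translates h) η (permute (rotation i j) η)
          ∂grandMeasure α + (∫ η, ψ i (η 0) * (ψ i (η 0) - ψ i (η (e i))) ∂grandMeasure α +
            ∫ η, ψ i (η 0) * (ψ j (η (e i)) - ψ j (η (e j))) ∂grandMeasure α) := by
        rw [integral_congr_ae (.of_forall h_split),
          integral_add (integrable_of_mem_boundedMeasurable h_exact_mem)
            (integrable_of_mem_boundedMeasurable h_sites_mem),
          integral_add (integrable_of_mem_boundedMeasurable (h_site_mem i _ _))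
            (integrable_of_mem_boundedMeasurable (h_site_mem j _ _))]
    _ = _ := by
        rw [h_exact, integral_site_mul_sub_self α (hψ i), integral_site_mul_site_sub α (hψ i)
          (hψ j) (e_ne_zero i).symm (e_ne_zero j).symm, zero_add, add_zero]

end Pairing

/-! ### The search for a hole -/

section HoleSearch

variable {ω : Angle → ℝ} {α : GrandParam} {k : Z2 → Config → ℝ} {π : Equiv.Perm Z2} {i j : Fin 2}

/-- The probability that a site is occupied. -/
def density (α : GrandParam) : ℝ≥0∞ := siteMeasure α {s | s ≠ SiteState.empty}

/-- The event that the first `n` sites of the ray are occupied. -/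
def rayOccupied (i j : Fin 2) (n : ℕ) : Set Config :=
  Set.pi ((Finset.range n).image (raySite i j) : Finset Z2) fun _ => {s | s ≠ SiteState.empty}

/-- The event that the site number `n` of the ray is the first empty one. -/
def firstHole (i j : Fin 2) (n : ℕ) : Set Config :=
  rayOccupied i j n ∩ {η | η (raySite i j n) = SiteState.empty}

lemma measurableSet_eq_empty : MeasurableSet {s : SiteState | s = SiteState.empty} := by
  simp only [SiteState.eq_empty_iff]
  exact measurable_isNone.setOf

lemma measurableSet_ne_empty : MeasurableSet {s : SiteState | s ≠ SiteState.empty} :=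
  measurableSet_eq_empty.compl

lemma measurableSet_firstHole (i j : Fin 2) (n : ℕ) : MeasurableSet (firstHole i j n) :=
  .inter (.pi (Finset.countable_toSet _) fun _ _ => measurableSet_ne_empty)
    (measurableSet_eq_empty.preimage (measurable_pi_apply (raySite i j n)))

lemma mem_rayOccupied {n : ℕ} {η : Config} :
    η ∈ rayOccupied i j n ↔ ∀ m < n, η (raySite i j m) ≠ SiteState.empty := by
  simp only [rayOccupied, Finset.coe_image, Finset.coe_range, Set.mem_pi, Set.mem_image,
    Set.mem_Iio, Set.mem_ofPred_eq, forall_exists_index, and_imp, forall_apply_eq_imp_iff₂]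

lemma measure_rayOccupied (α : GrandParam) (i j : Fin 2) (n : ℕ) :
    grandMeasure α (rayOccupied i j n) = density α ^ n := by
  rw [rayOccupied, grandMeasure, Measure.infinitePi_pi _ fun _ _ => measurableSet_ne_empty,
    Finset.prod_const, Finset.card_image_of_injective _ (raySite_injective i j),
    Finset.card_range, density]

lemma ae_exists_firstHole (hα : density α < 1) (i j : Fin 2) :
    ∀ᵐ η ∂grandMeasure α, η ∈ ⋃ n, firstHole i j n := by
  have h_le (n : ℕ) : grandMeasure α {η | η ∉ ⋃ n, firstHole i j n} ≤ density α ^ n := by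
    rw [← measure_rayOccupied α i j]
    refine measure_mono fun η hη => mem_rayOccupied.2 ?_
    by_contra h
    have h_ex : ∃ m, η (raySite i j m) = SiteState.empty := by
      push Not at h
      exact h.imp fun _ => And.right
    exact hη (Set.mem_iUnion.2 ⟨Nat.find h_ex,
      mem_rayOccupied.2 fun m hm => Nat.find_min h_ex hm, Nat.find_spec h_ex⟩)
  exact nonpos_iff_eq_zero.1
    (ge_of_tendsto' (ENNReal.tendsto_pow_atTop_nhds_zero_of_lt_one hα) h_le)

lemma eLpNorm_one_le_tsum_restrict {X E : Type*} [MeasurableSpace X] [NormedAddCommGroup E]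
    {μ : Measure X} {A : ℕ → Set X} (hA : ∀ᵐ x ∂μ, x ∈ ⋃ n, A n) (f : X → E) :
    eLpNorm f 1 μ ≤ ∑' n, eLpNorm f 1 (μ.restrict (A n)) := by
  simp only [eLpNorm_one_eq_lintegral_enorm]
  calc ∫⁻ x, ‖f x‖ₑ ∂μ = ∫⁻ x in ⋃ n, A n, ‖f x‖ₑ ∂μ := by
        rw [Measure.restrict_eq_self_of_ae_mem hA]
    _ ≤ ∑' n, ∫⁻ x in A n, ‖f x‖ₑ ∂μ := lintegral_iUnion_le A _

/-- The total cost of bringing in the first hole of a ray: `2 * n + 4` swaps when it is the site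
number `n`, an event that the Cauchy-Schwarz inequality weighs by the square root of its
probability. -/
def searchCost (α : GrandParam) : ℝ≥0∞ :=
  ∑' n : ℕ, (2 * n + 4) * (density α ^ (1 / 2 : ℝ)) ^ n

lemma searchCost_ne_top (hα : density α < 1) : searchCost α ≠ ⊤ := by
  obtain ⟨q, hq⟩ := ENNReal.canLift.prf _
    (ENNReal.rpow_ne_top_of_nonneg (by norm_num : (0 : ℝ) ≤ 1 / 2) hα.ne_top)
  have hq_lt : q < 1 := by
    rw [← ENNReal.coe_lt_one_iff, hq]
    exact ENNReal.rpow_lt_one hα (by norm_num)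
  have hq_norm : ‖(q : ℝ)‖ < 1 := by rwa [NNReal.norm_eq, NNReal.coe_lt_one]
  have h_summable : Summable fun n : ℕ => (2 * n + 4) * q ^ n := by
    rw [← NNReal.summable_coe]
    refine (((summable_pow_mul_geometric_of_norm_lt_one 1 hq_norm).mul_left 2).add
      ((summable_geometric_of_norm_lt_one hq_norm).mul_left 4)).congr fun n => ?_
    push_cast
    ring
  rw [searchCost, ← hq]
  exact_mod_cast ENNReal.tsum_coe_ne_top_iff_summable.2 h_summable

lemma eLpNorm_totalDiff_le_searchCost_mul (hα : density α < 1) {C : ℝ≥0∞}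
    (hk : ∀ n : ℕ, HoleBound α k π (raySite i j n) ((2 * n + 4) * C)) :
    eLpNorm (fun η => totalDiff k η (permute π η)) 1 (grandMeasure α) ≤ searchCost α * C := by
  refine (eLpNorm_one_le_tsum_restrict (ae_exists_firstHole hα i j) _).trans ?_
  rw [searchCost, ← ENNReal.tsum_mul_right]
  refine ENNReal.tsum_le_tsum fun n => ?_
  have h_measure : grandMeasure α (firstHole i j n) ≤ density α ^ n :=
    (measure_mono Set.inter_subset_left).trans (measure_rayOccupied α i j n).le
  calc _ ≤ (2 * n + 4) * C * grandMeasure α (firstHole i j n) ^ (1 / 2 : ℝ) :=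
        (hk n).eLpNorm_le _ (measurableSet_firstHole i j n) fun η hη => hη.2
    _ ≤ (2 * n + 4) * C * (density α ^ n) ^ (1 / 2 : ℝ) := by gcongr
    _ = (2 * n + 4) * (density α ^ (1 / 2 : ℝ)) ^ n * C := by
        rw [← ENNReal.rpow_natCast_mul, mul_comm (n : ℝ), ENNReal.rpow_mul_natCast]
        ring

lemma integral_mul_le_mul_eLpNorm_one {X : Type*} [MeasurableSpace X] {μ : Measure X}
    {f g : X → ℝ} {B : ℝ} (hf : ∀ x, |f x| ≤ B) (hg : Integrable g μ) :
    ∫ x, f x * g x ∂μ ≤ B * (eLpNorm g 1 μ).toReal := by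
  have h_norm : (eLpNorm g 1 μ).toReal = ∫ x, ‖g x‖ ∂μ := by
    rw [integral_norm_eq_lintegral_enorm hg.1, eLpNorm_one_eq_lintegral_enorm]
  rw [h_norm, ← integral_const_mul]
  refine (Real.le_norm_self _).trans (norm_integral_le_of_norm_le (hg.norm.const_mul B)
    (.of_forall fun x => ?_))
  rw [norm_mul]
  exact mul_le_mul_of_nonneg_right (hf x) (norm_nonneg _)

lemma exists_integral_sq_le (hω : IsC2 ω) (hα : density α < 1) {ψ : Fin 2 → SiteState → ℝ}
    (hψ : ∀ i, ψ i ∈ siteSpan ω) (i : Fin 2) :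
    ∃ C : ℝ, ∀ h ∈ weightedSpan ω,
      ∫ η, (ψ i (η 0) - ψ i (η (e i))) ^ 2 ∂grandMeasure α ≤
        C * (eLpNorm (germ h ψ) 2 (grandMeasure α)).toReal := by
  obtain ⟨j, hji⟩ := exists_ne i
  have hψ_bdd (i : Fin 2) := siteSpan_le_boundedMeasurable hω (hψ i)
  obtain ⟨-, B, hB⟩ := hψ_bdd i
  refine ⟨2 * (B * (searchCost α).toReal), fun h hh => ?_⟩
  have hh_bdd := weightedSpan_le_boundedMeasurable hω hh
  have hh_local := isLocal_of_mem_weightedSpan hh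
  have hU := memLp_of_mem_weightedSpan hω α (germ_mem_weightedSpan hh hψ)
  have h_unif := isUniformlyLocal_potential hh_local ψ
  have h_bdd := potential_mem_boundedMeasurable hh_bdd hψ_bdd
  have h_empty (i : Fin 2) := siteSpan_empty (hψ i)
  have h_eLpNorm := eLpNorm_totalDiff_le_searchCost_mul hα (holeBound_rotation h_unif h_bdd
    (holeBound_swap_left hh_local h_empty hU) (holeBound_swap_right hh_local h_empty hU) hji.symm)
  have h_toReal := ENNReal.toReal_mono
    (ENNReal.mul_ne_top (searchCost_ne_top hα) hU.eLpNorm_ne_top) h_eLpNorm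
  have h_integral := integral_mul_le_mul_eLpNorm_one (μ := grandMeasure α)
    (fun η => hB (η 0)) (integrable_of_mem_boundedMeasurable
    (totalDiff_permute_mem_boundedMeasurable h_unif h_bdd (finite_rotation_ne i j)))
  rw [integral_site_mul_totalDiff_rotation α hh_bdd hh_local hψ_bdd hji.symm] at h_integral
  rw [ENNReal.toReal_mul] at h_toReal
  have hB_nonneg : 0 ≤ B := (abs_nonneg _).trans (hB SiteState.empty)
  nlinarith [mul_le_mul_of_nonneg_left h_toReal hB_nonneg]

end HoleSearch

/-! ### The spaces of germs -/

lemma topologicalClosure_sup_of_finiteDimensional {V : Type*} [NormedAddCommGroup V]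
    [NormedSpace ℝ V] (S J : Submodule ℝ V) [FiniteDimensional ℝ J] :
    (S ⊔ J).topologicalClosure = S.topologicalClosure ⊔ J :=
  le_antisymm
    (Submodule.topologicalClosure_minimal _ (sup_le_sup_right S.le_topologicalClosure J)
      (Submodule.isClosed_sup_finiteDimensional _ _ S.isClosed_topologicalClosure))
    (sup_le (Submodule.topologicalClosure_mono le_sup_left)
      (le_sup_right.trans (Submodule.le_topologicalClosure _)))

section AEClasses

variable {X E : Type*} [MeasurableSpace X] [NormedAddCommGroup E] [NormedSpace ℝ E] {p : ℝ≥0∞}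
  {μ : Measure X} {V W : Submodule ℝ (X → E)} {A : Set (X → E)} {f : X → E} {g : Lp E p μ}

/-- The elements of `L^p` with a representative in a given space of functions. -/
def aeClasses (W : Submodule ℝ (X → E)) (p : ℝ≥0∞) (μ : Measure X) : Submodule ℝ (Lp E p μ) where
  carrier := {g | ∃ f ∈ W, g =ᵐ[μ] f}
  zero_mem' := ⟨0, W.zero_mem, Lp.coeFn_zero E p μ⟩
  add_mem' := fun {g g'} ⟨f, hf, hgf⟩ ⟨f', hf', hgf'⟩ =>
    ⟨f + f', add_mem hf hf', (Lp.coeFn_add g g').trans (hgf.add hgf')⟩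
  smul_mem' := fun a g ⟨f, hf, hgf⟩ =>
    ⟨a • f, W.smul_mem a hf, (Lp.coeFn_smul a g).trans (hgf.const_smul a)⟩

lemma mem_aeClasses : g ∈ aeClasses W p μ ↔ ∃ f ∈ W, g =ᵐ[μ] f := Iff.rfl

lemma aeClasses_span (hA : ∀ f ∈ A, MemLp f p μ) :
    aeClasses (Submodule.span ℝ A) p μ =
      Submodule.span ℝ {g : Lp E p μ | ∃ f ∈ A, g =ᵐ[μ] f} := by
  have h_class (f : X → E) (hf : f ∈ Submodule.span ℝ A) :
      ∃ g ∈ Submodule.span ℝ {g : Lp E p μ | ∃ f ∈ A, g =ᵐ[μ] f}, g =ᵐ[μ] f := by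
    induction hf using Submodule.span_induction with
    | mem f hf =>
      have h_coe := (hA f hf).coeFn_toLp
      exact ⟨_, Submodule.subset_span ⟨f, hf, h_coe⟩, h_coe⟩
    | zero => exact ⟨0, zero_mem _, Lp.coeFn_zero E p μ⟩
    | add f f' _ _ ih ih' =>
      obtain ⟨g, hg, hgf⟩ := ih
      obtain ⟨g', hg', hgf'⟩ := ih'
      exact ⟨g + g', add_mem hg hg', (Lp.coeFn_add g g').trans (hgf.add hgf')⟩
    | smul a f _ ih =>
      obtain ⟨g, hg, hgf⟩ := ih
      exact ⟨a • g, Submodule.smul_mem _ a hg, (Lp.coeFn_smul a g).trans (hgf.const_smul a)⟩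
  refine le_antisymm ?_ (Submodule.span_le.2 fun g ⟨f, hf, hg⟩ =>
    ⟨f, Submodule.subset_span hf, hg⟩)
  rintro g ⟨f, hf, hg⟩
  obtain ⟨g', hg', hgf'⟩ := h_class f hf
  rwa [Lp.ext (hg.trans hgf'.symm)]

lemma aeClasses_sup (hV : ∀ f ∈ V, MemLp f p μ) (hW : ∀ f ∈ W, MemLp f p μ) :
    aeClasses (V ⊔ W) p μ = aeClasses V p μ ⊔ aeClasses W p μ := by
  have h_mono {V W : Submodule ℝ (X → E)} (hVW : V ≤ W) : aeClasses V p μ ≤ aeClasses W p μ :=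
    fun g ⟨f, hf, hg⟩ => ⟨f, hVW hf, hg⟩
  refine le_antisymm ?_ (sup_le (h_mono le_sup_left) (h_mono le_sup_right))
  rintro g ⟨f, hf, hg⟩
  obtain ⟨v, hv, w, hw, rfl⟩ := Submodule.mem_sup.1 hf
  have hv_coe := (hV v hv).coeFn_toLp
  have hw_coe := (hW w hw).coeFn_toLp
  rw [Lp.ext (hg.trans ((Lp.coeFn_add _ _).trans (hv_coe.add hw_coe)).symm)]
  exact Submodule.add_mem_sup ⟨v, hv, hv_coe⟩ ⟨w, hw, hw_coe⟩

end AEClasses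

section Germs

variable {ω : Angle → ℝ} {α : GrandParam} {g : L2 α} {ψ : Fin 2 → SiteState → ℝ}

/-- The space of the germs `∇Σ_h`, without the condition that `h` is centred. -/
def gradients (ω : Angle → ℝ) : Submodule ℝ (Config → EuclideanSpace ℝ (Fin 2)) where
  carrier := gradSum '' weightedSpan ω
  zero_mem' := ⟨0, zero_mem _, gradSum_zero⟩
  add_mem' := by
    rintro _ _ ⟨h, hh, rfl⟩ ⟨k, hk, rfl⟩
    exact ⟨h + k, add_mem hh hk,
      gradSum_add (isLocal_of_mem_weightedSpan hh) (isLocal_of_mem_weightedSpan hk)⟩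
  smul_mem' := by
    rintro a _ ⟨h, hh, rfl⟩
    exact ⟨a • h, Submodule.smul_mem _ a hh, gradSum_smul a h⟩

/-- The map `ψ ↦ current ψ`. -/
def currentLinearMap :
    (Fin 2 → SiteState → ℝ) →ₗ[ℝ] Config → EuclideanSpace ℝ (Fin 2) where
  toFun := current
  map_add' ψ φ := by
    funext η
    ext i
    simp only [current_apply, PiLp.add_apply, Pi.add_apply, add_mul]
  map_smul' a ψ := by
    funext η
    ext i
    simp only [current_apply, PiLp.smul_apply, Pi.smul_apply, smul_eq_mul, mul_assoc,
      RingHom.id_apply]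

/-- The space of the germs of currents. -/
def currents (ω : Angle → ℝ) : Submodule ℝ (Config → EuclideanSpace ℝ (Fin 2)) :=
  (Submodule.pi Set.univ fun _ => siteSpan ω).map currentLinearMap

lemma mem_currents {f : Config → EuclideanSpace ℝ (Fin 2)} :
    f ∈ currents ω ↔ ∃ ψ : Fin 2 → SiteState → ℝ, (∀ i, ψ i ∈ siteSpan ω) ∧ current ψ = f := by
  simp only [currents, Submodule.mem_map, Submodule.mem_pi, Set.mem_univ, forall_const]
  rfl

lemma currentGerm_eq_current (σ : Species) (Φ : Angle → ℝ) (i : Fin 2) :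
    currentGerm σ Φ i = current (Pi.single i fun s => Φ s.1.2 * s.count σ) := by
  funext η
  ext m
  rcases eq_or_ne m i with rfl | h_ne
  · simp [currentGerm, current_apply, numW, num]
  · simp [currentGerm, current_apply, h_ne]

lemma currents_eq_span (ω : Angle → ℝ) : currents ω = Submodule.span ℝ
    {f | ∃ σ i, f = currentGerm σ (fun _ => 1) i ∨ f = currentGerm σ ω i} := by
  rw [currents, ← Submodule.iSup_map_single, Submodule.map_iSup]
  simp only [siteSpan, Submodule.map_span, ← Submodule.span_iUnion]
  congr 1
  ext f
  simp only [Set.mem_iUnion, Set.mem_image, Set.mem_ofPred_eq, currentGerm_eq_current, one_mul]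
  constructor
  · rintro ⟨i, _, ⟨_, ⟨σ, rfl | rfl⟩, rfl⟩, rfl⟩
    exacts [⟨σ, i, .inl rfl⟩, ⟨σ, i, .inr rfl⟩]
  · rintro ⟨σ, i, rfl | rfl⟩
    exacts [⟨i, _, ⟨_, ⟨σ, .inl rfl⟩, rfl⟩, rfl⟩, ⟨i, _, ⟨_, ⟨σ, .inr rfl⟩, rfl⟩, rfl⟩]

lemma memLp_of_mem_gradients (hω : IsC2 ω) (α : GrandParam)
    {f : Config → EuclideanSpace ℝ (Fin 2)} (hf : f ∈ gradients ω) :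
    MemLp f 2 (grandMeasure α) := by
  obtain ⟨h, hh, rfl⟩ := hf
  exact memLp_of_mem_weightedSpan hω α (gradSum_mem_weightedSpan hh)

lemma memLp_of_mem_currents (hω : IsC2 ω) (α : GrandParam)
    {f : Config → EuclideanSpace ℝ (Fin 2)} (hf : f ∈ currents ω) :
    MemLp f 2 (grandMeasure α) := by
  obtain ⟨ψ, hψ, rfl⟩ := mem_currents.1 hf
  exact memLp_of_mem_weightedSpan hω α (current_mem_weightedSpan hψ)

lemma currentForms_eq_aeClasses (hω : IsC2 ω) (α : GrandParam) :
    currentForms α ω = aeClasses (currents ω) 2 (grandMeasure α) := by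
  have h_memLp (f) (hf : f ∈ currents ω) := memLp_of_mem_currents hω α hf
  rw [currents_eq_span] at h_memLp ⊢
  rw [aeClasses_span fun f hf => h_memLp f (Submodule.subset_span hf), currentForms]
  congr 1
  ext g
  constructor
  · rintro ⟨σ, i, hg | hg⟩
    exacts [⟨_, ⟨σ, i, .inl rfl⟩, hg⟩, ⟨_, ⟨σ, i, .inr rfl⟩, hg⟩]
  · rintro ⟨_, ⟨σ, i, rfl | rfl⟩, hg⟩
    exacts [⟨σ, i, .inl hg⟩, ⟨σ, i, .inr hg⟩]

lemma closedGerms_eq_aeClasses (hω : IsC2 ω) (α : GrandParam) :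
    closedGerms α ω = (aeClasses (gradients ω ⊔ currents ω) 2 (grandMeasure α) : Set (L2 α)) := by
  ext g
  simp only [closedGerms, Tω_eq_weightedSpan hω, Set.mem_ofPred_eq, SetLike.mem_coe, mem_aeClasses]
  constructor
  · rintro ⟨U, hU, hUω, hg⟩
    obtain ⟨h, hh, ψ, hψ, rfl⟩ := hU.eq_germ hω hUω
    exact ⟨_, Submodule.add_mem_sup ⟨h, hh, rfl⟩ (mem_currents.2 ⟨ψ, hψ, rfl⟩), hg⟩
  · rintro ⟨f, hf, hg⟩
    obtain ⟨_, ⟨h, hh, rfl⟩, _, hψ', rfl⟩ := Submodule.mem_sup.1 hf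
    obtain ⟨ψ, hψ, rfl⟩ := mem_currents.1 hψ'
    exact ⟨germ h ψ, isClosedGerm_germ hω α hh hψ, germ_mem_weightedSpan hh hψ, hg⟩

lemma closedGerms_eq_sup (hω : IsC2 ω) (α : GrandParam) : closedGerms α ω =
    (aeClasses (gradients ω) 2 (grandMeasure α) ⊔ currentForms α ω : Submodule ℝ (L2 α)) := by
  rw [closedGerms_eq_aeClasses hω, currentForms_eq_aeClasses hω, aeClasses_sup
    (fun _ => memLp_of_mem_gradients hω α) (fun _ => memLp_of_mem_currents hω α)]

instance : Finite Species :=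
  .of_surjective (fun b => cond b .active .passive)
    fun | .active => ⟨true, rfl⟩ | .passive => ⟨false, rfl⟩

instance finiteDimensional_currentForms (α : GrandParam) (ω : Angle → ℝ) :
    FiniteDimensional ℝ (currentForms α ω) := by
  have h_finite (Φ : Angle → ℝ) : {g : L2 α | ∃ p : Species × Fin 2,
      g =ᵐ[grandMeasure α] currentGerm p.1 Φ p.2}.Finite := by
    rw [Set.ofPred_exists]
    exact Set.finite_iUnion fun p => Set.Subsingleton.finite fun g hg g' hg' =>
      Lp.ext (Filter.EventuallyEq.trans hg (Filter.EventuallyEq.symm hg'))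
  refine FiniteDimensional.span_of_finite ℝ
    (((h_finite fun _ => 1).union (h_finite ω)).subset ?_)
  rintro g ⟨σ, i, hg | hg⟩
  exacts [.inl ⟨(σ, i), hg⟩, .inr ⟨(σ, i), hg⟩]

lemma closure_exactGerms (hω : IsC2 ω) (α : GrandParam) : closure (exactGerms α ω) =
    closure (aeClasses (gradients ω) 2 (grandMeasure α) : Set (L2 α)) := by
  refine subset_antisymm (closure_mono ?_) (closure_minimal ?_ isClosed_closure)
  · rintro g ⟨h, -, hT, hg⟩
    exact ⟨_, ⟨h, Tω_eq_weightedSpan hω ▸ hT, rfl⟩, hg⟩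
  · rintro g ⟨_, ⟨h, hh, rfl⟩, hg⟩
    refine Metric.mem_closure_iff.2 fun ε hε => ?_
    obtain ⟨f, hfω, hf_centered, hf⟩ := exists_centered_approx hω hh (show 0 < ε / 4 by positivity)
    have hL := memLp_of_mem_weightedSpan hω α (gradSum_mem_weightedSpan hfω)
    refine ⟨hL.toLp _, ⟨f, hf_centered, (Tω_eq_weightedSpan hω).symm ▸ hfω, hL.coeFn_toLp⟩, ?_⟩
    have h_bound : ∀ᵐ η ∂grandMeasure α, ‖(g - hL.toLp _) η‖ ≤ ε / 2 := by
      filter_upwards [Lp.coeFn_sub g (hL.toLp _), hg, hL.coeFn_toLp] with η h_sub hg hL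
      rw [h_sub, Pi.sub_apply, hg, hL, EuclideanSpace.norm_eq, Fin.sum_univ_two]
      refine Real.sqrt_le_iff.2 ⟨by positivity, ?_⟩
      have h_sq (i : Fin 2) : ‖(gradSum h η - gradSum f η) i‖ ^ 2 ≤ (ε / 4) ^ 2 :=
        pow_le_pow_left₀ (norm_nonneg _) (hf η i) 2
      nlinarith [h_sq 0, h_sq 1]
    have h_norm := Lp.norm_le_of_ae_bound (half_pos hε).le h_bound
    rw [measureUnivNNReal, measure_univ, ENNReal.toNNReal_one, NNReal.coe_one, Real.one_rpow,
      one_mul] at h_norm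
    rw [dist_eq_norm]
    linarith

lemma ae_ne_empty_of_density_eq_one (hα : density α = 1) (x : Z2) :
    ∀ᵐ η ∂grandMeasure α, η x ≠ SiteState.empty := by
  have h_site : ∀ᵐ s ∂siteMeasure α, s ≠ SiteState.empty := by
    rw [ae_iff]
    exact (prob_compl_eq_zero_iff measurableSet_ne_empty).2 hα
  exact (measurePreserving_eval_infinitePi (fun _ => siteMeasure α) x).quasiMeasurePreserving.ae
    h_site

lemma integral_sq_eq_zero_of_mem_closure (hω : IsC2 ω) (hα : density α < 1)
    (hψ : ∀ i, ψ i ∈ siteSpan ω) (hgψ : g =ᵐ[grandMeasure α] current ψ)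
    (hg : g ∈ closure (aeClasses (gradients ω) 2 (grandMeasure α) : Set (L2 α))) (i : Fin 2) :
    ∫ η, (ψ i (η 0) - ψ i (η (e i))) ^ 2 ∂grandMeasure α = 0 := by
  obtain ⟨C, hC⟩ := exists_integral_sq_le hω hα hψ i
  set v := ∫ η, (ψ i (η 0) - ψ i (η (e i))) ^ 2 ∂grandMeasure α
  have h_closed : IsClosed {f : L2 α | v ≤ C * dist g f} := isClosed_le (by fun_prop) (by fun_prop)
  have h_gradients : (aeClasses (gradients ω) 2 (grandMeasure α) : Set (L2 α)) ⊆
      {f | v ≤ C * dist g f} := by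
    rintro f ⟨_, ⟨h, hh, rfl⟩, hf⟩
    have h_germ : (g - f : L2 α) =ᵐ[grandMeasure α] germ (-h) ψ := by
      filter_upwards [Lp.coeFn_sub g f, hgψ, hf] with η h_sub hgψ hf
      rw [h_sub, Pi.sub_apply, hgψ, hf, germ, ← neg_one_smul ℝ h, gradSum_smul, neg_one_smul,
        Pi.neg_apply, neg_add_eq_sub]
    rw [Set.mem_ofPred_eq, dist_eq_norm, Lp.norm_def, eLpNorm_congr_ae h_germ]
    exact hC (-h) (neg_mem hh)
  have h_self : v ≤ C * dist g g := closure_minimal h_gradients h_closed hg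
  rw [dist_self, mul_zero] at h_self
  exact h_self.antisymm (integral_nonneg fun η => sq_nonneg _)

lemma current_ae_eq_zero_of_mem_closure (hω : IsC2 ω) (hψ : ∀ i, ψ i ∈ siteSpan ω)
    (hgψ : g =ᵐ[grandMeasure α] current ψ)
    (hg : g ∈ closure (aeClasses (gradients ω) 2 (grandMeasure α) : Set (L2 α))) (i : Fin 2) :
    ∀ᵐ η ∂grandMeasure α, current ψ η i = 0 := by
  rcases (prob_le_one : density α ≤ 1).eq_or_lt with hα | hα
  · filter_upwards [ae_ne_empty_of_density_eq_one hα (e i)] with η hη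
    rw [current_apply, occ_of_ne_empty hη, sub_self, mul_zero]
  have h_bdd := siteSpan_le_boundedMeasurable hω (hψ i)
  have h_sub : (fun η : Config => ψ i (η 0) - ψ i (η (e i))) ∈ boundedMeasurable Config :=
    sub_mem (site_mem_boundedMeasurable h_bdd 0) (site_mem_boundedMeasurable h_bdd (e i))
  have h_ae := (integral_eq_zero_iff_of_nonneg (fun η => sq_nonneg _)
    (integrable_of_mem_boundedMeasurable (pow_mem h_sub 2))).1
    (integral_sq_eq_zero_of_mem_closure hω hα hψ hgψ hg i)
  filter_upwards [h_ae] with η hη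
  have h_eq : ψ i (η 0) = ψ i (η (e i)) := sub_eq_zero.1 (pow_eq_zero_iff two_ne_zero |>.1 hη)
  rw [current_apply, h_eq]
  by_cases h_empty : η (e i) = SiteState.empty
  · rw [h_empty, siteSpan_empty (hψ i), zero_mul]
  · rw [occ_of_ne_empty h_empty, sub_self, mul_zero]

lemma disjoint_closure_gradients_currentForms (hω : IsC2 ω) (α : GrandParam) :
    Disjoint (aeClasses (gradients ω) 2 (grandMeasure α)).topologicalClosure
      (currentForms α ω) := by
  refine Submodule.disjoint_def.2 fun g hg h_current => ?_
  rw [currentForms_eq_aeClasses hω] at h_current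
  obtain ⟨f, hf, hgψ⟩ := h_current
  obtain ⟨ψ, hψ, rfl⟩ := mem_currents.1 hf
  have h_zero := ae_all_iff.2 (current_ae_eq_zero_of_mem_closure hω hψ hgψ hg)
  rw [Lp.eq_zero_iff_ae_eq_zero]
  filter_upwards [hgψ, h_zero] with η hη h_zero
  rw [hη]
  ext i
  exact h_zero i

end Germs

end ActivePassive

end

theorem proposition5p1 (α : GrandParam) (ω : Angle → ℝ) (hω : IsC2 ω) :
    ∃ T E : Submodule ℝ (L2 α),
      (T : Set (L2 α)) = closure (closedGerms α ω) ∧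
      (E : Set (L2 α)) = closure (exactGerms α ω) ∧
      E ⊔ currentForms α ω = T ∧
      Disjoint E (currentForms α ω) := by
  set S := aeClasses (gradients ω) 2 (grandMeasure α)
  refine ⟨(S ⊔ currentForms α ω).topologicalClosure, S.topologicalClosure, ?_, ?_, ?_, ?_⟩
  · rw [closedGerms_eq_sup hω, Submodule.topologicalClosure_coe]
  · rw [closure_exactGerms hω, Submodule.topologicalClosure_coe]
  · rw [topologicalClosure_sup_of_finiteDimensional]
  · exact disjoint_closure_gradients_currentForms hω α
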